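/- Let $0<\alpha<1$, $\delta>0$, and let $\rho_\delta(s)=(1-\alpha)\delta^{\alpha-1}s^{-\alpha}$ for $s\in(0,\delta)$. Consider the nonlocal-in-time diffusion equation on the real line with Dirac history, $$\int_0^\delta \frac{u(x,t)-u(x,t-s)}{s}\,\rho_\delta(s)\,ds-\partial_{xx}u(x,t)=0\quad (x\in\mathbb R,\ t>0),\qquad u(\cdot,t)=\delta_0\quad (t\in(-\delta,0)),$$ where $\delta_0$ is the Dirac mass at $x=0$. A fundamental solution is a function $u(x,t)$, continuous on $\mathbb R\times(0,\infty)$, with $\sup_{t>0}\int_{\mathbb R}|u(x,t)|\,dx<\infty$, which solves the equation in the sense of distributions on $\mathbb R\times(0,\infty)$: for every real $\varphi\in C_c^\infty(\mathbb R\times(0,\infty))$ (extended by zero), $$\int_{-\delta}^0 (\mathcal G_\delta^*\varphi)(0,t)\,dt+\int_0^\infty\!\!\int_{\mathbb R}u(x,t)\big[(\mathcal G_\delta^*\varphi)(x,t)-\partial_{xx}\varphi(x,t)\big]dx\,dt=0,$$ $$(\mathcal G_\delta^*\varphi)(x,t)=\int_0^\delta\frac{\varphi(x,t)-\varphi(x,t+s)}{s}\,\rho_\delta(s)\,ds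 .$$ Put $K(z)=\int_0^\delta(1-e^{-zs})\,s^{-1}\rho_\delta(s)\,ds$. Then a fundamental solution exists, and every fundamental solution $u$ satisfies the following, where $f\approx g$ means $f/g\to1$. 1. For every $z>0$ the Laplace transform $\widehat u(0,z)=\int_0^\infty e^{-zt}u(0,t)\,dt$ converges absolutely and $$\widehat u(0,z)=\frac{\sqrt{K(z)}}{2z}.$$ It is strictly decreasing in $z>0$, with $\widehat u(0,z)\approx\sqrt{\frac{\Gamma(2-\alpha)}{4\alpha\delta^{1-\alpha}}}\,z^{\alpha/2-1}$ as $z\to\infty$ and $\widehat u(0,z)\approx\frac12z^{-1/2}$ as $z\to0^+$. 2. As $t\to0^+$, $$u(0,t)\approx\frac{\sqrt{\Gamma(2-\alpha)}}{\sqrt{4\alpha\delta^{1-\alpha}}\;\Gamma(1-\alpha/2)}\,t^{-\alpha/2}.$$ This is the rate of fractional sub-diffusion: $u(0,t)\approx c_\delta\,u_\infty(0,t)$ with $c_\delta=\sqrt{\Gamma(2-\alpha)\delta^{\alpha-1}\alpha^{-1}}$, where $u_\infty(x,t)=\frac12t^{-\alpha/2}M_{\alpha/2}(|x|/t^{\alpha/2})$,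 $M_\nu(y)=\sum_{n\ge0}\frac{(-y)^n}{n!\,\Gamma(1-\nu-\nu n)}$, is the fundamental solution of $\partial_t^\alpha u=\partial_{xx}u$. 3. As $t\to\infty$, $u(0,t)\approx\frac1{\sqrt{4\pi t}}$, which is the value at $x=0$ of the heat kernel $u_0(x,t)=\frac{1}{\sqrt{4\pi t}}e^{-x^2/4t}$. -/

import Mathlib

open Set Filter Topology MeasureTheory Asymptotics
open scoped ContDiff

noncomputable section

/-- The normalised memory kernel of fractional type,
`ρ_δ(s) = (1 - α) δ^(α - 1) s^(-α)`, used only for `s ∈ (0, δ)`. -/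
def fracKernel (α δ s : ℝ) : ℝ := (1 - α) * δ ^ (α - 1) * s ^ (-α)

/-- The formal adjoint in time of the nonlocal operator
`(G_δ v)(t) = ∫_0^δ (v(t) - v(t - s)) / s * ρ(s) ds`, acting on a test function of time:
`(G_δ^* ψ)(t) = ∫_0^δ (ψ(t) - ψ(t + s)) / s * ρ(s) ds`. For an integrable kernel and a `C¹`
compactly supported `ψ` the integral converges absolutely. -/
def nonlocalAdjoint (δ : ℝ) (ρ : ℝ → ℝ) (ψ : ℝ → ℝ) (t : ℝ) : ℝ :=
  ∫ s in (0 : ℝ)..δ, (ψ t - ψ (t + s)) / s * ρ s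

/-- `u` (a function of `x` and `t`, relevant for `t > 0` only) is a fundamental solution of
`G_δ u - ∂ₓₓ u = 0` for `t > 0` on the real line, with the history `u(·, t) = ` Dirac mass at `0`
for `t ∈ (-δ, 0)`: it is continuous for `t > 0`, has uniformly bounded mass, and solves the
equation in the sense of distributions on `{t > 0}`, where the history is paired with
`G_δ^* φ` as a Dirac mass in `x`. -/
structure IsFundamentalSolution (δ : ℝ) (ρ : ℝ → ℝ) (u : ℝ → ℝ → ℝ) : Prop where
  continuousOn : ContinuousOn (fun p : ℝ × ℝ => u p.1 p.2) {p : ℝ × ℝ | 0 < p.2}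
  integrable : ∀ t : ℝ, 0 < t → Integrable (fun x : ℝ => u x t)
  bounded_mass : ∃ M : ℝ, ∀ t : ℝ, 0 < t → ∫ x : ℝ, |u x t| ≤ M
  weak_eq : ∀ φ : ℝ × ℝ → ℝ, ContDiff ℝ ∞ φ → HasCompactSupport φ →
    tsupport φ ⊆ {p : ℝ × ℝ | 0 < p.2} →
    (∫ t in (-δ)..(0 : ℝ), nonlocalAdjoint δ ρ (fun r => φ (0, r)) t) +
      (∫ t in Ioi (0 : ℝ), ∫ x : ℝ, u x t *
        (nonlocalAdjoint δ ρ (fun r => φ (x, r)) t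
          - iteratedDeriv 2 (fun y => φ (y, t)) x)) = 0

/-- The symbol `K(z) = ∫_0^δ (1 - e^(-z s)) s⁻¹ ρ(s) ds` of the nonlocal operator. -/
def memorySymbol (δ : ℝ) (ρ : ℝ → ℝ) (z : ℝ) : ℝ :=
  ∫ s in (0 : ℝ)..δ, (1 - Real.exp (-z * s)) * s⁻¹ * ρ s

/-- The Laplace transform at a real argument. -/
def laplaceTransform (f : ℝ → ℝ) (z : ℝ) : ℝ :=
  ∫ t in Ioi (0 : ℝ), Real.exp (-z * t) * f t

/-- The Gaussian fundamental solution of the heat equation on the real line. -/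
def heatKernel (x t : ℝ) : ℝ := 1 / Real.sqrt (4 * Real.pi * t) * Real.exp (-x ^ 2 / (4 * t))

/-- Mainardi's function `M_ν(y) = ∑ₙ (-y)ⁿ / (n! Γ(1 - ν - ν n))`, for `0 < ν < 1`
(with `1 / Γ = 0` at the poles of `Γ`, as in Mathlib's convention). -/
def mainardiM (ν y : ℝ) : ℝ :=
  ∑' n : ℕ, (-y) ^ n / ((n.factorial : ℝ) * Real.Gamma (1 - ν - ν * n))

/-- The fundamental solution `(1/2) t^(-α/2) M_{α/2}(|x| / t^(α/2))` of the fractional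
sub-diffusion equation `∂_t^α u = ∂ₓₓ u` on the real line. -/
def subdiffusionKernel (α x t : ℝ) : ℝ :=
  1 / 2 * t ^ (-(α / 2)) * mainardiM (α / 2) (|x| / t ^ (α / 2))

end

/-! A Fourier transform in `x` turns the problem, at frequency `k` and with `l = k ^ 2`, into a
scalar relaxation equation `∫ (v(t) - v(t - s)) dν(s) + l v(t) = 0` for `t > 0` with `v = 1` for `t
≤ 0`, where `dν = ρ_δ(s) / s ds` is an infinite jump measure on `(0, δ)`. For finite `ν` a monotone
Picard iteration solves it; truncating the small jumps and taking an increasing limit gives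
`relaxFun` for the true `ν`. This function is nonincreasing in `t`, takes values in `[0, 1]`, decays
like `1 / l`, and has Laplace transform `K / (z (K + l))`.

Existence. `fundKernel` is the inverse cosine transform of `k ↦ relaxFun ν δ (k ^ 2) t`. Its sign
comes from the iteration: each Picard step averages products with resolvents `1 / (m + k ^ 2)`,
which are mixtures of Gaussians, so positivity of Gaussian-regularised cosine transforms is
inherited (`gaussPos_relaxIter`). Positivity together with `relaxFun ≤ 1` bounds the mass by `1`.
The weak equation `fundKernel_weak_eq` is the superposition over `k` of the scalar equations; for `t
≤ 0` the regularised kernel is a Gaussian concentrating at `0`, which produces the Dirac history.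

Uniqueness. The difference of two solutions solves the homogeneous equation. Tested against cut-off
versions of `e(x) exp(-z t)`, with `e` a sine or cosine, it gives `K(z) + κ > 0` times a space-time
Laplace transform, which therefore vanishes. Laplace uniqueness, Fourier inversion and continuity
give `eq_zero_of_weak_eq`. So every fundamental solution equals `fundKernel` for `t > 0`.

Asymptotics. Integrating `K / (z (K + k ^ 2))` over `k` gives `√K / (2 z)` at `x = 0`. The symbol
satisfies `K(z) ~ z` at `0`, since `ρ_δ` has integral one, and `K(z) ~ Γ(2 - α) / (α δ ^ (1 - α)) z
^ α` at infinity. As `fundKernel ν δ 0` is nonincreasing in time, Karamata's theorem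
`tendsto_of_laplaceTransform` transfers both behaviours from `z` to `t = 1 / z`. -/

noncomputable section

/-! ### The relaxation equation for a finite jump measure. -/

/-- Picard iteration, started from `1`, for the relaxation equation
`∫ (v(t) - v(t - s)) dμ(s) + l v(t) = 0` for `t > 0` with history `1`. -/
def relaxIter (μ : Measure ℝ) : ℕ → ℝ → ℝ → ℝ
  | 0, _, _ => 1
  | k + 1, l, t =>
    if t ≤ 0 then 1 else (μ.real univ + l)⁻¹ * ∫ s, relaxIter μ k l (t - s) ∂μ

/-- The solution of the relaxation equation with finite jump measure `μ` and history `1`. -/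
def relaxApprox (μ : Measure ℝ) (l t : ℝ) : ℝ := ⨅ k, relaxIter μ k l t

lemma relaxIter_succ (μ : Measure ℝ) (k : ℕ) (l t : ℝ) :
    relaxIter μ (k + 1) l t =
      if t ≤ 0 then 1 else (μ.real univ + l)⁻¹ * ∫ s, relaxIter μ k l (t - s) ∂μ := rfl

lemma relaxIter_of_nonpos (μ : Measure ℝ) (k : ℕ) (l : ℝ) {t : ℝ} (ht : t ≤ 0) :
    relaxIter μ k l t = 1 := by
  cases k with
  | zero => rfl
  | succ k => rw [relaxIter_succ, if_pos ht]

lemma measurable_relaxIter (μ : Measure ℝ) [IsFiniteMeasure μ] (k : ℕ) :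
    Measurable (fun p : ℝ × ℝ => relaxIter μ k p.1 p.2) := by
  induction k with
  | zero => exact measurable_const
  | succ k ih =>
    simp only [relaxIter_succ]
    refine Measurable.ite (measurableSet_le measurable_snd measurable_const) measurable_const ?_
    refine Measurable.mul (by fun_prop) ?_
    have h : Measurable (fun q : (ℝ × ℝ) × ℝ => relaxIter μ k q.1.1 (q.1.2 - q.2)) :=
      ih.comp (f := fun q : (ℝ × ℝ) × ℝ => (q.1.1, q.1.2 - q.2)) (by fun_prop)
    exact h.stronglyMeasurable.integral_prod_right'.measurable

lemma integral_mem_Icc_of_mem_Icc {μ : Measure ℝ} [IsFiniteMeasure μ] {f : ℝ → ℝ}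
    (h0 : ∀ s, 0 ≤ f s) (h1 : ∀ s, f s ≤ 1) {l : ℝ} (hl : 0 ≤ l) :
    0 ≤ (μ.real univ + l)⁻¹ * ∫ s, f s ∂μ ∧ (μ.real univ + l)⁻¹ * ∫ s, f s ∂μ ≤ 1 := by
  have hm : 0 ≤ μ.real univ := measureReal_nonneg
  refine ⟨mul_nonneg (by positivity) (integral_nonneg h0), ?_⟩
  have h2 : ∫ s, f s ∂μ ≤ μ.real univ := by
    have := integral_mono_of_nonneg (μ := μ) (Eventually.of_forall h0)
      (integrable_const (1 : ℝ)) (Eventually.of_forall h1)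
    simpa using this
  -- If the mass and `l` both vanish, the convention `0⁻¹ = 0` makes the quantity zero.
  rcases (add_nonneg hm hl).eq_or_lt with h | h
  · rw [← h]; simp
  · rw [inv_mul_le_iff₀ h]; linarith

lemma relaxIter_mem (μ : Measure ℝ) [IsFiniteMeasure μ] (k : ℕ) {l : ℝ} (hl : 0 ≤ l) (t : ℝ) :
    0 ≤ relaxIter μ k l t ∧ relaxIter μ k l t ≤ 1 := by
  induction k generalizing t with
  | zero => simp [relaxIter]
  | succ k ih =>
    rw [relaxIter_succ]
    split_ifs
    · simp
    · exact integral_mem_Icc_of_mem_Icc (fun s => (ih (t - s)).1) (fun s => (ih (t - s)).2) hl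

lemma integrable_of_measurable_of_mem_Icc {μ : Measure ℝ} [IsFiniteMeasure μ] {f : ℝ → ℝ}
    (hf : Measurable f) (h0 : ∀ s, 0 ≤ f s) (h1 : ∀ s, f s ≤ 1) : Integrable f μ :=
  Integrable.of_bound hf.aestronglyMeasurable 1
    (Eventually.of_forall fun s => by rw [Real.norm_eq_abs, abs_of_nonneg (h0 s)]; exact h1 s)

lemma integrable_relaxIter (μ : Measure ℝ) [IsFiniteMeasure μ] (k : ℕ) {l : ℝ} (hl : 0 ≤ l)
    (t : ℝ) : Integrable (fun s => relaxIter μ k l (t - s)) μ :=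
  integrable_of_measurable_of_mem_Icc
    ((measurable_relaxIter μ k).comp (f := fun s => (l, t - s)) (by fun_prop))
    (fun s => (relaxIter_mem μ k hl _).1) (fun s => (relaxIter_mem μ k hl _).2)

lemma antitone_relaxIter (μ : Measure ℝ) [IsFiniteMeasure μ] (k : ℕ) {l : ℝ} (hl : 0 ≤ l) :
    Antitone (relaxIter μ k l) := by
  induction k with
  | zero => intro a b _; exact le_rfl
  | succ k ih =>
    intro a b hab
    by_cases ha : a ≤ 0
    · rw [relaxIter_of_nonpos μ _ l ha]
      exact (relaxIter_mem μ _ hl b).2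
    · rw [relaxIter_succ, relaxIter_succ, if_neg ha, if_neg (by linarith)]
      have hm : 0 ≤ μ.real univ := measureReal_nonneg
      refine mul_le_mul_of_nonneg_left ?_ (by positivity)
      exact integral_mono (integrable_relaxIter μ k hl b) (integrable_relaxIter μ k hl a)
        fun s => ih (by linarith)

/-- The starting value `1` is the largest admissible one and the Picard step preserves order, so the
iterates decrease and their infimum is a limit. -/
lemma relaxIter_succ_le (μ : Measure ℝ) [IsFiniteMeasure μ] (k : ℕ) {l : ℝ} (hl : 0 ≤ l)
    (t : ℝ) : relaxIter μ (k + 1) l t ≤ relaxIter μ k l t := by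
  induction k generalizing t with
  | zero => exact (relaxIter_mem μ 1 hl t).2
  | succ k ih =>
    by_cases ht : t ≤ 0
    · rw [relaxIter_of_nonpos μ _ l ht, relaxIter_of_nonpos μ _ l ht]
    · rw [relaxIter_succ, relaxIter_succ, if_neg ht, if_neg ht]
      have hm : 0 ≤ μ.real univ := measureReal_nonneg
      refine mul_le_mul_of_nonneg_left ?_ (by positivity)
      exact integral_mono (integrable_relaxIter μ _ hl t) (integrable_relaxIter μ k hl t)
        fun s => ih _

lemma tendsto_relaxIter (μ : Measure ℝ) [IsFiniteMeasure μ] {l : ℝ} (hl : 0 ≤ l) (t : ℝ) :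
    Tendsto (fun k => relaxIter μ k l t) atTop (𝓝 (relaxApprox μ l t)) :=
  tendsto_atTop_ciInf (antitone_nat_of_succ_le fun k => relaxIter_succ_le μ k hl t)
    ⟨0, by rintro _ ⟨k, rfl⟩; exact (relaxIter_mem μ k hl t).1⟩

lemma relaxApprox_le_relaxIter (μ : Measure ℝ) [IsFiniteMeasure μ] {l : ℝ} (hl : 0 ≤ l) (k : ℕ)
    (t : ℝ) : relaxApprox μ l t ≤ relaxIter μ k l t :=
  ciInf_le ⟨0, by rintro _ ⟨k, rfl⟩; exact (relaxIter_mem μ k hl t).1⟩ k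

lemma relaxApprox_of_nonpos (μ : Measure ℝ) (l : ℝ) {t : ℝ} (ht : t ≤ 0) :
    relaxApprox μ l t = 1 := by
  simp [relaxApprox, relaxIter_of_nonpos μ _ l ht]

lemma relaxApprox_nonneg (μ : Measure ℝ) [IsFiniteMeasure μ] {l : ℝ} (hl : 0 ≤ l) (t : ℝ) :
    0 ≤ relaxApprox μ l t := le_ciInf fun k => (relaxIter_mem μ k hl t).1

lemma relaxApprox_le_one (μ : Measure ℝ) [IsFiniteMeasure μ] {l : ℝ} (hl : 0 ≤ l) (t : ℝ) :
    relaxApprox μ l t ≤ 1 :=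
  (relaxApprox_le_relaxIter μ hl 0 t).trans (relaxIter_mem μ 0 hl t).2

lemma measurable_relaxApprox (μ : Measure ℝ) [IsFiniteMeasure μ] :
    Measurable (fun p : ℝ × ℝ => relaxApprox μ p.1 p.2) :=
  Measurable.iInf fun k => measurable_relaxIter μ k

lemma antitone_relaxApprox (μ : Measure ℝ) [IsFiniteMeasure μ] {l : ℝ} (hl : 0 ≤ l) :
    Antitone (relaxApprox μ l) := fun _ _ hab =>
  le_of_tendsto_of_tendsto' (tendsto_relaxIter μ hl _) (tendsto_relaxIter μ hl _)
    fun k => antitone_relaxIter μ k hl hab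

lemma integrable_relaxApprox (μ ν : Measure ℝ) [IsFiniteMeasure μ] [IsFiniteMeasure ν] {l : ℝ}
    (hl : 0 ≤ l) (t : ℝ) : Integrable (fun s => relaxApprox μ l (t - s)) ν :=
  integrable_of_measurable_of_mem_Icc
    ((measurable_relaxApprox μ).comp (f := fun s => (l, t - s)) (by fun_prop))
    (fun s => relaxApprox_nonneg μ hl _) (fun s => relaxApprox_le_one μ hl _)

lemma relaxApprox_eq (μ : Measure ℝ) [IsFiniteMeasure μ] {l : ℝ} (hl : 0 ≤ l)
    (hm : 0 < μ.real univ) {t : ℝ} (ht : 0 < t) :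
    (μ.real univ + l) * relaxApprox μ l t = ∫ s, relaxApprox μ l (t - s) ∂μ := by
  have h1 : Tendsto (fun k => ∫ s, relaxIter μ k l (t - s) ∂μ) atTop
      (𝓝 (∫ s, relaxApprox μ l (t - s) ∂μ)) := by
    refine tendsto_integral_of_dominated_convergence (fun _ => (1 : ℝ))
      (fun k => (integrable_relaxIter μ k hl t).aestronglyMeasurable) (integrable_const _) ?_ ?_
    · intro k
      refine Eventually.of_forall fun s => ?_
      rw [Real.norm_eq_abs, abs_of_nonneg (relaxIter_mem μ k hl _).1]
      exact (relaxIter_mem μ k hl _).2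
    · exact Eventually.of_forall fun s => tendsto_relaxIter μ hl _
  have h2 : Tendsto (fun k => (μ.real univ + l) * relaxIter μ (k + 1) l t) atTop
      (𝓝 ((μ.real univ + l) * relaxApprox μ l t)) :=
    ((tendsto_relaxIter μ hl t).comp (tendsto_add_atTop_nat 1)).const_mul _
  refine tendsto_nhds_unique h2 (h1.congr fun k => ?_)
  rw [relaxIter_succ, if_neg (by linarith)]
  field_simp

/-- A solution `v` is nonincreasing, so the integrand `v(t - s) - v(t)` is nonnegative and its
integral grows with the measure. Hence the solution for `μ` is a subsolution for `μ'`, and the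
iteration for `μ'`, started at `1`, stays above it. -/
lemma relaxApprox_mono {μ μ' : Measure ℝ} [IsFiniteMeasure μ] [IsFiniteMeasure μ']
    (hle : μ ≤ μ') (hpos : ∀ᵐ s ∂μ', 0 < s) (hm : 0 < μ.real univ) {l : ℝ} (hl : 0 ≤ l) (t : ℝ) :
    relaxApprox μ l t ≤ relaxApprox μ' l t := by
  have key : ∀ t, 0 < t → (μ'.real univ + l) * relaxApprox μ l t ≤
      ∫ s, relaxApprox μ l (t - s) ∂μ' := by
    intro t ht
    have h1 := relaxApprox_eq μ hl hm ht
    have h2 : ∫ s, (relaxApprox μ l (t - s) - relaxApprox μ l t) ∂μ ≤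
        ∫ s, (relaxApprox μ l (t - s) - relaxApprox μ l t) ∂μ' := by
      refine integral_mono_measure hle ?_
        ((integrable_relaxApprox μ μ' hl t).sub (integrable_const _))
      filter_upwards [hpos] with s hs
      exact sub_nonneg.2 (antitone_relaxApprox μ hl (by linarith))
    rw [integral_sub (integrable_relaxApprox μ μ hl t) (integrable_const _),
      integral_sub (integrable_relaxApprox μ μ' hl t) (integrable_const _)] at h2
    simp only [integral_const, smul_eq_mul] at h2
    linarith
  have hm' : 0 < μ'.real univ :=
    hm.trans_le (ENNReal.toReal_mono (measure_ne_top _ _) (hle univ))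
  have h3 : ∀ k t, relaxApprox μ l t ≤ relaxIter μ' k l t := by
    intro k
    induction k with
    | zero => exact fun t => relaxApprox_le_one μ hl t
    | succ k ih =>
      intro t
      by_cases ht : t ≤ 0
      · rw [relaxApprox_of_nonpos μ l ht, relaxIter_of_nonpos _ _ _ ht]
      · push Not at ht
        rw [relaxIter_succ, if_neg (by linarith), inv_mul_eq_div, le_div_iff₀ (by positivity),
          mul_comm]
        exact (key t ht).trans (integral_mono (integrable_relaxApprox μ μ' hl t)
          (integrable_relaxIter μ' k hl t) fun s => ih _)
  exact le_ciInf fun k => h3 k t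

/-- The equation reads `∫ (v(t - s) - v(t)) dμ = l v(t) ≤ l`, and on `s ≥ h` the nonnegative
integrand is at least `v(t - h) - v(t)`. The bound sees `μ` only through its tail, so it survives
the removal of the truncation. -/
lemma relaxApprox_modulus (μ : Measure ℝ) [IsFiniteMeasure μ] (hpos : ∀ᵐ s ∂μ, 0 < s)
    (hm : 0 < μ.real univ) {l : ℝ} (hl : 0 ≤ l) {t : ℝ} (ht : 0 < t) (h : ℝ) :
    (relaxApprox μ l (t - h) - relaxApprox μ l t) * μ.real (Ici h) ≤ l := by
  have h1 := relaxApprox_eq μ hl hm ht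
  have hint : Integrable (fun s => relaxApprox μ l (t - s) - relaxApprox μ l t) μ :=
    (integrable_relaxApprox μ μ hl t).sub (integrable_const _)
  have h2 : ∫ s, (relaxApprox μ l (t - s) - relaxApprox μ l t) ∂μ = l * relaxApprox μ l t := by
    rw [integral_sub (integrable_relaxApprox μ μ hl t) (integrable_const _), ← h1]
    simp only [integral_const, smul_eq_mul]; ring
  have h3 : ∫ s in Ici h, (relaxApprox μ l (t - s) - relaxApprox μ l t) ∂μ ≤
      ∫ s, (relaxApprox μ l (t - s) - relaxApprox μ l t) ∂μ := by
    refine setIntegral_le_integral hint ?_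
    filter_upwards [hpos] with s hs
    exact sub_nonneg.2 (antitone_relaxApprox μ hl (by linarith))
  have h4 : ∫ _ in Ici h, (relaxApprox μ l (t - h) - relaxApprox μ l t) ∂μ ≤
      ∫ s in Ici h, (relaxApprox μ l (t - s) - relaxApprox μ l t) ∂μ := by
    refine setIntegral_mono_on (integrable_const _).integrableOn hint.integrableOn
      measurableSet_Ici fun s hs => ?_
    have : relaxApprox μ l (t - h) ≤ relaxApprox μ l (t - s) :=
      antitone_relaxApprox μ hl (by have := mem_Ici.1 hs; linarith)
    linarith
  rw [setIntegral_const, smul_eq_mul] at h4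
  have h5 := relaxApprox_le_one μ hl t
  nlinarith

end

/-! ### Positivity of Gaussian-regularised cosine transforms. -/

noncomputable section

lemma integral_gaussian_mul_cos {a : ℝ} (ha : 0 < a) (x : ℝ) :
    ∫ k : ℝ, Real.exp (-a * k ^ 2) * Real.cos (k * x) =
      Real.sqrt (Real.pi / a) * Real.exp (-x ^ 2 / (4 * a)) := by
  have h := fourierIntegral_gaussian (b := (a : ℂ)) (by simpa using ha) (x : ℂ)
  have h2 := congrArg Complex.re h
  have hi : Integrable (fun k : ℝ => Complex.exp (Complex.I * x * k) * Complex.exp (-a * k ^ 2)) := by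
    have := integrable_cexp_quadratic (b := (a : ℂ)) (by simpa using ha) (Complex.I * x) 0
    refine this.congr (Eventually.of_forall fun k => ?_)
    simp only
    rw [← Complex.exp_add]; congr 1; ring
  have h3 : (∫ k : ℝ, Complex.exp (Complex.I * x * k) * Complex.exp (-a * k ^ 2)).re =
      ∫ k : ℝ, (Complex.exp (Complex.I * x * k) * Complex.exp (-a * k ^ 2)).re :=
    (integral_re hi).symm
  rw [h3] at h2
  have h4 : ∀ k : ℝ, (Complex.exp (Complex.I * x * k) * Complex.exp (-a * k ^ 2)).re =
      Real.exp (-a * k ^ 2) * Real.cos (k * x) := by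
    intro k
    rw [show (-(a : ℂ) * (k : ℂ) ^ 2) = ((-a * k ^ 2 : ℝ) : ℂ) by push_cast; ring,
      ← Complex.ofReal_exp, Complex.re_mul_ofReal,
      show Complex.I * (x : ℂ) * k = ((k * x : ℝ) : ℂ) * Complex.I by push_cast; ring,
      Complex.exp_ofReal_mul_I_re, mul_comm]
  simp only [h4] at h2
  rw [h2, show (-(x : ℂ) ^ 2 / (4 * a)) = ((-x ^ 2 / (4 * a) : ℝ) : ℂ) by push_cast; ring,
    ← Complex.ofReal_exp, Complex.re_mul_ofReal, ← Complex.ofReal_div,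
    show (1 / 2 : ℂ) = ((1 / 2 : ℝ) : ℂ) by push_cast; ring,
    ← Complex.ofReal_cpow (by positivity), Complex.ofReal_re, Real.sqrt_eq_rpow]

/-- All Gaussian regularisations of the cosine transform of `f` are nonnegative. -/
def GaussPos (f : ℝ → ℝ) : Prop :=
  ∀ a, 0 < a → ∀ x, 0 ≤ ∫ k : ℝ, f k * (Real.exp (-a * k ^ 2) * Real.cos (k * x))

lemma abs_exp_mul_cos_le (a k x : ℝ) :
    |Real.exp (-a * k ^ 2) * Real.cos (k * x)| ≤ Real.exp (-a * k ^ 2) := by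
  rw [abs_mul, abs_of_pos (Real.exp_pos _)]
  exact mul_le_of_le_one_right (Real.exp_pos _).le (Real.abs_cos_le_one _)

lemma gaussPos_one : GaussPos fun _ => 1 := by
  intro a ha x
  simp only [one_mul]
  rw [integral_gaussian_mul_cos ha]
  positivity

lemma GaussPos.of_tendsto {f : ℕ → ℝ → ℝ} {g : ℝ → ℝ} (hf : ∀ n, GaussPos (f n))
    (hm : ∀ n, Measurable (f n)) (hb : ∀ n k, |f n k| ≤ 1)
    (h : ∀ k, Tendsto (fun n => f n k) atTop (𝓝 (g k))) : GaussPos g := by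
  intro a ha x
  refine ge_of_tendsto' (x := atTop)
    (f := fun n => ∫ k : ℝ, f n k * (Real.exp (-a * k ^ 2) * Real.cos (k * x)))
    ?_ fun n => hf n a ha x
  refine tendsto_integral_of_dominated_convergence (fun k => Real.exp (-a * k ^ 2))
    (fun n => ((hm n).mul (by fun_prop)).aestronglyMeasurable) (integrable_exp_neg_mul_sq ha) ?_ ?_
  · intro n
    refine Eventually.of_forall fun k => ?_
    rw [Real.norm_eq_abs, abs_mul]
    exact (mul_le_of_le_one_left (abs_nonneg _) (hb n k)).trans (abs_exp_mul_cos_le a k x)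
  · exact Eventually.of_forall fun k => (h k).mul_const _

lemma GaussPos.integral {μ : Measure ℝ} [IsFiniteMeasure μ] {f : ℝ → ℝ → ℝ}
    (hf : ∀ s, GaussPos (f s)) (hm : Measurable fun p : ℝ × ℝ => f p.1 p.2)
    (hb : ∀ s k, |f s k| ≤ 1) : GaussPos fun k => ∫ s, f s k ∂μ := by
  intro a ha x
  have hint : Integrable (fun p : ℝ × ℝ => f p.2 p.1 *
      (Real.exp (-a * p.1 ^ 2) * Real.cos (p.1 * x))) (volume.prod μ) := by
    have h1 : Integrable (fun p : ℝ × ℝ => Real.exp (-a * p.1 ^ 2) * (1 : ℝ)) (volume.prod μ) :=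
      (integrable_exp_neg_mul_sq ha).mul_prod (integrable_const _)
    refine h1.mono' ?_ (Eventually.of_forall fun p => ?_)
    · exact ((hm.comp measurable_swap).mul (by fun_prop)).aestronglyMeasurable
    · rw [Real.norm_eq_abs, abs_mul, mul_one]
      exact (mul_le_of_le_one_left (abs_nonneg _) (hb _ _)).trans (abs_exp_mul_cos_le _ _ _)
  simp only [← integral_mul_const]
  rw [integral_integral_swap hint]
  exact integral_nonneg fun s => hf s a ha x

/-- Since `(m + k ^ 2)⁻¹ = ∫_0^∞ exp(-(m + k ^ 2) y) dy`, the resolvent only replaces the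
regularisation parameter `a` by `a + y` and averages over `y` with positive weight. This is why
positivity is required for all `a > 0` at once. -/
lemma GaussPos.resolvent {f : ℝ → ℝ} (hf : GaussPos f) (hm : Measurable f) (hb : ∀ k, |f k| ≤ 1)
    {m : ℝ} (h0 : 0 < m) : GaussPos fun k => (m + k ^ 2)⁻¹ * f k := by
  intro a ha x
  have hint : Integrable (fun p : ℝ × ℝ => Real.exp (-(m + p.1 ^ 2) * p.2) * (f p.1 *
      (Real.exp (-a * p.1 ^ 2) * Real.cos (p.1 * x)))) (volume.prod (volume.restrict (Ioi 0))) := by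
    have h1 : Integrable (fun p : ℝ × ℝ => Real.exp (-a * p.1 ^ 2) * Real.exp (-m * p.2))
        (volume.prod (volume.restrict (Ioi 0))) :=
      (integrable_exp_neg_mul_sq ha).mul_prod (integrableOn_exp_mul_Ioi (by linarith) 0)
    refine h1.mono' ?_ ?_
    · exact (Measurable.mul (by fun_prop)
        ((hm.comp measurable_fst).mul (by fun_prop))).aestronglyMeasurable
    · have h2 : ∀ᵐ p : ℝ × ℝ ∂(volume.prod (volume.restrict (Ioi 0))), p.2 ∈ Ioi (0 : ℝ) :=
        Measure.quasiMeasurePreserving_snd.ae (ae_restrict_mem measurableSet_Ioi)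
      filter_upwards [h2] with p hp
      rw [Real.norm_eq_abs, abs_mul, abs_mul, abs_of_pos (Real.exp_pos _), mul_comm]
      refine mul_le_mul ((mul_le_of_le_one_left (abs_nonneg _) (hb _)).trans
        (abs_exp_mul_cos_le _ _ _)) ?_ (Real.exp_pos _).le (Real.exp_pos _).le
      refine Real.exp_le_exp.2 ?_
      have := mem_Ioi.1 hp
      nlinarith [mul_nonneg (sq_nonneg p.1) this.le]
  have h3 : ∀ k : ℝ, (m + k ^ 2)⁻¹ * f k * (Real.exp (-a * k ^ 2) * Real.cos (k * x)) =
      ∫ y in Ioi (0 : ℝ), Real.exp (-(m + k ^ 2) * y) * (f k *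
      (Real.exp (-a * k ^ 2) * Real.cos (k * x))) := by
    intro k
    have : 0 < m + k ^ 2 := by positivity
    rw [integral_mul_const, integral_exp_mul_Ioi (by linarith)]
    simp only [mul_zero, Real.exp_zero]
    field_simp
  simp only [h3]
  rw [integral_integral_swap hint]
  refine setIntegral_nonneg measurableSet_Ioi fun y hy => ?_
  have h4 : ∀ k : ℝ, Real.exp (-(m + k ^ 2) * y) * (f k *
      (Real.exp (-a * k ^ 2) * Real.cos (k * x))) = Real.exp (-m * y) *
      (f k * (Real.exp (-(a + y) * k ^ 2) * Real.cos (k * x))) := by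
    intro k
    rw [show -(m + k ^ 2) * y = -m * y + -(y * k ^ 2) by ring, Real.exp_add,
      show -(a + y) * k ^ 2 = -a * k ^ 2 + -(y * k ^ 2) by ring, Real.exp_add]
    ring
  simp only [h4]
  rw [integral_const_mul]
  exact mul_nonneg (Real.exp_pos _).le (hf _ (by have := mem_Ioi.1 hy; positivity) x)

lemma gaussPos_relaxIter (μ : Measure ℝ) [IsFiniteMeasure μ] (n : ℕ) (t : ℝ) :
    GaussPos fun k => relaxIter μ n (k ^ 2) t := by
  induction n generalizing t with
  | zero => exact gaussPos_one
  | succ n ih =>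
    by_cases ht : t ≤ 0
    · simp only [relaxIter_of_nonpos μ _ _ ht]
      exact gaussPos_one
    · simp only [relaxIter_succ, if_neg ht]
      have habs : ∀ s k : ℝ, |relaxIter μ n (k ^ 2) s| ≤ 1 := fun s k => by
        rw [abs_of_nonneg (relaxIter_mem μ n (sq_nonneg k) _).1]
        exact (relaxIter_mem μ n (sq_nonneg k) _).2
      rcases (measureReal_nonneg (μ := μ) (s := univ)).eq_or_lt with h | h
      · have : μ = 0 := by
          rw [← Measure.measure_univ_eq_zero]
          exact (measureReal_eq_zero_iff (measure_ne_top μ _)).1 h.symm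
        intro a ha x
        simp [this]
      -- The mass `m` is moved from the measure to the integrand: the measure becomes a probability,
      -- and `m / (m + k ^ 2) ≤ 1` gives the uniform bound that `GaussPos.integral` asks for.
      · have h1 : ∀ k : ℝ, (μ.real univ + k ^ 2)⁻¹ * ∫ s, relaxIter μ n (k ^ 2) (t - s) ∂μ =
            ∫ s, (μ.real univ * ((μ.real univ + k ^ 2)⁻¹ * relaxIter μ n (k ^ 2) (t - s)))
              ∂((ENNReal.ofReal (μ.real univ)⁻¹) • μ) := by
          intro k
          rw [integral_smul_measure, integral_const_mul, integral_const_mul,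
            ENNReal.toReal_ofReal (by positivity), smul_eq_mul]
          field_simp
        simp only [h1]
        have : IsFiniteMeasure ((ENNReal.ofReal (μ.real univ)⁻¹) • μ) :=
          Measure.smul_finite μ ENNReal.ofReal_ne_top
        refine GaussPos.integral
          (f := fun s k => μ.real univ * ((μ.real univ + k ^ 2)⁻¹ * relaxIter μ n (k ^ 2) (t - s)))
          ?_ ?_ ?_
        · intro s a ha x
          simp only [mul_assoc (μ.real univ)]
          rw [integral_const_mul]
          refine mul_nonneg h.le ?_
          exact GaussPos.resolvent (ih (t - s)) ((measurable_relaxIter μ n).comp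
            (f := fun k : ℝ => (k ^ 2, t - s)) (by fun_prop)) (fun k => habs _ k) h a ha x
        · refine Measurable.mul measurable_const (Measurable.mul (by fun_prop) ?_)
          exact (measurable_relaxIter μ n).comp
            (f := fun p : ℝ × ℝ => (p.2 ^ 2, t - p.1)) (by fun_prop)
        · intro s k
          have h2 : 0 < μ.real univ + k ^ 2 := by positivity
          rw [abs_mul, abs_mul, abs_of_pos h, abs_of_pos (inv_pos.2 h2), ← mul_assoc,
            ← div_eq_mul_inv]
          refine mul_le_one₀ ?_ (abs_nonneg _) (habs _ _)
          rw [div_le_one h2]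
          nlinarith [sq_nonneg k]

lemma gaussPos_relaxApprox (μ : Measure ℝ) [IsFiniteMeasure μ] (t : ℝ) :
    GaussPos fun k => relaxApprox μ (k ^ 2) t := by
  refine GaussPos.of_tendsto (f := fun n k => relaxIter μ n (k ^ 2) t)
    (fun n => gaussPos_relaxIter μ n t)
    (fun n => (measurable_relaxIter μ n).comp (f := fun k : ℝ => (k ^ 2, t)) (by fun_prop))
    (fun n k => ?_) fun k => tendsto_relaxIter μ (sq_nonneg k) t
  rw [abs_of_nonneg (relaxIter_mem μ n (sq_nonneg k) _).1]
  exact (relaxIter_mem μ n (sq_nonneg k) _).2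

end

/-! ### Laplace transform and weak form of the relaxation equation. -/

noncomputable section

lemma integrableOn_exp_mul_of_bounded {z : ℝ} (hz : 0 < z) {f : ℝ → ℝ} (hf : Measurable f)
    {C : ℝ} (hb : ∀ t, |f t| ≤ C) (c : ℝ) :
    IntegrableOn (fun t => Real.exp (-z * t) * f t) (Ioi c) := by
  refine ((integrableOn_exp_mul_Ioi (a := -z) (by linarith) c).mul_const C).mono'
    (by fun_prop) (Eventually.of_forall fun t => ?_)
  rw [Real.norm_eq_abs, abs_mul, abs_of_pos (Real.exp_pos _)]
  exact mul_le_mul_of_nonneg_left (hb t) (Real.exp_pos _).le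

/-- After translation the integral runs over `(-s, ∞)`; on `(-s, 0]` the function is the history
`1`, which contributes the first term. -/
lemma laplace_shift_of_history {z : ℝ} (hz : 0 < z) {f : ℝ → ℝ} (hf : Measurable f)
    {C : ℝ} (hb : ∀ t, |f t| ≤ C) (h1 : ∀ t ≤ 0, f t = 1) {s : ℝ} (hs : 0 < s) :
    ∫ t in Ioi (0 : ℝ), Real.exp (-z * t) * f (t - s) =
      (1 - Real.exp (-z * s)) / z + Real.exp (-z * s) * laplaceTransform f z := by
  have e1 : ∫ t in Ioi (0 : ℝ), Real.exp (-z * t) * f (t - s) =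
      ∫ t in Ioi (-s), Real.exp (-z * s) * (Real.exp (-z * t) * f t) := by
    have hmp : MeasurePreserving (fun t : ℝ => t - s) volume volume :=
      measurePreserving_sub_right volume s
    have he : MeasurableEmbedding (fun t : ℝ => t - s) :=
      (Homeomorph.subRight s).measurableEmbedding
    rw [← hmp.setIntegral_preimage_emb he (fun t => Real.exp (-z * s) * (Real.exp (-z * t) * f t))]
    have : (fun t : ℝ => t - s) ⁻¹' (Ioi (-s)) = Ioi 0 := by ext t; simp
    rw [this]
    congr 1; ext t
    rw [← mul_assoc, ← Real.exp_add]; congr 2; ring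
  rw [e1, integral_const_mul]
  have e2 : ∫ t in Ioi (-s), Real.exp (-z * t) * f t =
      (∫ t in Ioc (-s) 0, Real.exp (-z * t) * f t) + ∫ t in Ioi 0, Real.exp (-z * t) * f t := by
    rw [← setIntegral_union (Ioc_disjoint_Ioi le_rfl) measurableSet_Ioi
      ((integrableOn_exp_mul_of_bounded hz hf hb (-s)).mono_set Ioc_subset_Ioi_self)
      (integrableOn_exp_mul_of_bounded hz hf hb 0), Ioc_union_Ioi_eq_Ioi (by linarith)]
  have e3 : ∫ t in Ioc (-s) 0, Real.exp (-z * t) * f t = (Real.exp (z * s) - 1) / z := by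
    rw [setIntegral_congr_fun (g := fun t => Real.exp (-z * t)) measurableSet_Ioc
      (fun t ht => by simp [h1 t ht.2]), ← intervalIntegral.integral_of_le (by linarith),
      intervalIntegral.integral_comp_mul_left (f := Real.exp) (by linarith), integral_exp]
    simp only [mul_zero, Real.exp_zero, smul_eq_mul, neg_mul_neg]
    field_simp
    ring
  rw [e2, e3, laplaceTransform, mul_add]
  congr 1
  rw [mul_div_assoc', mul_sub, ← Real.exp_add]
  simp

/-- The Bernstein function with jump measure `μ`. -/
def jumpSymbol (μ : Measure ℝ) (z : ℝ) : ℝ := ∫ s, (1 - Real.exp (-z * s)) ∂μ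

/-- Transforming the fixed point equation gives `(m + l) V = K / z + (m - K) V`, with `m` the mass
of `μ`. The mass cancels, so the formula makes sense for infinite measures too. -/
lemma laplaceTransform_relaxApprox (μ : Measure ℝ) [IsFiniteMeasure μ] (hpos : ∀ᵐ s ∂μ, 0 < s)
    (hm : 0 < μ.real univ) {l : ℝ} (hl : 0 ≤ l) {z : ℝ} (hz : 0 < z) :
    (jumpSymbol μ z + l) * laplaceTransform (relaxApprox μ l) z = jumpSymbol μ z / z := by
  have hmeas : Measurable (relaxApprox μ l) :=
    (measurable_relaxApprox μ).comp (f := fun t => (l, t)) (by fun_prop)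
  have hb : ∀ t, |relaxApprox μ l t| ≤ 1 := fun t => by
    rw [abs_of_nonneg (relaxApprox_nonneg μ hl t)]; exact relaxApprox_le_one μ hl t
  have hint : Integrable (fun p : ℝ × ℝ => Real.exp (-z * p.1) * relaxApprox μ l (p.1 - p.2))
      ((volume.restrict (Ioi 0)).prod μ) := by
    have h1 : Integrable (fun p : ℝ × ℝ => Real.exp (-z * p.1) * (1 : ℝ))
        ((volume.restrict (Ioi 0)).prod μ) :=
      (integrableOn_exp_mul_Ioi (by linarith) 0 : IntegrableOn _ _ _).mul_prod
        (integrable_const (1 : ℝ))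
    refine h1.mono' ?_ (Eventually.of_forall fun p => ?_)
    · exact (Measurable.mul (by fun_prop) (hmeas.comp
        (f := fun p : ℝ × ℝ => p.1 - p.2) (by fun_prop))).aestronglyMeasurable
    · rw [Real.norm_eq_abs, abs_mul, abs_of_pos (Real.exp_pos _)]
      exact mul_le_mul_of_nonneg_left (hb _) (Real.exp_pos _).le
  have e1 : (μ.real univ + l) * laplaceTransform (relaxApprox μ l) z =
      ∫ s, (∫ t in Ioi (0 : ℝ), Real.exp (-z * t) * relaxApprox μ l (t - s)) ∂μ := by
    rw [← integral_integral_swap hint, laplaceTransform, ← integral_const_mul]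
    refine setIntegral_congr_fun measurableSet_Ioi fun t ht => ?_
    rw [integral_const_mul, ← relaxApprox_eq μ hl hm ht]
    ring
  have hexp : Integrable (fun s => Real.exp (-z * s)) μ := by
    refine Integrable.of_bound (by fun_prop) 1 ?_
    filter_upwards [hpos] with s hs
    rw [Real.norm_eq_abs, abs_of_pos (Real.exp_pos _)]
    exact Real.exp_le_one_iff.2 (by nlinarith)
  have e2 : ∫ s, (∫ t in Ioi (0 : ℝ), Real.exp (-z * t) * relaxApprox μ l (t - s)) ∂μ =
      jumpSymbol μ z / z + (μ.real univ - jumpSymbol μ z) *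
        laplaceTransform (relaxApprox μ l) z := by
    have : ∀ᵐ s ∂μ, (∫ t in Ioi (0 : ℝ), Real.exp (-z * t) * relaxApprox μ l (t - s)) =
        (1 - Real.exp (-z * s)) / z +
          Real.exp (-z * s) * laplaceTransform (relaxApprox μ l) z := by
      filter_upwards [hpos] with s hs
      exact laplace_shift_of_history hz hmeas hb (fun t ht => relaxApprox_of_nonpos μ l ht) hs
    have hi : Integrable (fun s => (1 - Real.exp (-z * s)) / z) μ :=
      ((integrable_const 1).sub hexp).div_const z
    rw [integral_congr_ae this, integral_add hi (hexp.mul_const _), integral_div, integral_mul_const, jumpSymbol,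
      integral_sub (integrable_const _) hexp]
    simp
  rw [e2] at e1
  linarith

/-- The adjoint of the nonlocal operator with jump measure `μ`. -/
def jumpAdjoint (μ : Measure ℝ) (ψ : ℝ → ℝ) (t : ℝ) : ℝ := ∫ s, (ψ t - ψ (t + s)) ∂μ

/-- Translation invariance moves the shift from `ψ` to `v`, where the pointwise equation applies.
Integrating over the whole line includes the contribution of the history. -/
lemma integral_relaxApprox_mul_jumpAdjoint (μ : Measure ℝ) [IsFiniteMeasure μ]
    (hm : 0 < μ.real univ) {l : ℝ} (hl : 0 ≤ l)
    {ψ : ℝ → ℝ} (hψ : Continuous ψ) (hc : HasCompactSupport ψ) (h0 : ∀ t ≤ 0, ψ t = 0) :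
    ∫ t, relaxApprox μ l t * (jumpAdjoint μ ψ t + l * ψ t) = 0 := by
  have hmeas : Measurable (relaxApprox μ l) :=
    (measurable_relaxApprox μ).comp (f := fun t => (l, t)) (by fun_prop)
  have hb : ∀ t, ‖relaxApprox μ l t‖ ≤ 1 := fun t => by
    rw [Real.norm_eq_abs, abs_of_nonneg (relaxApprox_nonneg μ hl t)]
    exact relaxApprox_le_one μ hl t
  have hψi : Integrable ψ := hψ.integrable_of_hasCompactSupport hc
  have hψs : ∀ t, Integrable (fun s => ψ (t + s)) μ := fun t => by
    obtain ⟨C, hC⟩ := hc.exists_bound_of_continuous hψ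
    exact Integrable.of_bound (by fun_prop) C (Eventually.of_forall fun s => hC _)
  have hvψ : Integrable (fun t => relaxApprox μ l t * ψ t) :=
    hψi.bdd_mul hmeas.aestronglyMeasurable (Eventually.of_forall hb)
  have hint : Integrable (fun p : ℝ × ℝ => relaxApprox μ l p.1 * ψ (p.1 + p.2))
      (volume.prod μ) := by
    rw [integrable_prod_iff' ?_]
    · refine ⟨Eventually.of_forall fun s => ?_, ?_⟩
      · exact (hψi.comp_add_right s).bdd_mul hmeas.aestronglyMeasurable (Eventually.of_forall hb)
      · refine Integrable.of_bound ?_ (∫ t, ‖ψ t‖) (Eventually.of_forall fun s => ?_)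
        · refine StronglyMeasurable.aestronglyMeasurable ?_
          have : Measurable fun p : ℝ × ℝ => ‖relaxApprox μ l p.1 * ψ (p.1 + p.2)‖ :=
            ((hmeas.comp measurable_fst).mul (by fun_prop)).norm
          exact this.stronglyMeasurable.integral_prod_left'
        · rw [Real.norm_eq_abs, abs_of_nonneg (integral_nonneg fun _ => norm_nonneg _),
            ← integral_add_right_eq_self (fun t => ‖ψ t‖) s]
          refine integral_mono_of_nonneg (Eventually.of_forall fun _ => norm_nonneg _)
            (hψi.comp_add_right s).norm (Eventually.of_forall fun t => ?_)
          simp only [norm_mul]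
          exact mul_le_of_le_one_left (norm_nonneg _) (hb t)
    · exact ((hmeas.comp measurable_fst).mul (by fun_prop)).aestronglyMeasurable
  have hint2 : Integrable (fun p : ℝ × ℝ => relaxApprox μ l (p.1 - p.2) * ψ p.1)
      (volume.prod μ) := by
    have h1 : Integrable (fun p : ℝ × ℝ => ψ p.1 * (1 : ℝ)) (volume.prod μ) :=
      hψi.mul_prod (integrable_const (1 : ℝ))
    simp only [mul_one] at h1
    refine h1.bdd_mul (c := 1) ?_ (Eventually.of_forall fun p => hb _)
    exact (hmeas.comp (f := fun p : ℝ × ℝ => p.1 - p.2) (by fun_prop)).aestronglyMeasurable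
  have e1 : ∫ t, ∫ s, relaxApprox μ l t * ψ (t + s) ∂μ =
      (μ.real univ + l) * ∫ t, relaxApprox μ l t * ψ t := by
    rw [integral_integral_swap hint]
    have : ∀ s, ∫ t, relaxApprox μ l t * ψ (t + s) = ∫ t, relaxApprox μ l (t - s) * ψ t := by
      intro s
      rw [← integral_add_right_eq_self (fun t => relaxApprox μ l (t - s) * ψ t) s]
      simp
    simp only [this]
    rw [← integral_integral_swap hint2, ← integral_const_mul]
    congr 1; ext t
    rw [integral_mul_const]
    -- The pointwise equation is available only for `t > 0`; elsewhere `ψ` vanishes.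
    rcases le_or_gt t 0 with ht | ht
    · simp [h0 t ht]
    · rw [← relaxApprox_eq μ hl hm ht]; ring
  have e2 : ∀ t, relaxApprox μ l t * (jumpAdjoint μ ψ t + l * ψ t) =
      (μ.real univ + l) * (relaxApprox μ l t * ψ t) -
        ∫ s, relaxApprox μ l t * ψ (t + s) ∂μ := by
    intro t
    rw [jumpAdjoint, integral_sub (integrable_const _) (hψs t), integral_const_mul]
    simp only [integral_const, smul_eq_mul]
    ring
  simp only [e2]
  rw [integral_sub (hvψ.const_mul _) hint.integral_prod_left, e1, integral_const_mul, sub_self]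

end

/-! ### Infinite jump measures as limits of truncations. -/

noncomputable section

/-- An infinite jump measure on `(0, δ)` with finite moment of order `β < 1`. -/
structure IsJumpKernel (δ β : ℝ) (ν : Measure ℝ) : Prop where
  delta_pos : 0 < δ
  beta_pos : 0 < β
  beta_lt_one : β < 1
  support : ∀ᵐ s ∂ν, s ∈ Ioo 0 δ
  moment : Integrable (fun s : ℝ => s ^ β) ν
  mass_pos : 0 < ν (Ioi (δ / 2))
  infinite : ν univ = ⊤

/-- The truncation of a jump measure that removes the jumps smaller than `δ / (n + 2)`. -/
def truncJump (ν : Measure ℝ) (δ : ℝ) (n : ℕ) : Measure ℝ := ν.restrict (Ioi (δ / (n + 2)))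

/-- The relaxation function with jump measure `ν` and history `1`. -/
def relaxFun (ν : Measure ℝ) (δ l t : ℝ) : ℝ := ⨆ n, relaxApprox (truncJump ν δ n) l t

namespace IsJumpKernel

variable {δ β : ℝ} {ν : Measure ℝ} (h : IsJumpKernel δ β ν)
include h

lemma ae_pos : ∀ᵐ s ∂ν, 0 < s := h.support.mono fun _ hs => hs.1

lemma integrable_id : Integrable (fun s : ℝ => s) ν := by
  refine (h.moment.const_mul (δ ^ (1 - β))).mono' (by fun_prop) ?_
  filter_upwards [h.support] with s hs
  rw [Real.norm_eq_abs, abs_of_pos hs.1]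
  calc s = s ^ (1 - β) * s ^ β := by rw [← Real.rpow_add hs.1]; simp
    _ ≤ δ ^ (1 - β) * s ^ β := by
      have := Real.rpow_le_rpow hs.1.le hs.2.le (by linarith [h.beta_lt_one] : 0 ≤ 1 - β)
      exact mul_le_mul_of_nonneg_right this (Real.rpow_nonneg hs.1.le _)

lemma measure_Ici_lt_top {r : ℝ} (hr : 0 < r) : ν (Ici r) < ⊤ := by
  have h1 := h.integrable_id.measure_norm_ge_lt_top hr
  refine (measure_mono fun s hs => ?_).trans_lt h1
  have hs' : r ≤ s := hs
  simpa using hs'.trans (le_abs_self s)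

lemma isFiniteMeasure_truncJump (n : ℕ) : IsFiniteMeasure (truncJump ν δ n) := by
  have hr : 0 < δ / (n + 2) := div_pos h.delta_pos (by positivity)
  refine ⟨?_⟩
  rw [truncJump, Measure.restrict_apply_univ]
  exact (measure_mono Ioi_subset_Ici_self).trans_lt (h.measure_Ici_lt_top hr)

lemma truncJump_mono : Monotone (truncJump ν δ) := by
  intro m n hmn
  refine Measure.restrict_mono (Ioi_subset_Ioi ?_) le_rfl
  have := h.delta_pos
  gcongr

/-- The cut level `δ / (n + 2)` never exceeds `δ / 2`, so `mass_pos` keeps every truncation nonzero.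
-/
lemma truncJump_pos (n : ℕ) : 0 < (truncJump ν δ n).real univ := by
  have := h.isFiniteMeasure_truncJump n
  refine ENNReal.toReal_pos ?_ (measure_ne_top _ _)
  rw [truncJump, Measure.restrict_apply_univ]
  refine (h.mass_pos.trans_le (measure_mono (Ioi_subset_Ioi ?_))).ne'
  have := h.delta_pos
  have hn : (0 : ℝ) ≤ n := n.cast_nonneg
  gcongr
  linarith

lemma truncJump_ae_pos (n : ℕ) : ∀ᵐ s ∂truncJump ν δ n, 0 < s :=
  ae_restrict_of_ae h.ae_pos

lemma bddAbove_relaxApprox {l : ℝ} (hl : 0 ≤ l) (t : ℝ) :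
    BddAbove (range fun n => relaxApprox (truncJump ν δ n) l t) := by
  refine ⟨1, ?_⟩
  rintro _ ⟨n, rfl⟩
  have := h.isFiniteMeasure_truncJump n
  exact relaxApprox_le_one _ hl t

lemma tendsto_relaxApprox {l : ℝ} (hl : 0 ≤ l) (t : ℝ) :
    Tendsto (fun n => relaxApprox (truncJump ν δ n) l t) atTop (𝓝 (relaxFun ν δ l t)) := by
  refine tendsto_atTop_ciSup (fun m n hmn => ?_) (h.bddAbove_relaxApprox hl t)
  have := h.isFiniteMeasure_truncJump n
  have := h.isFiniteMeasure_truncJump m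
  exact relaxApprox_mono (h.truncJump_mono hmn) (h.truncJump_ae_pos n) (h.truncJump_pos m) hl t

lemma abs_relaxApprox_le (n : ℕ) {l : ℝ} (hl : 0 ≤ l) (t : ℝ) :
    |relaxApprox (truncJump ν δ n) l t| ≤ 1 := by
  have := h.isFiniteMeasure_truncJump n
  rw [abs_of_nonneg (relaxApprox_nonneg _ hl t)]
  exact relaxApprox_le_one _ hl t

omit h in
lemma _root_.relaxFun_of_nonpos (ν : Measure ℝ) (δ l : ℝ) {t : ℝ} (ht : t ≤ 0) :
    relaxFun ν δ l t = 1 := by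
  simp [relaxFun, relaxApprox_of_nonpos _ l ht]

lemma relaxFun_nonneg {l : ℝ} (hl : 0 ≤ l) (t : ℝ) : 0 ≤ relaxFun ν δ l t :=
  ge_of_tendsto' (h.tendsto_relaxApprox hl t) fun n => by
    have := h.isFiniteMeasure_truncJump n
    exact relaxApprox_nonneg _ hl t

lemma relaxFun_le_one {l : ℝ} (hl : 0 ≤ l) (t : ℝ) : relaxFun ν δ l t ≤ 1 :=
  le_of_tendsto' (h.tendsto_relaxApprox hl t) fun n => by
    have := h.isFiniteMeasure_truncJump n
    exact relaxApprox_le_one _ hl t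

lemma abs_relaxFun_le {l : ℝ} (hl : 0 ≤ l) (t : ℝ) : |relaxFun ν δ l t| ≤ 1 := by
  rw [abs_of_nonneg (h.relaxFun_nonneg hl t)]
  exact h.relaxFun_le_one hl t

lemma antitone_relaxFun {l : ℝ} (hl : 0 ≤ l) : Antitone (relaxFun ν δ l) := fun _ _ hab =>
  le_of_tendsto_of_tendsto' (h.tendsto_relaxApprox hl _) (h.tendsto_relaxApprox hl _) fun n => by
    have := h.isFiniteMeasure_truncJump n
    exact antitone_relaxApprox _ hl hab

lemma measurable_relaxFun : Measurable (fun p : ℝ × ℝ => relaxFun ν δ p.1 p.2) :=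
  Measurable.iSup fun n => by
    have := h.isFiniteMeasure_truncJump n
    exact measurable_relaxApprox _

lemma measurable_relaxFun_right (l : ℝ) : Measurable (relaxFun ν δ l) :=
  h.measurable_relaxFun.comp (f := fun t => (l, t)) (by fun_prop)

lemma gaussPos_relaxFun (t : ℝ) : GaussPos fun k => relaxFun ν δ (k ^ 2) t := by
  refine GaussPos.of_tendsto (f := fun n k => relaxApprox (truncJump ν δ n) (k ^ 2) t)
    (fun n => ?_) (fun n => ?_) (fun n k => h.abs_relaxApprox_le n (sq_nonneg k) t)
    fun k => h.tendsto_relaxApprox (sq_nonneg k) t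
  all_goals have := h.isFiniteMeasure_truncJump n
  · exact gaussPos_relaxApprox _ t
  · exact (measurable_relaxApprox _).comp (f := fun k : ℝ => (k ^ 2, t)) (by fun_prop)

omit h in
lemma _root_.iUnion_Ioi_div_add_two {δ : ℝ} (hδ : 0 < δ) :
    ⋃ n : ℕ, Ioi (δ / ((n : ℝ) + 2)) = Ioi 0 := by
  ext s
  simp only [mem_iUnion, mem_Ioi]
  refine ⟨fun ⟨n, hn⟩ => (div_pos hδ (by positivity)).trans hn, fun hs => ?_⟩
  obtain ⟨n, hn⟩ := exists_nat_gt (δ / s)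
  refine ⟨n, ?_⟩
  rw [div_lt_iff₀ hs] at hn
  rw [div_lt_iff₀ (by positivity)]
  nlinarith

lemma tendsto_integral_truncJump {f : ℝ → ℝ} (hf : Integrable f ν) :
    Tendsto (fun n => ∫ s, f s ∂truncJump ν δ n) atTop (𝓝 (∫ s, f s ∂ν)) := by
  have h1 := tendsto_setIntegral_of_monotone (μ := ν) (f := f)
    (s := fun n : ℕ => Ioi (δ / ((n : ℝ) + 2))) (fun n => measurableSet_Ioi)
    (fun m n hmn => Ioi_subset_Ioi (by have := h.delta_pos; gcongr))
    hf.integrableOn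
  rw [iUnion_Ioi_div_add_two h.delta_pos] at h1
  have h2 : ν.restrict (Ioi 0) = ν := Measure.restrict_eq_self_of_ae_mem h.ae_pos
  rwa [h2] at h1

lemma integrable_one_sub_exp {z : ℝ} (hz : 0 ≤ z) :
    Integrable (fun s => 1 - Real.exp (-z * s)) ν := by
  refine (h.integrable_id.const_mul z).mono' (by fun_prop) ?_
  filter_upwards [h.ae_pos] with s hs
  have h1 := Real.add_one_le_exp (-z * s)
  have h2 : Real.exp (-z * s) ≤ 1 := Real.exp_le_one_iff.2 (by nlinarith)
  rw [Real.norm_eq_abs, abs_of_nonneg (by linarith)]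
  linarith

lemma jumpSymbol_nonneg {z : ℝ} (hz : 0 ≤ z) : 0 ≤ jumpSymbol ν z := by
  refine integral_nonneg_of_ae ?_
  filter_upwards [h.ae_pos] with s hs
  have h2 : Real.exp (-z * s) ≤ 1 := Real.exp_le_one_iff.2 (by nlinarith)
  simpa using h2

lemma jumpSymbol_pos {z : ℝ} (hz : 0 < z) : 0 < jumpSymbol ν z := by
  rw [jumpSymbol, integral_pos_iff_support_of_nonneg_ae _ (h.integrable_one_sub_exp hz.le)]
  · refine h.mass_pos.trans_le (measure_mono fun s hs => ?_)
    have hs0 : 0 < s := (half_pos h.delta_pos).trans hs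
    have : Real.exp (-z * s) < 1 := by rw [← Real.exp_zero]; exact Real.exp_lt_exp.2 (by nlinarith)
    simp only [Function.mem_support]
    linarith
  · filter_upwards [h.ae_pos] with s hs
    have h2 : Real.exp (-z * s) ≤ 1 := Real.exp_le_one_iff.2 (by nlinarith)
    simpa using h2

lemma laplaceTransform_relaxFun {l : ℝ} (hl : 0 ≤ l) {z : ℝ} (hz : 0 < z) :
    laplaceTransform (relaxFun ν δ l) z = jumpSymbol ν z / (z * (jumpSymbol ν z + l)) := by
  have hK := h.jumpSymbol_pos hz
  have h1 : Tendsto (fun n => laplaceTransform (relaxApprox (truncJump ν δ n) l) z) atTop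
      (𝓝 (laplaceTransform (relaxFun ν δ l) z)) := by
    refine tendsto_integral_of_dominated_convergence (fun t => Real.exp (-z * t))
      (fun n => ?_) (integrableOn_exp_mul_Ioi (by linarith) 0) (fun n => ?_) ?_
    · have := h.isFiniteMeasure_truncJump n
      exact (Measurable.mul (by fun_prop) ((measurable_relaxApprox _).comp
        (f := fun t : ℝ => (l, t)) (by fun_prop))).aestronglyMeasurable
    · refine Eventually.of_forall fun t => ?_
      rw [Real.norm_eq_abs, abs_mul, abs_of_pos (Real.exp_pos _)]
      exact mul_le_of_le_one_right (Real.exp_pos _).le (h.abs_relaxApprox_le n hl t)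
    · exact Eventually.of_forall fun t => (h.tendsto_relaxApprox hl t).const_mul _
  have h2 : Tendsto (fun n => jumpSymbol (truncJump ν δ n) z) atTop (𝓝 (jumpSymbol ν z)) :=
    h.tendsto_integral_truncJump (h.integrable_one_sub_exp hz.le)
  have h3 := (h2.add_const l).mul h1
  have h4 : Tendsto (fun n => jumpSymbol (truncJump ν δ n) z / z) atTop
      (𝓝 (jumpSymbol ν z / z)) := h2.div_const z
  have h5 := tendsto_nhds_unique (h3.congr fun n => by
    have := h.isFiniteMeasure_truncJump n
    exact laplaceTransform_relaxApprox _ (h.truncJump_ae_pos n) (h.truncJump_pos n) hl hz) h4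
  rw [eq_div_iff (by positivity)]
  rw [eq_div_iff (by positivity)] at h5
  linarith

/-- Once `δ / (n + 2) < r`, the truncation leaves the tail `[r, ∞)` untouched, so the finite-measure
bound is constant on the right and passes to the limit. -/
lemma relaxFun_modulus {l : ℝ} (hl : 0 ≤ l) {t : ℝ} (ht : 0 < t) {r : ℝ} (hr : 0 < r) :
    (relaxFun ν δ l (t - r) - relaxFun ν δ l t) * ν.real (Ici r) ≤ l := by
  have h1 := (((h.tendsto_relaxApprox hl (t - r)).sub (h.tendsto_relaxApprox hl t)).mul_const
    (ν.real (Ici r)))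
  refine le_of_tendsto h1 ?_
  obtain ⟨N, hN⟩ := exists_nat_gt (δ / r)
  filter_upwards [eventually_ge_atTop N] with n hn
  have := h.isFiniteMeasure_truncJump n
  have h2 := relaxApprox_modulus _ (h.truncJump_ae_pos n) (h.truncJump_pos n) hl ht r
  have h3 : (truncJump ν δ n).real (Ici r) = ν.real (Ici r) := by
    rw [truncJump, measureReal_restrict_apply measurableSet_Ici,
      inter_eq_left.2 fun s hs => ?_]
    refine lt_of_lt_of_le ?_ (mem_Ici.1 hs)
    have hn' : (N : ℝ) ≤ n := by exact_mod_cast hn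
    rw [div_lt_iff₀ hr] at hN
    rw [div_lt_iff₀ (by positivity)]
    nlinarith
  rwa [h3] at h2

/-- Infinite total mass with finite tails forces the tails to blow up at the origin. This makes the
modulus estimate effective. -/
lemma exists_measureReal_Ici_gt (C : ℝ) : ∃ r, 0 < r ∧ C < ν.real (Ici r) := by
  have h1 : Tendsto (fun n : ℕ => ν (Ioi (δ / ((n : ℝ) + 2)))) atTop (𝓝 ⊤) := by
    have := tendsto_measure_iUnion_atTop (μ := ν) (s := fun n : ℕ => Ioi (δ / ((n : ℝ) + 2)))
      (fun m n hmn => Ioi_subset_Ioi (by have := h.delta_pos; gcongr))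
    rw [iUnion_Ioi_div_add_two h.delta_pos] at this
    have h2 : ν (Ioi 0) = ⊤ := by
      have h3 : ν.restrict (Ioi 0) = ν := Measure.restrict_eq_self_of_ae_mem h.ae_pos
      rw [← h.infinite, ← Measure.restrict_apply_univ (Ioi 0), h3]
    rwa [h2] at this
  obtain ⟨n, hn⟩ := (h1.eventually (eventually_gt_nhds
    (ENNReal.ofReal_lt_top : ENNReal.ofReal C < ⊤))).exists
  have hr : 0 < δ / ((n : ℝ) + 2) := div_pos h.delta_pos (by positivity)
  refine ⟨_, hr, ?_⟩
  have h3 := hn.trans_le (measure_mono (μ := ν) Ioi_subset_Ici_self)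
  by_contra hcon
  push Not at hcon
  exact absurd h3 (not_lt.2 ((ENNReal.ofReal_toReal (h.measure_Ici_lt_top hr).ne).symm.le.trans
    (ENNReal.ofReal_le_ofReal hcon)))

/-- With `r` chosen so that `ν [r, ∞) > l / ε`, the modulus estimate bounds the drop over any
interval of length `r` by `ε`. Infinite mass is essential: for a finite jump measure on `(0, ∞)` and
`l > 0` the solution jumps at `t = 0`. -/
lemma continuous_relaxFun {l : ℝ} (hl : 0 ≤ l) : Continuous (relaxFun ν δ l) := by
  rw [Metric.continuous_iff]
  intro t ε hε
  obtain ⟨r, hr, hC⟩ := h.exists_measureReal_Ici_gt (l / ε)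
  have key : ∀ a b, a ≤ b → b - a ≤ r → relaxFun ν δ l a - relaxFun ν δ l b < ε := by
    intro a b hab hba
    rcases le_or_gt b 0 with hb | hb
    · rw [relaxFun_of_nonpos _ _ _ hb, relaxFun_of_nonpos _ _ _ (hab.trans hb)]
      simpa using hε
    · have h1 := h.relaxFun_modulus hl hb hr
      have h2 : relaxFun ν δ l a ≤ relaxFun ν δ l (b - r) := h.antitone_relaxFun hl (by linarith)
      have h3 : 0 < ν.real (Ici r) := lt_of_le_of_lt (by positivity) hC
      rw [← le_div_iff₀ h3] at h1
      rw [div_lt_iff₀ hε] at hC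
      have h4 : l / ν.real (Ici r) < ε := by rw [div_lt_iff₀ h3]; linarith
      linarith
  refine ⟨r, hr, fun b hb => ?_⟩
  rw [Real.dist_eq] at hb ⊢
  rcases le_total b t with hbt | hbt
  · rw [abs_of_nonneg (sub_nonneg.2 (h.antitone_relaxFun hl hbt))]
    rw [abs_of_nonpos (by linarith)] at hb
    exact key b t hbt (by linarith)
  · rw [abs_of_nonpos (sub_nonpos.2 (h.antitone_relaxFun hl hbt))]
    rw [abs_of_nonneg (by linarith)] at hb
    linarith [key t b hbt (by linarith)]

/-- By monotonicity the Laplace transform at `z = 1 / t` is at least `v(t) ∫_0^t exp(-r / t) dr`,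
while its exact value is at most `t K(1 / t) / l`. The resulting decay in `l = k ^ 2` makes the
Fourier integral converge absolutely. -/
lemma relaxFun_mul_le {l : ℝ} (hl : 0 < l) {t : ℝ} (ht : 0 < t) :
    relaxFun ν δ l t * (t * (1 - Real.exp (-1))) ≤ t * jumpSymbol ν t⁻¹ / l := by
  have hz : 0 < t⁻¹ := by positivity
  have hK := h.jumpSymbol_pos hz
  have h1 := h.laplaceTransform_relaxFun hl.le hz
  have hi := integrableOn_exp_mul_of_bounded hz (h.measurable_relaxFun_right l)
    (h.abs_relaxFun_le hl.le) 0
  have h2 : ∫ r in Ioc 0 t, Real.exp (-t⁻¹ * r) * relaxFun ν δ l t ≤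
      laplaceTransform (relaxFun ν δ l) t⁻¹ := by
    refine le_trans (setIntegral_mono_on ?_ (hi.mono_set Ioc_subset_Ioi_self) measurableSet_Ioc
      fun r hr => ?_) (setIntegral_mono_set hi ?_ Ioc_subset_Ioi_self.eventuallyLE)
    · exact (Continuous.integrableOn_Ioc (by fun_prop))
    · exact mul_le_mul_of_nonneg_left (h.antitone_relaxFun hl.le hr.2) (Real.exp_pos _).le
    · exact Eventually.of_forall fun r =>
        mul_nonneg (Real.exp_pos _).le (h.relaxFun_nonneg hl.le r)
  have h3 : ∫ r in Ioc 0 t, Real.exp (-t⁻¹ * r) * relaxFun ν δ l t =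
      relaxFun ν δ l t * (t * (1 - Real.exp (-1))) := by
    rw [integral_mul_const, ← intervalIntegral.integral_of_le ht.le,
      intervalIntegral.integral_comp_mul_left (f := Real.exp) (by linarith), integral_exp]
    have : -t⁻¹ * t = -1 := by field_simp
    rw [this]
    simp only [mul_zero, Real.exp_zero, smul_eq_mul, inv_neg, inv_inv]
    ring
  rw [h3, h1] at h2
  refine h2.trans ?_
  have : jumpSymbol ν t⁻¹ / (t⁻¹ * (jumpSymbol ν t⁻¹ + l)) =
      t * jumpSymbol ν t⁻¹ / (jumpSymbol ν t⁻¹ + l) := by field_simp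
  rw [this]
  gcongr
  linarith

lemma integrable_sub_shift {ψ : ℝ → ℝ} {L : NNReal} (hψ : LipschitzWith L ψ) (t : ℝ) :
    Integrable (fun s => ψ t - ψ (t + s)) ν := by
  refine (h.integrable_id.const_mul L).mono'
    (hψ.continuous.measurable.comp (by fun_prop) |>.const_sub _).aestronglyMeasurable ?_
  filter_upwards [h.ae_pos] with s hs
  have := hψ.dist_le_mul t (t + s)
  rw [Real.dist_eq, Real.dist_eq] at this
  simpa [abs_of_pos hs] using this

/-- Uniform over the truncations, so that it can serve as a dominating bound; the Lipschitz estimate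
absorbs the singularity of `ν` at `0`. -/
lemma abs_jumpAdjoint_le {μ : Measure ℝ} (hμ : μ ≤ ν) {ψ : ℝ → ℝ} {L : NNReal}
    (hψ : LipschitzWith L ψ) (t : ℝ) : |jumpAdjoint μ ψ t| ≤ L * ∫ s, s ∂ν := by
  have hi := h.integrable_id.mono_measure hμ
  have h1 : |jumpAdjoint μ ψ t| ≤ ∫ s, L * s ∂μ := by
    refine norm_integral_le_of_norm_le (f := fun s => ψ t - ψ (t + s)) (hi.const_mul (L : ℝ)) ?_
    filter_upwards [ae_mono hμ h.ae_pos] with s hs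
    have := hψ.dist_le_mul t (t + s)
    rw [Real.dist_eq, Real.dist_eq] at this
    simpa [abs_of_pos hs] using this
  rw [integral_const_mul] at h1
  refine h1.trans (mul_le_mul_of_nonneg_left ?_ L.2)
  exact integral_mono_measure hμ (h.ae_pos.mono fun s hs => hs.le) h.integrable_id

lemma jumpAdjoint_eq_zero {μ : Measure ℝ} (hμ : μ ≤ ν) {ψ : ℝ → ℝ} {T : ℝ}
    (h0 : ∀ t, t ∉ Icc 0 T → ψ t = 0) {t : ℝ} (ht : t ∉ Icc (-δ) T) :
    jumpAdjoint μ ψ t = 0 := by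
  refine integral_eq_zero_of_ae ?_
  filter_upwards [ae_mono hμ h.support] with s hs
  have hδ := h.delta_pos
  simp only [mem_Icc, not_and_or, not_le, Pi.zero_apply] at *
  rw [h0 t (by rcases ht with ht | ht <;> [left; right] <;> linarith),
    h0 (t + s) (by rcases ht with ht | ht <;> [left; right] <;> linarith [hs.1, hs.2]), sub_zero]

lemma integral_relaxFun_mul_jumpAdjoint {l : ℝ} (hl : 0 ≤ l) {ψ : ℝ → ℝ} {L : NNReal}
    (hψ : LipschitzWith L ψ) {T : ℝ} (h0 : ∀ t, t ∉ Ioc 0 T → ψ t = 0) :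
    ∫ t, relaxFun ν δ l t * (jumpAdjoint ν ψ t + l * ψ t) = 0 := by
  have hsupp : HasCompactSupport ψ :=
    HasCompactSupport.of_support_subset_isCompact (isCompact_Icc (a := 0) (b := T)) fun t ht => by
      by_contra hc
      exact ht (h0 t fun h' => hc (Ioc_subset_Icc_self h'))
  have h0' : ∀ t, t ∉ Icc 0 T → ψ t = 0 := fun t ht => h0 t fun h' => ht (Ioc_subset_Icc_self h')
  have hle : ∀ n, truncJump ν δ n ≤ ν := fun n => Measure.restrict_le_self
  obtain ⟨C, hC⟩ := hsupp.exists_bound_of_continuous hψ.continuous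
  have h1 : Tendsto (fun n => ∫ t, relaxApprox (truncJump ν δ n) l t *
      (jumpAdjoint (truncJump ν δ n) ψ t + l * ψ t)) atTop
      (𝓝 (∫ t, relaxFun ν δ l t * (jumpAdjoint ν ψ t + l * ψ t))) := by
    refine tendsto_integral_of_dominated_convergence
      ((Icc (-δ) T).indicator fun _ => L * ∫ s, s ∂ν + l * C) (fun n => ?_) ?_ (fun n => ?_) ?_
    · have := h.isFiniteMeasure_truncJump n
      refine (Measurable.mul ((measurable_relaxApprox _).comp
        (f := fun t : ℝ => (l, t)) (by fun_prop)) (Measurable.add ?_ ?_)).aestronglyMeasurable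
      · have hm : Measurable fun p : ℝ × ℝ => ψ p.1 - ψ (p.1 + p.2) :=
          (hψ.continuous.measurable.comp measurable_fst).sub
            (hψ.continuous.measurable.comp (by fun_prop))
        exact hm.stronglyMeasurable.integral_prod_right.measurable
      · exact hψ.continuous.measurable.const_mul l
    · exact (integrable_indicator_iff measurableSet_Icc).2 continuousOn_const.integrableOn_Icc
    · refine Eventually.of_forall fun t => ?_
      by_cases ht : t ∈ Icc (-δ) T
      · rw [indicator_of_mem ht, Real.norm_eq_abs, abs_mul]
        refine (mul_le_of_le_one_left (abs_nonneg _) (h.abs_relaxApprox_le n hl t)).trans ?_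
        refine (abs_add_le _ _).trans (add_le_add (h.abs_jumpAdjoint_le (hle n) hψ t) ?_)
        rw [abs_mul, abs_of_nonneg hl]
        exact mul_le_mul_of_nonneg_left (hC t) hl
      · rw [indicator_of_notMem ht, h.jumpAdjoint_eq_zero (hle n) h0' ht, h0' t fun h' =>
          ht ⟨by linarith [h'.1, h.delta_pos], h'.2⟩]
        simp
    · refine Eventually.of_forall fun t => ?_
      refine (h.tendsto_relaxApprox hl t).mul (Tendsto.add_const _ ?_)
      exact h.tendsto_integral_truncJump (h.integrable_sub_shift hψ t)
  refine tendsto_nhds_unique h1 (tendsto_const_nhds.congr fun n => ?_)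
  have := h.isFiniteMeasure_truncJump n
  exact (integral_relaxApprox_mul_jumpAdjoint _ (h.truncJump_pos n) hl hψ.continuous hsupp
    fun t ht => h0 t fun h' => by linarith [h'.1]).symm

end IsJumpKernel
end

/-! ### The fundamental solution: continuity, sign, mass and Laplace transform. -/

noncomputable section

/-- The fundamental solution, as the inverse Fourier transform of the relaxation function. -/
def fundKernel (ν : Measure ℝ) (δ x t : ℝ) : ℝ :=
  (2 * Real.pi)⁻¹ * ∫ k : ℝ, relaxFun ν δ (k ^ 2) t * Real.cos (k * x)

lemma integral_inv_add_sq {K : ℝ} (hK : 0 < K) :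
    ∫ k : ℝ, (K + k ^ 2)⁻¹ = Real.pi / Real.sqrt K := by
  have hs : 0 < Real.sqrt K := Real.sqrt_pos.2 hK
  have h1 := Measure.integral_comp_div (fun x : ℝ => (1 + x ^ 2)⁻¹) (Real.sqrt K)
  rw [integral_univ_inv_one_add_sq, abs_of_pos hs, smul_eq_mul] at h1
  have h2 : ∀ k : ℝ, (K + k ^ 2)⁻¹ = K⁻¹ * (1 + (k / Real.sqrt K) ^ 2)⁻¹ := by
    intro k
    rw [div_pow, Real.sq_sqrt hK.le]
    field_simp
  simp only [h2]
  rw [integral_const_mul, h1]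
  have h3 := Real.mul_self_sqrt hK.le
  field_simp
  nlinarith

lemma integrable_inv_add_sq {K : ℝ} (hK : 0 < K) : Integrable fun k : ℝ => (K + k ^ 2)⁻¹ := by
  -- A non-integrable function has integral `0` by convention, which contradicts the positive value
  -- already computed.
  by_contra hc
  have h1 := integral_undef hc
  rw [integral_inv_add_sq hK] at h1
  have : 0 < Real.pi / Real.sqrt K := div_pos Real.pi_pos (Real.sqrt_pos.2 hK)
  linarith

namespace IsJumpKernel

variable {δ β : ℝ} {ν : Measure ℝ} (h : IsJumpKernel δ β ν)
include h

/-- Adds the trivial bound `1` to the `k ^ (-2)` decay at time `t₀`; monotonicity in time makes the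
constant uniform for `t ≥ t₀`. -/
lemma exists_relaxFun_le {t₀ : ℝ} (ht₀ : 0 < t₀) :
    ∃ C, ∀ t, t₀ ≤ t → ∀ k : ℝ, relaxFun ν δ (k ^ 2) t ≤ C * (1 + k ^ 2)⁻¹ := by
  have he : 0 < 1 - Real.exp (-1) := by
    have : Real.exp (-1) < 1 := by rw [← Real.exp_zero]; exact Real.exp_lt_exp.2 (by norm_num)
    linarith
  refine ⟨1 + jumpSymbol ν t₀⁻¹ / (1 - Real.exp (-1)), fun t ht k => ?_⟩
  have h0 : relaxFun ν δ (k ^ 2) t ≤ relaxFun ν δ (k ^ 2) t₀ :=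
    h.antitone_relaxFun (sq_nonneg k) ht
  refine h0.trans ?_
  rw [← div_eq_mul_inv, le_div_iff₀ (by positivity), mul_add, mul_one]
  refine add_le_add (h.relaxFun_le_one (sq_nonneg k) t₀) ?_
  rcases (sq_nonneg k).eq_or_lt with hk | hk
  · rw [← hk, mul_zero]
    exact div_nonneg (h.jumpSymbol_nonneg (by positivity)) he.le
  · have h1 := h.relaxFun_mul_le hk ht₀
    rw [le_div_iff₀ hk] at h1
    rw [le_div_iff₀ he]
    have h2 : t₀ * (relaxFun ν δ (k ^ 2) t₀ * k ^ 2 * (1 - Real.exp (-1))) ≤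
        t₀ * jumpSymbol ν t₀⁻¹ := by linarith
    exact le_of_mul_le_mul_left h2 ht₀

lemma measurable_relaxFun_sq (t : ℝ) : Measurable fun k : ℝ => relaxFun ν δ (k ^ 2) t :=
  h.measurable_relaxFun.comp (f := fun k : ℝ => (k ^ 2, t)) (by fun_prop)

lemma integrable_relaxFun_sq {t : ℝ} (ht : 0 < t) :
    Integrable fun k : ℝ => relaxFun ν δ (k ^ 2) t := by
  obtain ⟨C, hC⟩ := h.exists_relaxFun_le ht
  refine (integrable_inv_one_add_sq.const_mul C).mono'
    (h.measurable_relaxFun_sq t).aestronglyMeasurable (Eventually.of_forall fun k => ?_)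
  rw [Real.norm_eq_abs, abs_of_nonneg (h.relaxFun_nonneg (sq_nonneg k) t)]
  exact hC t le_rfl k

lemma abs_relaxFun_mul_cos_le (t x k : ℝ) :
    |relaxFun ν δ (k ^ 2) t * Real.cos (k * x)| ≤ relaxFun ν δ (k ^ 2) t := by
  rw [abs_mul, abs_of_nonneg (h.relaxFun_nonneg (sq_nonneg k) t)]
  exact mul_le_of_le_one_right (h.relaxFun_nonneg (sq_nonneg k) t) (Real.abs_cos_le_one _)

lemma continuousOn_fundKernel :
    ContinuousOn (fun p : ℝ × ℝ => fundKernel ν δ p.1 p.2) {p : ℝ × ℝ | 0 < p.2} := by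
  intro p hp
  refine ContinuousAt.continuousWithinAt ?_
  have hp' : 0 < p.2 := hp
  obtain ⟨C, hC⟩ := h.exists_relaxFun_le (half_pos hp')
  refine ContinuousAt.mul continuousAt_const ?_
  refine tendsto_integral_filter_of_dominated_convergence (fun k : ℝ => C * (1 + k ^ 2)⁻¹) ?_ ?_
    (integrable_inv_one_add_sq.const_mul C) ?_
  · exact Eventually.of_forall fun q =>
      ((h.measurable_relaxFun_sq q.2).mul (by fun_prop)).aestronglyMeasurable
  · have : ∀ᶠ q : ℝ × ℝ in 𝓝 p, p.2 / 2 < q.2 :=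
      continuousAt_snd.eventually (lt_mem_nhds (half_lt_self hp'))
    filter_upwards [this] with q hq
    exact Eventually.of_forall fun k =>
      (h.abs_relaxFun_mul_cos_le q.2 q.1 k).trans (hC _ hq.le k)
  · refine Eventually.of_forall fun k => ?_
    have : Continuous fun q : ℝ × ℝ => relaxFun ν δ (k ^ 2) q.2 * Real.cos (k * q.1) :=
      ((h.continuous_relaxFun (sq_nonneg k)).comp continuous_snd).mul (by fun_prop)
    exact this.tendsto p

lemma abs_fundKernel_le (x : ℝ) {t : ℝ} (ht : 0 < t) :
    |fundKernel ν δ x t| ≤ fundKernel ν δ 0 t := by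
  have hpi := Real.pi_pos
  rw [fundKernel, fundKernel, abs_mul, abs_of_pos (by positivity)]
  refine mul_le_mul_of_nonneg_left ?_ (by positivity)
  simp only [mul_zero, Real.cos_zero, mul_one]
  exact norm_integral_le_of_norm_le (f := fun k : ℝ => relaxFun ν δ (k ^ 2) t * Real.cos (k * x))
    (h.integrable_relaxFun_sq ht) (Eventually.of_forall fun k => h.abs_relaxFun_mul_cos_le t x k)

/-- The Gaussian regularisation of `2 π fundKernel`. -/
def _root_.gaussKernel (ν : Measure ℝ) (δ a x t : ℝ) : ℝ :=
  ∫ k : ℝ, relaxFun ν δ (k ^ 2) t * (Real.exp (-a * k ^ 2) * Real.cos (k * x))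

lemma abs_gaussKernel_integrand_le {a : ℝ} (ha : 0 ≤ a) (x t k : ℝ) :
    |relaxFun ν δ (k ^ 2) t * (Real.exp (-a * k ^ 2) * Real.cos (k * x))| ≤
      relaxFun ν δ (k ^ 2) t := by
  rw [abs_mul, abs_of_nonneg (h.relaxFun_nonneg (sq_nonneg k) t)]
  refine mul_le_of_le_one_right (h.relaxFun_nonneg (sq_nonneg k) t)
    ((abs_exp_mul_cos_le a k x).trans (Real.exp_le_one_iff.2 ?_))
  nlinarith [mul_nonneg ha (sq_nonneg k)]

lemma tendsto_gaussKernel (x : ℝ) {t : ℝ} (ht : 0 < t) {a : ℕ → ℝ} (ha : ∀ n, 0 < a n)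
    (hlim : Tendsto a atTop (𝓝 0)) :
    Tendsto (fun n => gaussKernel ν δ (a n) x t) atTop
      (𝓝 (2 * Real.pi * fundKernel ν δ x t)) := by
  have hpi := Real.pi_pos
  rw [fundKernel, ← mul_assoc, mul_inv_cancel₀ (by positivity), one_mul]
  refine tendsto_integral_of_dominated_convergence _ (fun n =>
    ((h.measurable_relaxFun_sq t).mul (by fun_prop)).aestronglyMeasurable)
    (h.integrable_relaxFun_sq ht) (fun n => Eventually.of_forall fun k =>
      h.abs_gaussKernel_integrand_le (ha n).le x t k) (Eventually.of_forall fun k => ?_)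
  have h1 : Tendsto (fun n => Real.exp (-a n * k ^ 2)) atTop (𝓝 (Real.exp (-0 * k ^ 2))) :=
    (Real.continuous_exp.tendsto _).comp ((hlim.neg).mul_const _)
  simp only [neg_zero, zero_mul, Real.exp_zero] at h1
  simpa using (h1.mul_const (Real.cos (k * x))).const_mul (relaxFun ν δ (k ^ 2) t)

lemma abs_gaussKernel_le {a : ℝ} (ha : 0 ≤ a) (x : ℝ) {t : ℝ} (ht : 0 < t) :
    |gaussKernel ν δ a x t| ≤ 2 * Real.pi * fundKernel ν δ 0 t := by
  have hpi := Real.pi_pos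
  rw [fundKernel, ← mul_assoc, mul_inv_cancel₀ (by positivity), one_mul]
  simp only [mul_zero, Real.cos_zero, mul_one]
  exact norm_integral_le_of_norm_le
    (f := fun k : ℝ => relaxFun ν δ (k ^ 2) t * (Real.exp (-a * k ^ 2) * Real.cos (k * x)))
    (h.integrable_relaxFun_sq ht)
    (Eventually.of_forall fun k => h.abs_gaussKernel_integrand_le ha x t k)

omit h in
lemma _root_.tendsto_one_div_nat_add_one : Tendsto (fun n : ℕ => 1 / ((n : ℝ) + 1)) atTop (𝓝 0) :=
  tendsto_one_div_add_atTop_nhds_zero_nat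

/-- A limit of Gaussian regularisations, each nonnegative by `gaussPos_relaxFun`. -/
lemma fundKernel_nonneg (x : ℝ) {t : ℝ} (ht : 0 < t) : 0 ≤ fundKernel ν δ x t := by
  have h1 := ge_of_tendsto' (h.tendsto_gaussKernel x ht (a := fun n : ℕ => 1 / ((n : ℝ) + 1))
    (fun n => by positivity) tendsto_one_div_nat_add_one)
    fun n => h.gaussPos_relaxFun t _ (by positivity) x
  have hpi := Real.pi_pos
  exact nonneg_of_mul_nonneg_right h1 (by positivity)

lemma continuous_fundKernel_left {t : ℝ} (ht : 0 < t) :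
    Continuous fun x => fundKernel ν δ x t :=
  h.continuousOn_fundKernel.comp_continuous (f := fun x : ℝ => (x, t)) (by fun_prop) fun _ => ht

/-- By Fubini the left side is the average of `relaxFun ≤ 1` against a Gaussian in `k` of total mass
one. Bounding the mass this way avoids knowing beforehand that the kernel is integrable in `x`. -/
lemma integral_fundKernel_mul_gaussian_le {t : ℝ} (ht : 0 < t) {b : ℝ} (hb : 0 < b) :
    ∫ x, fundKernel ν δ x t * Real.exp (-b * x ^ 2) ≤ 1 := by
  have hpi := Real.pi_pos
  have hint : Integrable (fun p : ℝ × ℝ =>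
      relaxFun ν δ (p.2 ^ 2) t * Real.cos (p.2 * p.1) * Real.exp (-b * p.1 ^ 2))
      (volume.prod volume) := by
    have h1 : Integrable (fun p : ℝ × ℝ => Real.exp (-b * p.1 ^ 2) * relaxFun ν δ (p.2 ^ 2) t)
        (volume.prod volume) :=
      (integrable_exp_neg_mul_sq hb).mul_prod (h.integrable_relaxFun_sq ht)
    refine h1.mono' ?_ (Eventually.of_forall fun p => ?_)
    · exact ((((h.measurable_relaxFun_sq t).comp measurable_snd).mul (by fun_prop)).mul
        (by fun_prop)).aestronglyMeasurable
    · rw [Real.norm_eq_abs, abs_mul, abs_of_pos (Real.exp_pos _), mul_comm]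
      exact mul_le_mul_of_nonneg_left (h.abs_relaxFun_mul_cos_le _ _ _) (Real.exp_pos _).le
  have e1 : ∫ x, fundKernel ν δ x t * Real.exp (-b * x ^ 2) =
      (2 * Real.pi)⁻¹ * ∫ k : ℝ, ∫ x : ℝ,
        relaxFun ν δ (k ^ 2) t * Real.cos (k * x) * Real.exp (-b * x ^ 2) := by
    rw [← integral_integral_swap hint, ← integral_const_mul]
    congr 1; ext x
    rw [fundKernel, integral_mul_const, mul_assoc]
  have e2 : ∀ k : ℝ, ∫ x : ℝ, relaxFun ν δ (k ^ 2) t * Real.cos (k * x) *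
      Real.exp (-b * x ^ 2) = relaxFun ν δ (k ^ 2) t *
        (Real.sqrt (Real.pi / b) * Real.exp (-(1 / (4 * b)) * k ^ 2)) := by
    intro k
    have := integral_gaussian_mul_cos hb k
    rw [show -(1 / (4 * b)) * k ^ 2 = -k ^ 2 / (4 * b) by ring, ← this, ← integral_const_mul]
    congr 1; ext x
    rw [mul_comm k x]; ring
  rw [e1]
  simp only [e2]
  have h4 : (0 : ℝ) < 1 / (4 * b) := by positivity
  have e3 : ∫ k : ℝ, relaxFun ν δ (k ^ 2) t *
        (Real.sqrt (Real.pi / b) * Real.exp (-(1 / (4 * b)) * k ^ 2)) ≤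
      ∫ k : ℝ, Real.sqrt (Real.pi / b) * Real.exp (-(1 / (4 * b)) * k ^ 2) := by
    refine integral_mono_of_nonneg (Eventually.of_forall fun k => ?_)
      ((integrable_exp_neg_mul_sq h4).const_mul _) (Eventually.of_forall fun k => ?_)
    · exact mul_nonneg (h.relaxFun_nonneg (sq_nonneg k) t) (by positivity)
    · exact mul_le_of_le_one_left (by positivity) (h.relaxFun_le_one (sq_nonneg k) t)
  rw [integral_const_mul, integral_gaussian, ← Real.sqrt_mul (by positivity),
    show Real.pi / b * (Real.pi / (1 / (4 * b))) = (2 * Real.pi) ^ 2 by field_simp; ring,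
    Real.sqrt_sq (by positivity)] at e3
  rw [inv_mul_le_iff₀ (by positivity)]
  linarith

/-- Fatou's lemma as the Gaussian weight widens to `1`; the nonnegativity of the kernel is what
permits it. -/
lemma lintegral_fundKernel_le {t : ℝ} (ht : 0 < t) :
    ∫⁻ x, ENNReal.ofReal (fundKernel ν δ x t) ≤ 1 := by
  have hcont := h.continuous_fundKernel_left ht
  set f : ℕ → ℝ → ENNReal := fun n x =>
    ENNReal.ofReal (fundKernel ν δ x t * Real.exp (-(1 / ((n : ℝ) + 1)) * x ^ 2)) with hf
  have hlim : ∀ x, Tendsto (fun n => f n x) atTop (𝓝 (ENNReal.ofReal (fundKernel ν δ x t))) := by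
    intro x
    refine ENNReal.tendsto_ofReal ?_
    have h1 : Tendsto (fun n : ℕ => Real.exp (-(1 / ((n : ℝ) + 1)) * x ^ 2)) atTop
        (𝓝 (Real.exp (-0 * x ^ 2))) :=
      (Real.continuous_exp.tendsto _).comp (tendsto_one_div_nat_add_one.neg.mul_const _)
    simp only [neg_zero, zero_mul, Real.exp_zero] at h1
    simpa using h1.const_mul (fundKernel ν δ x t)
  have h1 : ∀ n, ∫⁻ x, f n x ≤ 1 := by
    intro n
    have hb : (0 : ℝ) < 1 / ((n : ℝ) + 1) := by positivity
    rw [hf]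
    simp only
    rw [← ofReal_integral_eq_lintegral_ofReal]
    · rw [← ENNReal.ofReal_one]
      exact ENNReal.ofReal_le_ofReal (h.integral_fundKernel_mul_gaussian_le ht hb)
    · exact (integrable_exp_neg_mul_sq hb).bdd_mul hcont.aestronglyMeasurable
        (Eventually.of_forall fun x => h.abs_fundKernel_le x ht)
    · exact Eventually.of_forall fun x =>
        mul_nonneg (h.fundKernel_nonneg x ht) (Real.exp_pos _).le
  calc ∫⁻ x, ENNReal.ofReal (fundKernel ν δ x t)
      = ∫⁻ x, liminf (fun n => f n x) atTop := by
        congr 1; ext x; exact (hlim x).liminf_eq.symm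
    _ ≤ liminf (fun n => ∫⁻ x, f n x) atTop :=
        lintegral_liminf_le fun n => by
          have := hcont.measurable
          exact (this.mul (by fun_prop)).ennreal_ofReal
    _ ≤ 1 := by
        refine liminf_le_of_frequently_le' (Eventually.of_forall h1).frequently

lemma integrable_fundKernel {t : ℝ} (ht : 0 < t) : Integrable fun x => fundKernel ν δ x t := by
  refine ⟨(h.continuous_fundKernel_left ht).aestronglyMeasurable, ?_⟩
  rw [hasFiniteIntegral_iff_ofReal (Eventually.of_forall fun x => h.fundKernel_nonneg x ht)]
  exact (h.lintegral_fundKernel_le ht).trans_lt ENNReal.one_lt_top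

lemma integral_abs_fundKernel_le {t : ℝ} (ht : 0 < t) : ∫ x, |fundKernel ν δ x t| ≤ 1 := by
  have h1 : ∀ x, |fundKernel ν δ x t| = fundKernel ν δ x t :=
    fun x => abs_of_nonneg (h.fundKernel_nonneg x ht)
  simp only [h1]
  rw [integral_eq_lintegral_of_nonneg_ae
    (Eventually.of_forall fun x => h.fundKernel_nonneg x ht)
    (h.continuous_fundKernel_left ht).aestronglyMeasurable]
  exact ENNReal.toReal_mono ENNReal.one_ne_top (h.lintegral_fundKernel_le ht)

lemma antitoneOn_fundKernel_zero : AntitoneOn (fundKernel ν δ 0) (Ioi 0) := by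
  intro a ha b hb hab
  have hpi := Real.pi_pos
  refine mul_le_mul_of_nonneg_left ?_ (by positivity)
  simp only [mul_zero, Real.cos_zero, mul_one]
  exact integral_mono (h.integrable_relaxFun_sq hb) (h.integrable_relaxFun_sq ha)
    fun k => h.antitone_relaxFun (sq_nonneg k) hab

/-- Tonelli allows the transform under the `k`-integral, where it equals `(K / z) / (K + k ^ 2)`;
then `∫ dk / (K + k ^ 2) = π / √K`. -/
lemma laplaceTransform_fundKernel_zero {z : ℝ} (hz : 0 < z) :
    IntegrableOn (fun t => Real.exp (-z * t) * fundKernel ν δ 0 t) (Ioi 0) ∧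
    laplaceTransform (fundKernel ν δ 0) z = Real.sqrt (jumpSymbol ν z) / (2 * z) := by
  have hpi := Real.pi_pos
  have hK := h.jumpSymbol_pos hz
  have hLT : ∀ k : ℝ, ∫ t in Ioi (0 : ℝ), Real.exp (-z * t) * relaxFun ν δ (k ^ 2) t =
      jumpSymbol ν z / z * (jumpSymbol ν z + k ^ 2)⁻¹ := fun k => by
    have := h.laplaceTransform_relaxFun (sq_nonneg k) hz
    rw [laplaceTransform] at this
    rw [this]; field_simp
  have hint : Integrable (fun p : ℝ × ℝ => Real.exp (-z * p.1) * relaxFun ν δ (p.2 ^ 2) p.1)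
      ((volume.restrict (Ioi 0)).prod volume) := by
    have hm : Measurable fun p : ℝ × ℝ => Real.exp (-z * p.1) * relaxFun ν δ (p.2 ^ 2) p.1 :=
      Measurable.mul (by fun_prop) (h.measurable_relaxFun.comp
        (f := fun p : ℝ × ℝ => (p.2 ^ 2, p.1)) (by fun_prop))
    rw [integrable_prod_iff' hm.aestronglyMeasurable]
    refine ⟨Eventually.of_forall fun k => ?_, ?_⟩
    · exact integrableOn_exp_mul_of_bounded hz (h.measurable_relaxFun_right _)
        (h.abs_relaxFun_le (sq_nonneg k)) 0
    · have : ∀ k t : ℝ, ‖Real.exp (-z * t) * relaxFun ν δ (k ^ 2) t‖ =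
          Real.exp (-z * t) * relaxFun ν δ (k ^ 2) t := fun k t => by
        rw [Real.norm_eq_abs, abs_of_nonneg]
        exact mul_nonneg (Real.exp_pos _).le (h.relaxFun_nonneg (sq_nonneg k) t)
      simp only [this, hLT]
      exact (integrable_inv_add_sq hK).const_mul _
  have hval : ∀ t, ∫ k : ℝ, Real.exp (-z * t) * relaxFun ν δ (k ^ 2) t =
      2 * Real.pi * (Real.exp (-z * t) * fundKernel ν δ 0 t) := fun t => by
    rw [integral_const_mul, fundKernel]
    simp only [mul_zero, Real.cos_zero, mul_one]
    field_simp
  have h1 := hint.integral_prod_left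
  simp only [hval] at h1
  constructor
  · have := h1.const_mul (2 * Real.pi)⁻¹
    refine this.congr (Eventually.of_forall fun t => ?_)
    field_simp
  · have h2 := integral_integral_swap
      (f := fun t k : ℝ => Real.exp (-z * t) * relaxFun ν δ (k ^ 2) t) hint
    simp only [hval, hLT] at h2
    rw [integral_const_mul, integral_const_mul, integral_inv_add_sq hK] at h2
    rw [laplaceTransform]
    have h3 := Real.mul_self_sqrt hK.le
    have h4 : 0 < Real.sqrt (jumpSymbol ν z) := Real.sqrt_pos.2 hK
    set S := Real.sqrt (jumpSymbol ν z)
    set I := ∫ t in Ioi (0 : ℝ), Real.exp (-z * t) * fundKernel ν δ 0 t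
    rw [← h3] at h2
    field_simp at h2 ⊢
    linarith

end IsJumpKernel
end

/-! ### From the frequency-wise equations to an identity in space and time. -/

noncomputable section

/-- The partial derivative in the first variable. -/
def partialFst (φ : ℝ × ℝ → ℝ) (p : ℝ × ℝ) : ℝ := fderiv ℝ φ p (1, 0)

lemma contDiff_partialFst {φ : ℝ × ℝ → ℝ} (hφ : ContDiff ℝ ∞ φ) : ContDiff ℝ ∞ (partialFst φ) :=
  (hφ.fderiv_right (m := ∞) (by simp)).clm_apply contDiff_const

lemma hasCompactSupport_partialFst {φ : ℝ × ℝ → ℝ} (hc : HasCompactSupport φ) :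
    HasCompactSupport (partialFst φ) := hc.fderiv_apply ℝ (1, 0)

lemma hasDerivAt_partialFst {φ : ℝ × ℝ → ℝ} (hφ : ContDiff ℝ ∞ φ) (x t : ℝ) :
    HasDerivAt (fun y => φ (y, t)) (partialFst φ (x, t)) x := by
  have h1 : HasFDerivAt φ (fderiv ℝ φ (x, t)) (x, t) :=
    ((hφ.differentiable (by simp)) (x, t)).hasFDerivAt
  exact h1.comp_hasDerivAt x ((hasDerivAt_id x).prodMk (hasDerivAt_const x t))

lemma iteratedDeriv_two_eq_partialFst {φ : ℝ × ℝ → ℝ} (hφ : ContDiff ℝ ∞ φ) (x t : ℝ) :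
    iteratedDeriv 2 (fun y => φ (y, t)) x = partialFst (partialFst φ) (x, t) := by
  rw [iteratedDeriv_succ, iteratedDeriv_one]
  have : deriv (fun y => φ (y, t)) = fun y => partialFst φ (y, t) :=
    funext fun y => (hasDerivAt_partialFst hφ y t).deriv
  rw [this]
  exact (hasDerivAt_partialFst (contDiff_partialFst hφ) x t).deriv

lemma hasCompactSupport_slice {φ : ℝ × ℝ → ℝ} (hc : HasCompactSupport φ) (t : ℝ) :
    HasCompactSupport fun x => φ (x, t) := by
  refine HasCompactSupport.intro (hc.isCompact.image continuous_fst) fun x hx => ?_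
  by_contra h0
  exact hx ⟨(x, t), subset_tsupport φ h0, rfl⟩

lemma integral_mul_partialFst {φ : ℝ × ℝ → ℝ} (hφ : ContDiff ℝ ∞ φ) (hc : HasCompactSupport φ)
    {g g' : ℝ → ℝ} (hg : ∀ x, HasDerivAt g (g' x) x) (hg' : Continuous g') (t : ℝ) :
    ∫ x, g x * partialFst φ (x, t) = -∫ x, g' x * φ (x, t) := by
  have hgc : Continuous g := continuous_iff_continuousAt.2 fun x => (hg x).continuousAt
  have hφt : Continuous fun x => φ (x, t) := hφ.continuous.comp (by fun_prop)
  have hφ't : Continuous fun x => partialFst φ (x, t) :=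
    (contDiff_partialFst hφ).continuous.comp (by fun_prop)
  have hs := hasCompactSupport_slice hc t
  have hs' := hasCompactSupport_slice (hasCompactSupport_partialFst hc) t
  refine integral_mul_deriv_eq_deriv_mul_of_integrable (u := g) (u' := g')
    (v := fun x => φ (x, t)) (v' := fun x => partialFst φ (x, t)) (fun x _ => hg x)
    (fun x _ => hasDerivAt_partialFst hφ x t) ?_ ?_ ?_
  · exact (hgc.mul hφ't).integrable_of_hasCompactSupport hs'.mul_left
  · exact (hg'.mul hφt).integrable_of_hasCompactSupport hs.mul_left
  · exact (hgc.mul hφt).integrable_of_hasCompactSupport hs.mul_left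

lemma integral_cos_mul_partialFst_partialFst {φ : ℝ × ℝ → ℝ} (hφ : ContDiff ℝ ∞ φ)
    (hc : HasCompactSupport φ) (k t : ℝ) :
    ∫ x, Real.cos (k * x) * partialFst (partialFst φ) (x, t) =
      -(k ^ 2 * ∫ x, Real.cos (k * x) * φ (x, t)) := by
  have h1 : ∀ x : ℝ, HasDerivAt (fun x => Real.cos (k * x)) (-(Real.sin (k * x) * k)) x := by
    intro x
    have := ((hasDerivAt_id x).const_mul k).cos
    simpa using this
  have h2 : ∀ x : ℝ, HasDerivAt (fun x => -(Real.sin (k * x) * k)) (-(Real.cos (k * x) * k * k)) x := by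
    intro x
    have := (((hasDerivAt_id x).const_mul k).sin).mul_const k
    simp only [id_eq, mul_one] at this
    exact this.neg
  rw [integral_mul_partialFst (contDiff_partialFst hφ) (hasCompactSupport_partialFst hc) h1
    (by fun_prop), integral_mul_partialFst hφ hc h2 (by fun_prop), neg_neg,
    ← integral_const_mul, ← integral_neg]
  congr 1; ext x; ring

lemma exists_support_box {φ : ℝ × ℝ → ℝ} (hc : HasCompactSupport φ) :
    ∃ R, 0 < R ∧ ∀ x t, (R < |x| ∨ R < |t|) → φ (x, t) = 0 := by
  obtain ⟨R, hR⟩ := hc.isCompact.isBounded.exists_norm_le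
  refine ⟨max R 1, by positivity, fun x t hxt => ?_⟩
  by_contra h0
  have h1 := hR _ (subset_tsupport φ h0)
  have h2 := norm_fst_le (x, t)
  have h3 := norm_snd_le (x, t)
  simp only [Real.norm_eq_abs] at h2 h3
  have := le_max_left R 1
  rcases hxt with h | h <;> linarith

/-- The substitution `x = 2 √a y` exhibits the Gaussian as `2 π` times an approximate identity as `a
→ 0`. -/
lemma scaled_gaussian_integral {a : ℝ} (ha : 0 < a) (f : ℝ → ℝ) :
    ∫ x, Real.sqrt (Real.pi / a) * Real.exp (-x ^ 2 / (4 * a)) * f x =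
      ∫ y, 2 * Real.sqrt Real.pi * Real.exp (-1 * y ^ 2) * f (2 * Real.sqrt a * y) := by
  have hs : 0 < Real.sqrt a := Real.sqrt_pos.2 ha
  have h1 := Measure.integral_comp_mul_left
    (fun x => Real.sqrt (Real.pi / a) * Real.exp (-x ^ 2 / (4 * a)) * f x) (2 * Real.sqrt a)
  rw [abs_of_pos (by positivity), smul_eq_mul, inv_mul_eq_div, eq_div_iff (by positivity)] at h1
  rw [← h1, ← integral_mul_const]
  congr 1; ext y
  rw [mul_pow, mul_pow, Real.sq_sqrt ha.le, Real.sqrt_div Real.pi_pos.le,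
    show -(2 ^ 2 * a * y ^ 2) / (4 * a) = -1 * y ^ 2 by field_simp; ring]
  field_simp

lemma integrable_two_sqrt_pi_gaussian :
    Integrable fun y : ℝ => 2 * Real.sqrt Real.pi * Real.exp (-1 * y ^ 2) :=
  (integrable_exp_neg_mul_sq one_pos).const_mul _

lemma integral_two_sqrt_pi_gaussian :
    ∫ y : ℝ, 2 * Real.sqrt Real.pi * Real.exp (-1 * y ^ 2) = 2 * Real.pi := by
  rw [integral_const_mul, integral_gaussian, div_one, mul_assoc,
    Real.mul_self_sqrt Real.pi_pos.le]

lemma abs_scaled_gaussian_integral_le {a : ℝ} (ha : 0 < a) {f : ℝ → ℝ} {C : ℝ}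
    (hb : ∀ x, |f x| ≤ C) :
    |∫ x, Real.sqrt (Real.pi / a) * Real.exp (-x ^ 2 / (4 * a)) * f x| ≤ 2 * Real.pi * C := by
  rw [scaled_gaussian_integral ha, ← integral_two_sqrt_pi_gaussian, ← integral_mul_const]
  refine norm_integral_le_of_norm_le
    (f := fun y => 2 * Real.sqrt Real.pi * Real.exp (-1 * y ^ 2) * f (2 * Real.sqrt a * y))
    (integrable_two_sqrt_pi_gaussian.mul_const C) (Eventually.of_forall fun y => ?_)
  rw [Real.norm_eq_abs, abs_mul, abs_of_nonneg (by positivity)]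
  exact mul_le_mul_of_nonneg_left (hb _) (by positivity)

lemma tendsto_scaled_gaussian_integral {a : ℕ → ℝ} (ha : ∀ n, 0 < a n)
    (hlim : Tendsto a atTop (𝓝 0)) {f : ℝ → ℝ} (hf : Continuous f) {C : ℝ}
    (hb : ∀ x, |f x| ≤ C) :
    Tendsto (fun n => ∫ x, Real.sqrt (Real.pi / a n) * Real.exp (-x ^ 2 / (4 * a n)) * f x) atTop
      (𝓝 (2 * Real.pi * f 0)) := by
  simp only [scaled_gaussian_integral (ha _)]
  rw [← integral_two_sqrt_pi_gaussian, ← integral_mul_const]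
  refine tendsto_integral_of_dominated_convergence
    (fun y => 2 * Real.sqrt Real.pi * Real.exp (-1 * y ^ 2) * C) (fun n => ?_)
    (integrable_two_sqrt_pi_gaussian.mul_const C) (fun n => Eventually.of_forall fun y => ?_)
    (Eventually.of_forall fun y => ?_)
  · exact (Continuous.mul (by fun_prop) (hf.comp (by fun_prop))).aestronglyMeasurable
  · rw [Real.norm_eq_abs, abs_mul, abs_of_nonneg (by positivity)]
    exact mul_le_mul_of_nonneg_left (hb _) (by positivity)
  · refine Tendsto.const_mul _ ?_
    have h1 : Tendsto (fun n => 2 * Real.sqrt (a n) * y) atTop (𝓝 (2 * Real.sqrt 0 * y)) :=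
      (((Real.continuous_sqrt.tendsto 0).comp hlim).const_mul 2).mul_const y
    simp only [Real.sqrt_zero, mul_zero, zero_mul] at h1
    exact (hf.tendsto 0).comp h1

/-- At nonpositive times the relaxation function is `1`, so the regularised kernel is an explicit
Gaussian; this is the source of the Dirac history. -/
lemma gaussKernel_of_nonpos (ν : Measure ℝ) (δ : ℝ) {a : ℝ} (ha : 0 < a) (x : ℝ) {t : ℝ}
    (ht : t ≤ 0) :
    gaussKernel ν δ a x t = Real.sqrt (Real.pi / a) * Real.exp (-x ^ 2 / (4 * a)) := by
  simp only [gaussKernel, relaxFun_of_nonpos ν δ _ ht, one_mul]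
  exact integral_gaussian_mul_cos ha x

namespace IsJumpKernel

variable {δ β : ℝ} {ν : Measure ℝ} (h : IsJumpKernel δ β ν)
include h

/-- Local integrability up to `t = 0`, where the kernel may be singular, is read off from the
convergence of the Laplace transform at `z = 1`. -/
lemma integrableOn_fundKernel_zero (T : ℝ) : IntegrableOn (fundKernel ν δ 0) (Ioc 0 T) := by
  have h1 := (h.laplaceTransform_fundKernel_zero one_pos).1.mono_set
    (Ioc_subset_Ioi_self : Ioc 0 T ⊆ Ioi 0)
  have h2 : IntegrableOn (fun t => Real.exp t * (Real.exp (-1 * t) * fundKernel ν δ 0 t))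
      (Ioc 0 T) := by
    refine Integrable.bdd_mul (c := Real.exp T) h1 (by fun_prop) ?_
    filter_upwards [ae_restrict_mem measurableSet_Ioc] with t ht
    rw [Real.norm_eq_abs, abs_of_pos (Real.exp_pos _)]
    exact Real.exp_le_exp.2 ht.2
  refine h2.congr (Eventually.of_forall fun t => ?_)
  simp only
  rw [← mul_assoc, ← Real.exp_add]
  simp

/-- The vanishing identities are integrated against `exp(-a k ^ 2) dk`; the Gaussian weight makes
Fubini legitimate over all times, including `t ≤ 0`, where `relaxFun` has no decay in `k`. -/
lemma integral_gaussKernel_mul_eq_zero {F : ℝ × ℝ → ℝ} (hF : Integrable F)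
    (hvan : ∀ k : ℝ, ∫ t, ∫ x, relaxFun ν δ (k ^ 2) t * (Real.cos (k * x) * F (t, x)) = 0)
    {a : ℝ} (ha : 0 < a) :
    Integrable (fun t => ∫ x, gaussKernel ν δ a x t * F (t, x)) ∧
    ∫ t, ∫ x, gaussKernel ν δ a x t * F (t, x) = 0 := by
  have hm : Measurable fun q : (ℝ × ℝ) × ℝ => relaxFun ν δ (q.2 ^ 2) q.1.1 *
      (Real.exp (-a * q.2 ^ 2) * Real.cos (q.2 * q.1.2)) :=
    (h.measurable_relaxFun.comp (f := fun q : (ℝ × ℝ) × ℝ => (q.2 ^ 2, q.1.1)) (by fun_prop)).mul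
      (by fun_prop)
  have hint : Integrable (fun q : (ℝ × ℝ) × ℝ => relaxFun ν δ (q.2 ^ 2) q.1.1 *
      (Real.exp (-a * q.2 ^ 2) * Real.cos (q.2 * q.1.2)) * F q.1) (volume.prod volume) := by
    have h1 : Integrable (fun q : (ℝ × ℝ) × ℝ => ‖F q.1‖ * Real.exp (-a * q.2 ^ 2))
        (volume.prod volume) := hF.norm.mul_prod (integrable_exp_neg_mul_sq ha)
    refine h1.mono' (hm.aestronglyMeasurable.mul hF.aestronglyMeasurable.comp_fst)
      (Eventually.of_forall fun q => ?_)
    rw [norm_mul, mul_comm]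
    refine mul_le_mul_of_nonneg_left ?_ (norm_nonneg _)
    rw [Real.norm_eq_abs, abs_mul]
    exact (mul_le_of_le_one_left (abs_nonneg _) (h.abs_relaxFun_le (sq_nonneg _) _)).trans
      (abs_exp_mul_cos_le _ _ _)
  have e1 : ∀ p : ℝ × ℝ, ∫ k : ℝ, relaxFun ν δ (k ^ 2) p.1 *
      (Real.exp (-a * k ^ 2) * Real.cos (k * p.2)) * F p = gaussKernel ν δ a p.2 p.1 * F p :=
    fun p => by rw [integral_mul_const]; rfl
  have hG : Integrable (fun p : ℝ × ℝ => gaussKernel ν δ a p.2 p.1 * F p)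
      (volume.prod volume) := by
    have := hint.integral_prod_left
    simp only [e1] at this
    exact this
  refine ⟨hG.integral_prod_left, ?_⟩
  rw [← integral_prod _ hG]
  simp only [← e1]
  have hsw := integral_integral_swap (f := fun (p : ℝ × ℝ) (k : ℝ) => relaxFun ν δ (k ^ 2) p.1 *
      (Real.exp (-a * k ^ 2) * Real.cos (k * p.2)) * F p) hint
  refine hsw.trans (integral_eq_zero_of_ae ?_)
  filter_upwards [hint.prod_left_ae] with k hk
  rw [Pi.zero_apply]
  have h2 : Integrable (fun p : ℝ × ℝ => relaxFun ν δ (k ^ 2) p.1 *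
      (Real.exp (-a * k ^ 2) * Real.cos (k * p.2)) * F p) (volume.prod volume) := hk
  have h3 := integral_prod _ h2
  refine h3.trans ?_
  have : ∀ t x : ℝ, relaxFun ν δ (k ^ 2) t * (Real.exp (-a * k ^ 2) * Real.cos (k * x)) *
      F (t, x) = Real.exp (-a * k ^ 2) *
        (relaxFun ν δ (k ^ 2) t * (Real.cos (k * x) * F (t, x))) := fun t x => by ring
  have h4 := hvan k
  simp only [integral_const_mul] at h4
  simp only [this, integral_const_mul, h4, mul_zero]

lemma integral_fundKernel_mul_of_vanishing {F : ℝ × ℝ → ℝ} (hF : Continuous F)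
    (hc : HasCompactSupport F)
    (hvan : ∀ k : ℝ, ∫ t, ∫ x, relaxFun ν δ (k ^ 2) t * (Real.cos (k * x) * F (t, x)) = 0) :
    (∫ t in Iic (0 : ℝ), F (t, 0)) + (∫ t in Ioi (0 : ℝ), ∫ x, fundKernel ν δ x t * F (t, x)) = 0 := by
  have hpi := Real.pi_pos
  obtain ⟨R, hR, hbox⟩ := exists_support_box hc
  obtain ⟨C, hC⟩ := hc.exists_bound_of_continuous hF
  have hFi : Integrable F := hF.integrable_of_hasCompactSupport hc
  set a : ℕ → ℝ := fun n => 1 / ((n : ℝ) + 1) with ha_def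
  have ha : ∀ n, 0 < a n := fun n => by positivity
  have hlim : Tendsto a atTop (𝓝 0) := tendsto_one_div_nat_add_one
  have hI := fun n => h.integral_gaussKernel_mul_eq_zero hFi hvan (ha n)
  have hsum : ∀ n, (∫ t in Iic (0 : ℝ), ∫ x, gaussKernel ν δ (a n) x t * F (t, x)) +
      (∫ t in Ioi (0 : ℝ), ∫ x, gaussKernel ν δ (a n) x t * F (t, x)) = 0 := fun n => by
    rw [← compl_Iic, integral_add_compl measurableSet_Iic (hI n).1, (hI n).2]
  have hslice : ∀ t, Continuous fun x => F (t, x) := fun t => hF.comp (by fun_prop)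
  -- Nonpositive times: the Gaussians concentrate at `x = 0`.
  have l1 : Tendsto (fun n => ∫ t in Iic (0 : ℝ), ∫ x, gaussKernel ν δ (a n) x t * F (t, x)) atTop
      (𝓝 (∫ t in Iic (0 : ℝ), 2 * Real.pi * F (t, 0))) := by
    refine tendsto_integral_of_dominated_convergence
      ((Icc (-R) 0).indicator fun _ => 2 * Real.pi * C)
      (fun n => (hI n).1.aestronglyMeasurable.restrict) ?_ (fun n => ?_) ?_
    · exact ((integrable_indicator_iff measurableSet_Icc).2
        continuousOn_const.integrableOn_Icc).integrableOn
    · filter_upwards [ae_restrict_mem measurableSet_Iic] with t ht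
      by_cases htR : t ∈ Icc (-R) 0
      · rw [indicator_of_mem htR]
        simp only [gaussKernel_of_nonpos ν δ (ha n) _ ht]
        exact abs_scaled_gaussian_integral_le (ha n) fun x => hC _
      · have h0 : ∀ x, F (t, x) = 0 := fun x => hbox t x <| Or.inl <| by
          rw [abs_of_nonpos ht]
          by_contra hcon
          exact htR ⟨by linarith, ht⟩
        simp [h0, htR]
    · filter_upwards [ae_restrict_mem measurableSet_Iic] with t ht
      simp only [gaussKernel_of_nonpos ν δ (ha _) _ ht]
      exact tendsto_scaled_gaussian_integral ha hlim (hslice t) fun x => hC _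
  have hxint : ∀ t, Integrable fun x => F (t, x) := fun t =>
    (hslice t).integrable_of_hasCompactSupport <| by
      refine HasCompactSupport.intro (isCompact_Icc (a := -R) (b := R)) fun x hx => ?_
      refine hbox t x (Or.inr ?_)
      by_contra hcon
      exact hx (abs_le.1 (not_lt.1 hcon))
  have hxb : ∀ t, ∫ x, |F (t, x)| ≤ 2 * R * C := by
    intro t
    have h1 : ∫ x, |F (t, x)| ≤ ∫ x, (Icc (-R) R).indicator (fun _ => C) x := by
      refine integral_mono (hxint t).abs ((integrable_indicator_iff measurableSet_Icc).2
        continuousOn_const.integrableOn_Icc) fun x => ?_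
      by_cases hx : x ∈ Icc (-R) R
      · simpa [indicator_of_mem hx] using hC (t, x)
      · have : F (t, x) = 0 := by
          refine hbox t x (Or.inr ?_)
          by_contra hcon
          exact hx (abs_le.1 (not_lt.1 hcon))
        simp [hx, this]
    refine h1.trans (le_of_eq ?_)
    rw [integral_indicator measurableSet_Icc, setIntegral_const, measureReal_def, Real.volume_Icc,
      ENNReal.toReal_ofReal (by linarith), smul_eq_mul]
    ring
  have hubound : ∀ n t, 0 < t → ‖∫ x, gaussKernel ν δ (a n) x t * F (t, x)‖ ≤
      2 * Real.pi * fundKernel ν δ 0 t * (2 * R * C) := by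
    intro n t ht
    have h1 : ‖∫ x, gaussKernel ν δ (a n) x t * F (t, x)‖ ≤
        ∫ x, 2 * Real.pi * fundKernel ν δ 0 t * |F (t, x)| := by
      refine norm_integral_le_of_norm_le ((hxint t).abs.const_mul _)
        (Eventually.of_forall fun x => ?_)
      rw [Real.norm_eq_abs, abs_mul]
      exact mul_le_mul_of_nonneg_right (h.abs_gaussKernel_le (ha n).le x ht) (abs_nonneg _)
    rw [integral_const_mul] at h1
    refine h1.trans (mul_le_mul_of_nonneg_left (hxb t) ?_)
    exact mul_nonneg (by positivity) (h.fundKernel_nonneg 0 ht)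
  -- Positive times: the regularised kernels are dominated by `2 π` times the kernel at `x = 0`,
  -- which is integrable in time near `0`.
  have l2 : Tendsto (fun n => ∫ t in Ioi (0 : ℝ), ∫ x, gaussKernel ν δ (a n) x t * F (t, x)) atTop
      (𝓝 (∫ t in Ioi (0 : ℝ), ∫ x, 2 * Real.pi * fundKernel ν δ x t * F (t, x))) := by
    refine tendsto_integral_of_dominated_convergence
      ((Ioc 0 R).indicator fun t => 2 * Real.pi * fundKernel ν δ 0 t * (2 * R * C))
      (fun n => (hI n).1.aestronglyMeasurable.restrict) ?_ (fun n => ?_) ?_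
    · exact ((integrable_indicator_iff measurableSet_Ioc).2
        (((h.integrableOn_fundKernel_zero R).const_mul _).mul_const _)).integrableOn
    · filter_upwards [ae_restrict_mem measurableSet_Ioi] with t ht
      have ht' : 0 < t := ht
      by_cases htR : t ≤ R
      · rw [indicator_of_mem (show t ∈ Ioc 0 R from ⟨ht', htR⟩)]
        exact hubound n t ht'
      · have h0 : ∀ x, F (t, x) = 0 := fun x => hbox t x <| Or.inl <| by
          rw [abs_of_pos ht']; linarith
        simp [h0, htR]
    · filter_upwards [ae_restrict_mem measurableSet_Ioi] with t ht
      have ht' : 0 < t := ht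
      refine tendsto_integral_of_dominated_convergence
        (fun x => 2 * Real.pi * fundKernel ν δ 0 t * |F (t, x)|) (fun n => ?_)
        ((hxint t).abs.const_mul _) (fun n => Eventually.of_forall fun x => ?_)
        (Eventually.of_forall fun x => (h.tendsto_gaussKernel x ht' ha hlim).mul_const _)
      · refine AEStronglyMeasurable.mul ?_ (hslice t).aestronglyMeasurable
        have hm : Measurable fun q : ℝ × ℝ => relaxFun ν δ (q.2 ^ 2) t *
            (Real.exp (-a n * q.2 ^ 2) * Real.cos (q.2 * q.1)) :=
          (h.measurable_relaxFun.comp (f := fun q : ℝ × ℝ => (q.2 ^ 2, t)) (by fun_prop)).mul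
            (by fun_prop)
        exact hm.stronglyMeasurable.integral_prod_right'.aestronglyMeasurable
      · rw [Real.norm_eq_abs, abs_mul]
        exact mul_le_mul_of_nonneg_right (h.abs_gaussKernel_le (ha n).le x ht') (abs_nonneg _)
  have h3 := tendsto_nhds_unique ((l1.add l2).congr hsum) tendsto_const_nhds
  simp only [mul_assoc, integral_const_mul] at h3
  have h4 : 2 * Real.pi * ((∫ t in Iic (0 : ℝ), F (t, 0)) +
      (∫ t in Ioi (0 : ℝ), ∫ x, fundKernel ν δ x t * F (t, x))) = 0 := by linarith
  exact (mul_eq_zero.1 h4).resolve_left (by positivity)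

end IsJumpKernel
end

/-! ### The weak equation for the constructed kernel. -/

noncomputable section

lemma integrable_indicator_Icc_const (a b C : ℝ) :
    Integrable ((Icc a b).indicator fun _ => C) :=
  (integrable_indicator_iff measurableSet_Icc).2 continuousOn_const.integrableOn_Icc

lemma lipschitzWith_slice {φ : ℝ × ℝ → ℝ} {L : NNReal} (hL : LipschitzWith L φ) (x : ℝ) :
    LipschitzWith L fun r => φ (x, r) :=
  LipschitzWith.of_dist_le_mul fun a b => by
    simpa [Prod.dist_eq] using hL.dist_le_mul (x, a) (x, b)

lemma exists_time_support {φ : ℝ × ℝ → ℝ} (hc : HasCompactSupport φ)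
    (hs : tsupport φ ⊆ {p : ℝ × ℝ | 0 < p.2}) :
    ∃ R, 0 < R ∧ (∀ x t, R < |x| → φ (x, t) = 0) ∧ ∀ x t, t ∉ Ioc 0 R → φ (x, t) = 0 := by
  obtain ⟨R, hR, hbox⟩ := exists_support_box hc
  refine ⟨R, hR, fun x t hx => hbox x t (Or.inl hx), fun x t ht => ?_⟩
  by_contra h0
  have h1 : 0 < t := hs (subset_tsupport φ h0)
  refine h0 (hbox x t (Or.inr ?_))
  rw [abs_of_pos h1]
  by_contra h2
  exact ht ⟨h1, not_lt.1 h2⟩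

namespace IsJumpKernel

variable {δ β : ℝ} {ν : Measure ℝ} (h : IsJumpKernel δ β ν)
include h

lemma continuous_jumpAdjoint {φ : ℝ × ℝ → ℝ} {L : NNReal} (hL : LipschitzWith L φ) :
    Continuous fun p : ℝ × ℝ => jumpAdjoint ν (fun r => φ (p.2, r)) p.1 := by
  have hφ := hL.continuous
  refine continuous_of_dominated (bound := fun s => L * s) (fun p => ?_) (fun p => ?_)
    (h.integrable_id.const_mul _) ?_
  · exact Continuous.aestronglyMeasurable (by fun_prop)
  · filter_upwards [h.ae_pos] with s hs
    have := (lipschitzWith_slice hL p.2).dist_le_mul p.1 (p.1 + s)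
    rw [Real.dist_eq, Real.dist_eq] at this
    simpa [abs_of_pos hs] using this
  · exact Eventually.of_forall fun s => by fun_prop

lemma integrable_sub_shift_mul [SFinite ν] {φ : ℝ × ℝ → ℝ} {L : NNReal} (hL : LipschitzWith L φ)
    {R : ℝ} (hR : ∀ x t, R < |x| → φ (x, t) = 0) {g : ℝ → ℝ} (hg : Continuous g)
    (hg1 : ∀ x, |g x| ≤ 1) (t : ℝ) :
    Integrable (fun p : ℝ × ℝ => g p.2 * (φ (p.2, t) - φ (p.2, t + p.1))) (ν.prod volume) := by
  have hφ := hL.continuous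
  have h1 : Integrable (fun p : ℝ × ℝ => p.1 * (Icc (-R) R).indicator (fun _ => (L : ℝ)) p.2)
      (ν.prod volume) := h.integrable_id.mul_prod (integrable_indicator_Icc_const _ _ _)
  refine h1.mono' (Continuous.aestronglyMeasurable (by fun_prop)) ?_
  have h2 : ∀ᵐ p : ℝ × ℝ ∂(ν.prod volume), 0 < p.1 :=
    Measure.quasiMeasurePreserving_fst.ae h.ae_pos
  filter_upwards [h2] with p hp
  by_cases hx : p.2 ∈ Icc (-R) R
  · rw [indicator_of_mem hx, Real.norm_eq_abs, abs_mul]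
    refine (mul_le_of_le_one_left (abs_nonneg _) (hg1 _)).trans ?_
    have := (lipschitzWith_slice hL p.2).dist_le_mul t (t + p.1)
    rw [Real.dist_eq, Real.dist_eq] at this
    simpa [abs_of_pos hp, mul_comm] using this
  · have hx' : R < |p.2| := by
      by_contra hcon
      exact hx (abs_le.1 (not_lt.1 hcon))
    rw [indicator_of_notMem hx, hR _ _ hx', hR _ _ hx']
    simp

/-- Fubini is allowed although `ν` is infinite: the increment of `φ` is at most `L s`, and `s` is
`ν`-integrable. -/
lemma jumpAdjoint_integral_mul [SFinite ν] {φ : ℝ × ℝ → ℝ} {L : NNReal} (hL : LipschitzWith L φ)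
    (hc : HasCompactSupport φ)
    {R : ℝ} (hR : ∀ x t, R < |x| → φ (x, t) = 0) {g : ℝ → ℝ} (hg : Continuous g)
    (hg1 : ∀ x, |g x| ≤ 1) (t : ℝ) :
    jumpAdjoint ν (fun r => ∫ x, g x * φ (x, r)) t =
      ∫ x, g x * jumpAdjoint ν (fun r => φ (x, r)) t := by
  have hφ := hL.continuous
  have hi : ∀ r, Integrable fun x => g x * φ (x, r) := fun r =>
    (hg.mul (hφ.comp (by fun_prop))).integrable_of_hasCompactSupport
      (hasCompactSupport_slice hc r).mul_left
  have hsw := integral_integral_swap (f := fun s x : ℝ => g x * (φ (x, t) - φ (x, t + s)))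
    (h.integrable_sub_shift_mul hL hR hg hg1 t)
  simp only [integral_const_mul] at hsw
  simp only [jumpAdjoint]
  rw [← hsw]
  congr 1; ext s
  rw [← integral_sub (hi t) (hi (t + s))]
  congr 1; ext x; ring

omit h in
lemma _root_.lipschitzWith_integral_mul {φ : ℝ × ℝ → ℝ} {L : NNReal} (hL : LipschitzWith L φ)
    (hc : HasCompactSupport φ)
    {R : ℝ} (hR0 : 0 < R) (hR : ∀ x t, R < |x| → φ (x, t) = 0) {g : ℝ → ℝ} (hg : Continuous g)
    (hg1 : ∀ x, |g x| ≤ 1) :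
    LipschitzWith (L * (2 * R).toNNReal) fun r => ∫ x, g x * φ (x, r) := by
  have hφ := hL.continuous
  have hi : ∀ r, Integrable fun x => g x * φ (x, r) := fun r =>
    (hg.mul (hφ.comp (by fun_prop))).integrable_of_hasCompactSupport
      (hasCompactSupport_slice hc r).mul_left
  refine LipschitzWith.of_dist_le_mul fun a b => ?_
  rw [Real.dist_eq, ← integral_sub (hi a) (hi b)]
  refine (norm_integral_le_of_norm_le (f := fun x => g x * φ (x, a) - g x * φ (x, b))
    (integrable_indicator_Icc_const (-R) R (L * dist a b))
    (Eventually.of_forall fun x => ?_)).trans (le_of_eq ?_)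
  · by_cases hx : x ∈ Icc (-R) R
    · rw [indicator_of_mem hx, Real.norm_eq_abs, ← mul_sub, abs_mul]
      refine (mul_le_of_le_one_left (abs_nonneg _) (hg1 _)).trans ?_
      exact (lipschitzWith_slice hL x).dist_le_mul a b
    · have hx' : R < |x| := by
        by_contra hcon
        exact hx (abs_le.1 (not_lt.1 hcon))
      rw [indicator_of_notMem hx, hR _ _ hx', hR _ _ hx']
      simp
  · rw [integral_indicator measurableSet_Icc, setIntegral_const, measureReal_def, Real.volume_Icc,
      ENNReal.toReal_ofReal (by linarith), smul_eq_mul, NNReal.coe_mul,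
      Real.coe_toNNReal _ (by linarith)]
    ring

omit h in
lemma _root_.exists_lipschitzWith_of_contDiff {φ : ℝ × ℝ → ℝ} (hφ : ContDiff ℝ ∞ φ)
    (hc : HasCompactSupport φ) : ∃ L, LipschitzWith L φ :=
  (hφ.of_le (by simp : (1 : WithTop ℕ∞) ≤ ∞)).lipschitzWith_of_hasCompactSupport hc (by simp)

/-- The adjoint equation applied to a test function, as a function of `(t, x)`. -/
def _root_.testOperator (ν : Measure ℝ) (φ : ℝ × ℝ → ℝ) (p : ℝ × ℝ) : ℝ :=
  jumpAdjoint ν (fun r => φ (p.2, r)) p.1 - iteratedDeriv 2 (fun y => φ (y, p.1)) p.2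

lemma continuous_testOperator {φ : ℝ × ℝ → ℝ} (hφ : ContDiff ℝ ∞ φ) (hc : HasCompactSupport φ) :
    Continuous (testOperator ν φ) := by
  obtain ⟨L, hL⟩ := exists_lipschitzWith_of_contDiff hφ hc
  have hφ2 := contDiff_partialFst (contDiff_partialFst hφ)
  refine (h.continuous_jumpAdjoint hL).sub ?_
  simp only [iteratedDeriv_two_eq_partialFst hφ]
  exact hφ2.continuous.comp (by fun_prop)

lemma hasCompactSupport_testOperator {φ : ℝ × ℝ → ℝ} (hφ : ContDiff ℝ ∞ φ)
    (hc : HasCompactSupport φ) (hs : tsupport φ ⊆ {p : ℝ × ℝ | 0 < p.2}) :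
    HasCompactSupport (testOperator ν φ) := by
  obtain ⟨R, hR0, hRx, hRt⟩ := exists_time_support hc hs
  have hc2 := hasCompactSupport_partialFst (hasCompactSupport_partialFst hc)
  have hGs : HasCompactSupport fun p : ℝ × ℝ => jumpAdjoint ν (fun r => φ (p.2, r)) p.1 := by
    refine HasCompactSupport.intro ((isCompact_Icc (a := -δ) (b := R)).prod
      (isCompact_Icc (a := -R) (b := R))) fun p hp => ?_
    by_cases hx : R < |p.2|
    · simp [jumpAdjoint, hRx _ _ hx]
    · refine h.jumpAdjoint_eq_zero le_rfl (T := R)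
        (fun t ht => hRt p.2 t fun h' => ht (Ioc_subset_Icc_self h')) fun ht => hp ⟨ht, ?_⟩
      exact abs_le.1 (not_lt.1 hx)
  refine hGs.sub ?_
  simp only [iteratedDeriv_two_eq_partialFst hφ]
  exact hc2.comp_homeomorph (Homeomorph.prodComm ℝ ℝ)

/-- The cosine transform in `x` turns the test operator into `jumpAdjoint ν ψ + k ^ 2 ψ`, with `ψ`
the transform of `φ`, and this pairs to zero with `relaxFun` for each `k`. -/
lemma fundKernel_weak_eq [SFinite ν] {φ : ℝ × ℝ → ℝ} (hφ : ContDiff ℝ ∞ φ)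
    (hc : HasCompactSupport φ) (hs : tsupport φ ⊆ {p : ℝ × ℝ | 0 < p.2}) :
    (∫ t in Iic (0 : ℝ), jumpAdjoint ν (fun r => φ (0, r)) t) +
      (∫ t in Ioi (0 : ℝ), ∫ x, fundKernel ν δ x t * testOperator ν φ (t, x)) = 0 := by
  obtain ⟨R, hR0, hRx, hRt⟩ := exists_time_support hc hs
  obtain ⟨L, hL⟩ := exists_lipschitzWith_of_contDiff hφ hc
  have hφ2 := contDiff_partialFst (contDiff_partialFst hφ)
  have hc2 := hasCompactSupport_partialFst (hasCompactSupport_partialFst hc)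
  have hsup2 : ∀ p : ℝ × ℝ, p ∉ tsupport φ → partialFst (partialFst φ) p = 0 := by
    intro p hp
    have h1 : tsupport (partialFst φ) ⊆ tsupport φ := tsupport_fderiv_apply_subset ℝ (1, 0)
    have h2 : tsupport (partialFst (partialFst φ)) ⊆ tsupport (partialFst φ) :=
      tsupport_fderiv_apply_subset ℝ (1, 0)
    exact image_eq_zero_of_notMem_tsupport fun h3 => hp (h1 (h2 h3))
  have hF : ∀ t x, testOperator ν φ (t, x) =
      jumpAdjoint ν (fun r => φ (x, r)) t - partialFst (partialFst φ) (x, t) := fun t x => by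
    rw [testOperator, iteratedDeriv_two_eq_partialFst hφ]
  have hGc : Continuous fun p : ℝ × ℝ => jumpAdjoint ν (fun r => φ (p.2, r)) p.1 :=
    h.continuous_jumpAdjoint hL
  have hGx : ∀ x t, R < |x| → jumpAdjoint ν (fun r => φ (x, r)) t = 0 := by
    intro x t hx
    simp [jumpAdjoint, hRx x _ hx]
  have hvan : ∀ k : ℝ, ∫ t, ∫ x, relaxFun ν δ (k ^ 2) t * (Real.cos (k * x) * testOperator ν φ (t, x)) = 0 := by
    intro k
    set ψ : ℝ → ℝ := fun r => ∫ x, Real.cos (k * x) * φ (x, r) with hψ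
    have hcos : Continuous fun x => Real.cos (k * x) := by fun_prop
    have hcos1 : ∀ x, |Real.cos (k * x)| ≤ 1 := fun x => Real.abs_cos_le_one _
    have h1 := h.integral_relaxFun_mul_jumpAdjoint (sq_nonneg k) (ψ := ψ) (T := R)
      (lipschitzWith_integral_mul hL hc hR0 hRx hcos hcos1)
      (fun t ht => by simp [hψ, hRt _ t ht])
    rw [← h1]
    congr 1; ext t
    rw [integral_const_mul, hψ, h.jumpAdjoint_integral_mul hL hc hRx hcos hcos1 t]
    congr 1
    have h2 := integral_cos_mul_partialFst_partialFst hφ hc k t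
    have hi1 : Integrable fun x => Real.cos (k * x) * jumpAdjoint ν (fun r => φ (x, r)) t := by
      refine (hcos.mul (hGc.comp (f := fun x : ℝ => (t, x)) (by fun_prop))
        ).integrable_of_hasCompactSupport ?_
      refine HasCompactSupport.mul_left ?_
      refine HasCompactSupport.intro (isCompact_Icc (a := -R) (b := R)) fun x hx => hGx x t ?_
      by_contra hcon
      exact hx (abs_le.1 (not_lt.1 hcon))
    have hi2 : Integrable fun x => Real.cos (k * x) * partialFst (partialFst φ) (x, t) :=
      (hcos.mul (hφ2.continuous.comp (by fun_prop))).integrable_of_hasCompactSupport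
        (hasCompactSupport_slice hc2 t).mul_left
    rw [← sub_neg_eq_add, ← h2, ← integral_sub hi1 hi2]
    congr 1; ext x
    rw [hF]; ring
  have h3 := h.integral_fundKernel_mul_of_vanishing (h.continuous_testOperator hφ hc)
    (h.hasCompactSupport_testOperator hφ hc hs) hvan
  refine Eq.trans ?_ h3
  congr 1
  refine setIntegral_congr_fun measurableSet_Iic fun t ht => ?_
  -- On `t ≤ 0` the second derivative of `φ` vanishes, leaving only the nonlocal part in the history
  -- term.
  rw [hF, hsup2 (0, t) fun h' => (not_lt.2 (show t ≤ 0 from ht)) (hs h'), sub_zero]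

end IsJumpKernel
end

/-! ### Uniqueness for Laplace transforms and Karamata's Tauberian theorem. -/

noncomputable section

lemma exp_neg_mem_Icc {s : ℝ} (hs : 0 < s) : Real.exp (-s) ∈ Icc (0 : ℝ) 1 :=
  ⟨(Real.exp_pos _).le, Real.exp_le_one_iff.2 (by linarith)⟩

lemma integrableOn_comp_exp_mul {g H : ℝ → ℝ} (hg : Continuous g)
    (hH : IntegrableOn H (Ioi 0)) :
    IntegrableOn (fun s => g (Real.exp (-s)) * H s) (Ioi 0) := by
  obtain ⟨C, hC⟩ := (isCompact_Icc (a := (0 : ℝ)) (b := 1)).exists_bound_of_continuousOn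
    hg.continuousOn
  refine Integrable.bdd_mul (c := C) hH (hg.comp (by fun_prop)).aestronglyMeasurable ?_
  filter_upwards [ae_restrict_mem measurableSet_Ioi] with s hs
  exact hC _ (exp_neg_mem_Icc hs)

lemma integral_polynomial_comp_exp {F : ℝ → ℝ}
    (hF : IntegrableOn (fun s => Real.exp (-s) * F s) (Ioi 0)) (p : Polynomial ℝ) :
    ∫ s in Ioi (0 : ℝ), p.eval (Real.exp (-s)) * (Real.exp (-s) * F s) =
      p.sum fun k c => c * ∫ s in Ioi (0 : ℝ), Real.exp (-s) ^ (k + 1) * F s := by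
  simp only [Polynomial.eval_eq_sum, Polynomial.sum, Finset.sum_mul]
  rw [integral_finsetSum]
  · refine Finset.sum_congr rfl fun k _ => ?_
    rw [← integral_const_mul]
    congr 1; ext s; ring
  · intro k _
    exact integrableOn_comp_exp_mul (g := fun y => p.coeff k * y ^ k) (by fun_prop) hF

/-- In the variable `y = exp(-s)` the hypotheses are convergence of all moments of `exp(-s) F i s`.
Linearity gives polynomials, and Weierstrass approximation on `[0, 1]` gives continuous `g`, the
error being controlled by the common bound `A` on total variation. -/
lemma tendsto_integral_comp_exp {ι : Type*} {l : Filter ι} {F : ι → ℝ → ℝ} {G : ℝ → ℝ} {A : ℝ}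
    (hF : ∀ᶠ i in l, IntegrableOn (fun s => Real.exp (-s) * F i s) (Ioi 0))
    (hG : IntegrableOn (fun s => Real.exp (-s) * G s) (Ioi 0))
    (hA : ∀ᶠ i in l, ∫ s in Ioi (0 : ℝ), |Real.exp (-s) * F i s| ≤ A)
    (hlim : ∀ k : ℕ, Tendsto (fun i => ∫ s in Ioi (0 : ℝ), Real.exp (-s) ^ (k + 1) * F i s) l
      (𝓝 (∫ s in Ioi (0 : ℝ), Real.exp (-s) ^ (k + 1) * G s)))
    {g : ℝ → ℝ} (hg : Continuous g) :
    Tendsto (fun i => ∫ s in Ioi (0 : ℝ), g (Real.exp (-s)) * (Real.exp (-s) * F i s)) l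
      (𝓝 (∫ s in Ioi (0 : ℝ), g (Real.exp (-s)) * (Real.exp (-s) * G s))) := by
  have hpoly : ∀ p : Polynomial ℝ,
      Tendsto (fun i => ∫ s in Ioi (0 : ℝ), p.eval (Real.exp (-s)) * (Real.exp (-s) * F i s)) l
        (𝓝 (∫ s in Ioi (0 : ℝ), p.eval (Real.exp (-s)) * (Real.exp (-s) * G s))) := by
    intro p
    rw [integral_polynomial_comp_exp hG]
    have h1 : Tendsto (fun i => p.sum fun k c =>
        c * ∫ s in Ioi (0 : ℝ), Real.exp (-s) ^ (k + 1) * F i s) l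
        (𝓝 (p.sum fun k c => c * ∫ s in Ioi (0 : ℝ), Real.exp (-s) ^ (k + 1) * G s)) :=
      tendsto_finsetSum _ fun k _ => (hlim k).const_mul _
    refine h1.congr' ?_
    filter_upwards [hF] with i hi
    exact (integral_polynomial_comp_exp hi p).symm
  have happ : ∀ (p : Polynomial ℝ) (η : ℝ), (∀ y ∈ Icc (0 : ℝ) 1, |p.eval y - g y| < η) →
      ∀ H : ℝ → ℝ, IntegrableOn (fun s => Real.exp (-s) * H s) (Ioi 0) →
      |(∫ s in Ioi (0 : ℝ), p.eval (Real.exp (-s)) * (Real.exp (-s) * H s)) -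
        ∫ s in Ioi (0 : ℝ), g (Real.exp (-s)) * (Real.exp (-s) * H s)| ≤
        η * ∫ s in Ioi (0 : ℝ), |Real.exp (-s) * H s| := by
    intro p η hp H hH
    rw [← integral_sub (integrableOn_comp_exp_mul p.continuous hH)
      (integrableOn_comp_exp_mul hg hH), ← integral_const_mul]
    refine norm_integral_le_of_norm_le (f := fun s => p.eval (Real.exp (-s)) *
      (Real.exp (-s) * H s) - g (Real.exp (-s)) * (Real.exp (-s) * H s)) (hH.abs.const_mul η) ?_
    filter_upwards [ae_restrict_mem measurableSet_Ioi] with s hs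
    rw [← sub_mul, Real.norm_eq_abs, abs_mul]
    exact mul_le_mul_of_nonneg_right (hp _ (exp_neg_mem_Icc hs)).le (abs_nonneg _)
  rw [Metric.tendsto_nhds]
  intro ε hε
  set B := max (max A (∫ s in Ioi (0 : ℝ), |Real.exp (-s) * G s|)) 1 with hB
  have hB1 : 1 ≤ B := le_max_right _ _
  have hBA : A ≤ B := (le_max_left _ _).trans (le_max_left _ _)
  have hBG : ∫ s in Ioi (0 : ℝ), |Real.exp (-s) * G s| ≤ B :=
    (le_max_right _ _).trans (le_max_left _ _)
  have hη : 0 < ε / (4 * B) := by positivity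
  obtain ⟨p, hp⟩ := exists_polynomial_near_of_continuousOn 0 1 g hg.continuousOn _ hη
  have h2 := happ p _ hp G hG
  filter_upwards [hF, hA, Metric.tendsto_nhds.1 (hpoly p) (ε / 4) (by positivity)] with i hi hAi hpi
  have h1 := happ p _ hp (F i) hi
  have e1 : ε / (4 * B) * ∫ s in Ioi (0 : ℝ), |Real.exp (-s) * F i s| ≤ ε / 4 := by
    refine (mul_le_mul_of_nonneg_left (hAi.trans hBA) hη.le).trans (le_of_eq ?_)
    field_simp
  have e2 : ε / (4 * B) * ∫ s in Ioi (0 : ℝ), |Real.exp (-s) * G s| ≤ ε / 4 := by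
    refine (mul_le_mul_of_nonneg_left hBG hη.le).trans (le_of_eq ?_)
    field_simp
  rw [Real.dist_eq] at hpi ⊢
  have h1' := abs_le.1 (h1.trans e1)
  have h2' := abs_le.1 (h2.trans e2)
  have h3' := abs_lt.1 hpi
  rw [abs_lt]
  constructor <;> linarith [h1'.1, h1'.2, h2'.1, h2'.2, h3'.1, h3'.2]

lemma ae_eq_zero_of_laplace_eq_zero {f : ℝ → ℝ}
    (hf : IntegrableOn (fun s => Real.exp (-s) * f s) (Ioi 0))
    (h0 : ∀ k : ℕ, ∫ s in Ioi (0 : ℝ), Real.exp (-s) ^ (k + 1) * f s = 0) :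
    ∀ᵐ s ∂volume.restrict (Ioi (0 : ℝ)), f s = 0 := by
  have key : ∀ g : ℝ → ℝ, Continuous g →
      ∫ s in Ioi (0 : ℝ), g (Real.exp (-s)) * (Real.exp (-s) * f s) = 0 := by
    intro g hg
    -- A constant family with limit `0`: its integrals against every `g` must vanish.
    have h1 := tendsto_integral_comp_exp (l := (atTop : Filter ℕ)) (F := fun _ => f)
      (G := fun _ => 0) (Eventually.of_forall fun _ => hf) (by simp)
      (Eventually.of_forall fun _ => le_rfl) (fun k => by simp [h0]) hg
    simp only [mul_zero, integral_zero] at h1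
    exact tendsto_nhds_unique tendsto_const_nhds h1
  have h2 : ∀ᵐ s, s ∈ Ioi (0 : ℝ) → Real.exp (-s) * f s = 0 := by
    refine isOpen_Ioi.ae_eq_zero_of_integral_contDiff_smul_eq_zero hf.locallyIntegrableOn
      fun φ hφ hc hs => ?_
    set g : ℝ → ℝ := fun y => φ (-Real.log y) with hg
    have hgc : Continuous g := by
      rw [continuous_iff_continuousAt]
      intro y
      -- Near `y = 0` the value `-log y` leaves the support of `φ`; at `y = 0` the convention `log 0
      -- = 0` gives `φ 0`, which is zero because the support lies in `(0, ∞)`.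
      by_cases hy : y = 0
      · obtain ⟨R, hR⟩ := hc.isCompact.isBounded.exists_norm_le
        have h3 : g =ᶠ[𝓝 y] fun _ => 0 := by
          have h4 : ∀ᶠ r in 𝓝[≠] (0 : ℝ), Real.log r < -R :=
            Real.tendsto_log_nhdsNE_zero.eventually (eventually_lt_atBot _)
          rw [eventually_nhdsWithin_iff] at h4
          rw [hy]
          filter_upwards [h4] with r hr
          by_cases hr0 : r = 0
          · rw [hg, hr0]
            simp only [Real.log_zero, neg_zero]
            by_contra hcon
            exact absurd (mem_Ioi.1 (hs (subset_tsupport φ hcon))) (lt_irrefl _)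
          · by_contra hcon
            have h5 := hR _ (subset_tsupport φ hcon)
            rw [Real.norm_eq_abs] at h5
            linarith [le_abs_self (-Real.log r), hr hr0]
        exact continuousAt_const.congr h3.symm
      · exact hφ.continuous.continuousAt.comp (Real.continuousAt_log hy).neg
    have h6 := key g hgc
    simp only [hg, Real.log_exp, neg_neg] at h6
    rw [← h6]
    refine (setIntegral_eq_integral_of_forall_compl_eq_zero fun s hs' => ?_).symm
    have : φ s = 0 := by
      by_contra hcon
      exact hs' (hs (subset_tsupport φ hcon))
    simp [this]
  rw [ae_restrict_iff' measurableSet_Ioi]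
  filter_upwards [h2] with s hs hs0
  exact (mul_eq_zero.1 (hs hs0)).resolve_left (Real.exp_pos _).ne'

/-- One-sided windows for localising near `s = 1`: the positive part of a quadratic in `y = exp(-s)`
with roots at the two endpoints. -/
lemma exists_bump_comp_exp {a b : ℝ} (ha : 0 ≤ a) (hab : a < b) :
    ∃ g : ℝ → ℝ, Continuous g ∧ (∀ y, 0 ≤ g y) ∧ (∀ s, s ∉ Ioo a b → g (Real.exp (-s)) = 0) ∧
      0 < ∫ s in Ioi (0 : ℝ), g (Real.exp (-s)) * (Real.exp (-s) * 1) := by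
  set g : ℝ → ℝ := fun y => max 0 ((y - Real.exp (-b)) * (Real.exp (-a) - y)) with hg
  have hgc : Continuous g := by fun_prop
  have h0 : ∀ y, 0 ≤ g y := fun y => le_max_left _ _
  refine ⟨g, hgc, h0, fun s hs => max_eq_left ?_, ?_⟩
  · simp only [mem_Ioo, not_and_or, not_lt] at hs
    rcases hs with hs | hs
    · have h1 : Real.exp (-a) ≤ Real.exp (-s) := Real.exp_le_exp.2 (by linarith)
      have h2 : Real.exp (-b) < Real.exp (-a) := Real.exp_lt_exp.2 (by linarith)
      exact mul_nonpos_of_nonneg_of_nonpos (by linarith) (by linarith)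
    · have h1 : Real.exp (-s) ≤ Real.exp (-b) := Real.exp_le_exp.2 (by linarith)
      have h2 : Real.exp (-b) < Real.exp (-a) := Real.exp_lt_exp.2 (by linarith)
      exact mul_nonpos_of_nonpos_of_nonneg (by linarith) (by linarith)
  · have hi : IntegrableOn (fun s : ℝ => Real.exp (-s) * (1 : ℝ)) (Ioi 0) := by
      simpa using integrableOn_exp_neg_Ioi 0
    rw [integral_pos_iff_support_of_nonneg_ae
      (Eventually.of_forall fun s => mul_nonneg (h0 _) (by positivity))
      (integrableOn_comp_exp_mul hgc hi)]
    have hsub : Ioo a b ⊆ Function.support fun s => g (Real.exp (-s)) * (Real.exp (-s) * 1) := by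
      intro s hs
      have h1 : Real.exp (-s) < Real.exp (-a) := Real.exp_lt_exp.2 (by linarith [hs.1])
      have h2 : Real.exp (-b) < Real.exp (-s) := Real.exp_lt_exp.2 (by linarith [hs.2])
      have h3 : 0 < (Real.exp (-s) - Real.exp (-b)) * (Real.exp (-a) - Real.exp (-s)) :=
        mul_pos (by linarith) (by linarith)
      have h4 : 0 < g (Real.exp (-s)) := lt_max_of_lt_right h3
      exact (mul_pos h4 (by positivity)).ne'
    refine lt_of_lt_of_le ?_ (measure_mono hsub)
    have hI : Ioo a b ⊆ Ioi 0 := fun s hs => ha.trans_lt hs.1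
    rw [Measure.restrict_apply measurableSet_Ioo, inter_eq_left.2 hI, Real.volume_Ioo]
    simpa using hab

/-- On a window just left of `1` monotonicity gives `F i s ≥ F i 1`, and just right of it `F i s ≤ F
i 1`. The window averages converge to those of `G`, which are close to `G 1` by continuity, so `F i
1` is squeezed. -/
lemma tendsto_of_antitone_of_tendsto_integral {ι : Type*} {l : Filter ι} {F : ι → ℝ → ℝ}
    {G : ℝ → ℝ}
    (hF : ∀ᶠ i in l, IntegrableOn (fun s => Real.exp (-s) * F i s) (Ioi 0))
    (hanti : ∀ᶠ i in l, AntitoneOn (F i) (Ioi 0))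
    (hG : IntegrableOn (fun s => Real.exp (-s) * G s) (Ioi 0)) (hGc : ContinuousAt G 1)
    (hlim : ∀ g : ℝ → ℝ, Continuous g →
      Tendsto (fun i => ∫ s in Ioi (0 : ℝ), g (Real.exp (-s)) * (Real.exp (-s) * F i s)) l
      (𝓝 (∫ s in Ioi (0 : ℝ), g (Real.exp (-s)) * (Real.exp (-s) * G s)))) :
    Tendsto (fun i => F i 1) l (𝓝 (G 1)) := by
  have hone : IntegrableOn (fun s : ℝ => Real.exp (-s) * (1 : ℝ)) (Ioi 0) := by
    simpa using integrableOn_exp_neg_Ioi 0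
  have hmul : ∀ (g : ℝ → ℝ) (c : ℝ), ∫ s in Ioi (0 : ℝ), g (Real.exp (-s)) * (Real.exp (-s) * c) =
      c * ∫ s in Ioi (0 : ℝ), g (Real.exp (-s)) * (Real.exp (-s) * 1) := fun g c => by
    rw [← integral_const_mul]
    congr 1; ext s; ring
  have hint : ∀ (g : ℝ → ℝ) (c : ℝ), Continuous g →
      IntegrableOn (fun s : ℝ => g (Real.exp (-s)) * (Real.exp (-s) * c)) (Ioi 0) := fun g c hg => by
    have := integrableOn_comp_exp_mul hg (hone.mul_const c)
    simpa only [mul_one] using this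
  rw [Metric.tendsto_nhds]
  intro ε hε
  obtain ⟨r, hr, hr1, hGr⟩ : ∃ r, 0 < r ∧ r < 1 ∧
      ∀ s, |s - 1| < r → |G s - G 1| < ε / 2 := by
    obtain ⟨r, hr, h⟩ := Metric.continuousAt_iff.1 hGc (ε / 2) (half_pos hε)
    refine ⟨min r (1 / 2), by positivity, (min_le_right _ _).trans_lt (by norm_num), fun s hs => ?_⟩
    have := h (x := s) (by rw [Real.dist_eq]; exact hs.trans_le (min_le_left _ _))
    rwa [Real.dist_eq] at this
  obtain ⟨g, hgc, hg0, hgs, hgI⟩ := exists_bump_comp_exp (a := 1 - r) (b := 1) (by linarith)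
    (by linarith)
  obtain ⟨g', hgc', hg0', hgs', hgI'⟩ := exists_bump_comp_exp (a := 1) (b := 1 + r) (by linarith)
    (by linarith)
  set I := ∫ s in Ioi (0 : ℝ), g (Real.exp (-s)) * (Real.exp (-s) * 1) with hI
  set I' := ∫ s in Ioi (0 : ℝ), g' (Real.exp (-s)) * (Real.exp (-s) * 1) with hI'
  have hup : ∫ s in Ioi (0 : ℝ), g (Real.exp (-s)) * (Real.exp (-s) * G s) ≤
      (G 1 + ε / 2) * I := by
    rw [hI, ← hmul]
    refine setIntegral_mono_on (integrableOn_comp_exp_mul hgc hG) (hint g _ hgc) measurableSet_Ioi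
      fun s _ => ?_
    by_cases hs : s ∈ Ioo (1 - r) 1
    · have h1 := abs_lt.1 (hGr s (abs_lt.2 ⟨by linarith [hs.1], by linarith [hs.2]⟩))
      exact mul_le_mul_of_nonneg_left
        (mul_le_mul_of_nonneg_left (by linarith [h1.2]) (Real.exp_pos _).le) (hg0 _)
    · rw [hgs s hs]; simp
  have hlo : (G 1 - ε / 2) * I' ≤
      ∫ s in Ioi (0 : ℝ), g' (Real.exp (-s)) * (Real.exp (-s) * G s) := by
    rw [hI', ← hmul]
    refine setIntegral_mono_on (hint g' _ hgc') (integrableOn_comp_exp_mul hgc' hG)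
      measurableSet_Ioi fun s _ => ?_
    by_cases hs : s ∈ Ioo 1 (1 + r)
    · have h1 := abs_lt.1 (hGr s (abs_lt.2 ⟨by linarith [hs.1], by linarith [hs.2]⟩))
      exact mul_le_mul_of_nonneg_left
        (mul_le_mul_of_nonneg_left (by linarith [h1.1]) (Real.exp_pos _).le) (hg0' _)
    · rw [hgs' s hs]; simp
  have e1 := (hlim g hgc).eventually (gt_mem_nhds
    (show _ < (G 1 + ε) * I from hup.trans_lt (by nlinarith)))
  have e2 := (hlim g' hgc').eventually (lt_mem_nhds
    (show (G 1 - ε) * I' < _ from lt_of_lt_of_le (by nlinarith) hlo))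
  filter_upwards [hF, hanti, e1, e2] with i hi hai h1 h2
  have h3 : F i 1 * I ≤ ∫ s in Ioi (0 : ℝ), g (Real.exp (-s)) * (Real.exp (-s) * F i s) := by
    rw [hI, ← hmul]
    refine setIntegral_mono_on (hint g _ hgc) (integrableOn_comp_exp_mul hgc hi) measurableSet_Ioi
      fun s hs0 => ?_
    by_cases hs : s ∈ Ioo (1 - r) 1
    · exact mul_le_mul_of_nonneg_left (mul_le_mul_of_nonneg_left
        (hai hs0 (mem_Ioi.2 one_pos) hs.2.le) (Real.exp_pos _).le) (hg0 _)
    · rw [hgs s hs]; simp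
  have h4 : ∫ s in Ioi (0 : ℝ), g' (Real.exp (-s)) * (Real.exp (-s) * F i s) ≤ F i 1 * I' := by
    rw [hI', ← hmul]
    refine setIntegral_mono_on (integrableOn_comp_exp_mul hgc' hi) (hint g' _ hgc')
      measurableSet_Ioi fun s hs0 => ?_
    by_cases hs : s ∈ Ioo 1 (1 + r)
    · exact mul_le_mul_of_nonneg_left (mul_le_mul_of_nonneg_left
        (hai (mem_Ioi.2 one_pos) hs0 hs.1.le) (Real.exp_pos _).le) (hg0' _)
    · rw [hgs' s hs]; simp
  rw [Real.dist_eq, abs_lt]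
  have h5 := lt_of_mul_lt_mul_right (h3.trans_lt h1) hgI.le
  have h6 := lt_of_mul_lt_mul_right (h2.trans_le h4) hgI'.le
  constructor <;> linarith

/-- Karamata's Tauberian theorem for a nonincreasing density, at `0` or at `∞` according to the
filter `l`. -/
theorem tendsto_of_laplaceTransform {f : ℝ → ℝ} (hanti : AntitoneOn f (Ioi 0))
    (hnn : ∀ t, 0 < t → 0 ≤ f t)
    (hint : ∀ z, 0 < z → IntegrableOn (fun t => Real.exp (-z * t) * f t) (Ioi 0))
    {l : Filter ℝ} (hpos : ∀ᶠ z in l, 0 < z)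
    (hscale : ∀ k : ℕ, Tendsto (fun z : ℝ => ((k : ℝ) + 1) * z) l l) {ρ C : ℝ} (hρ : 0 < ρ)
    (hlim : Tendsto (fun z => z ^ ρ * laplaceTransform f z) l (𝓝 C)) :
    Tendsto (fun z => z ^ (ρ - 1) * f z⁻¹) l (𝓝 (C / Real.Gamma ρ)) := by
  have hΓ := Real.Gamma_pos_of_pos hρ
  -- Rescaling by `z` puts the desired value `f z⁻¹` at `s = 1`; `G` is the power function with the
  -- limiting Laplace transform.
  set F : ℝ → ℝ → ℝ := fun z s => z ^ (ρ - 1) * f (s / z) with hFdef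
  set G : ℝ → ℝ := fun s => C / Real.Gamma ρ * s ^ (ρ - 1) with hGdef
  have hexp : ∀ (k : ℕ) (s : ℝ), Real.exp (-s) ^ (k + 1) = Real.exp (-((k : ℝ) + 1) * s) := by
    intro k s
    rw [← Real.exp_nat_mul]; congr 1; push_cast; ring
  have hFint : ∀ z, 0 < z → ∀ k : ℕ,
      IntegrableOn (fun s => Real.exp (-((k : ℝ) + 1) * s) * F z s) (Ioi 0) := by
    intro z hz k
    have h1 := (hint (((k : ℝ) + 1) * z) (by positivity)).const_mul (z ^ (ρ - 1))
    have h2 := (integrableOn_Ioi_comp_mul_left_iff (fun t => z ^ (ρ - 1) *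
      (Real.exp (-(((k : ℝ) + 1) * z) * t) * f t)) 0 (inv_pos.2 hz)).2
      (by rw [mul_zero]; exact h1)
    refine h2.congr (Eventually.of_forall fun s => ?_)
    simp only [hFdef]
    rw [show -(((k : ℝ) + 1) * z) * (z⁻¹ * s) = -((k : ℝ) + 1) * s by field_simp,
      inv_mul_eq_div]
    ring
  -- The moments of `F z` are Laplace transforms of `f` at the integer multiples `(k + 1) z`, which
  -- is why `l` must be stable under these dilations.
  have hFval : ∀ z, 0 < z → ∀ k : ℕ, ∫ s in Ioi (0 : ℝ), Real.exp (-s) ^ (k + 1) * F z s =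
      ((k : ℝ) + 1) ^ (-ρ) * ((((k : ℝ) + 1) * z) ^ ρ * laplaceTransform f (((k : ℝ) + 1) * z)) := by
    intro z hz k
    have h1 := integral_comp_mul_left_Ioi (fun t => z ^ (ρ - 1) *
      (Real.exp (-(((k : ℝ) + 1) * z) * t) * f t)) 0 (inv_pos.2 hz)
    rw [mul_zero, integral_const_mul (μ := volume.restrict (Ioi 0)) (z ^ (ρ - 1))
      fun t => Real.exp (-(((k : ℝ) + 1) * z) * t) * f t, inv_inv, smul_eq_mul] at h1
    have h2 : ∀ s : ℝ, Real.exp (-s) ^ (k + 1) * F z s = z ^ (ρ - 1) *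
        (Real.exp (-(((k : ℝ) + 1) * z) * (z⁻¹ * s)) * f (z⁻¹ * s)) := by
      intro s
      rw [hexp]
      simp only [hFdef]
      rw [show -(((k : ℝ) + 1) * z) * (z⁻¹ * s) = -((k : ℝ) + 1) * s by field_simp,
        inv_mul_eq_div]
      ring
    simp only [h2]
    have hk : (0 : ℝ) < (k : ℝ) + 1 := by positivity
    rw [h1, laplaceTransform, Real.mul_rpow hk.le hz.le, ← mul_assoc, ← mul_assoc, ← mul_assoc,
      ← Real.rpow_add hk, neg_add_cancel, Real.rpow_zero, one_mul, ← Real.rpow_one_add' hz.le]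
    · congr 2; ring
    · linarith
  have hGval : ∀ k : ℕ, ∫ s in Ioi (0 : ℝ), Real.exp (-s) ^ (k + 1) * G s =
      ((k : ℝ) + 1) ^ (-ρ) * C := by
    intro k
    have hk : (0 : ℝ) < (k : ℝ) + 1 := by positivity
    have h1 := Real.integral_rpow_mul_exp_neg_mul_Ioi hρ hk
    have h2 : ∀ s : ℝ, Real.exp (-s) ^ (k + 1) * G s = C / Real.Gamma ρ *
        (s ^ (ρ - 1) * Real.exp (-(((k : ℝ) + 1) * s))) := by
      intro s
      rw [hexp, neg_mul]
      simp only [hGdef]; ring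
    simp only [h2]
    rw [integral_const_mul, h1, one_div, Real.inv_rpow hk.le, ← Real.rpow_neg hk.le]
    field_simp
  have hGint : IntegrableOn (fun s => Real.exp (-s) * G s) (Ioi 0) := by
    have := (Real.GammaIntegral_convergent hρ).const_mul (C / Real.Gamma ρ)
    refine this.congr (Eventually.of_forall fun s => ?_)
    simp only [hGdef]; ring
  have hFint' : ∀ᶠ z in l, IntegrableOn (fun s => Real.exp (-s) * F z s) (Ioi 0) := by
    filter_upwards [hpos] with z hz
    simpa using hFint z hz 0
  have hconv : ∀ k : ℕ, Tendsto (fun z => ∫ s in Ioi (0 : ℝ), Real.exp (-s) ^ (k + 1) * F z s) l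
      (𝓝 (∫ s in Ioi (0 : ℝ), Real.exp (-s) ^ (k + 1) * G s)) := by
    intro k
    rw [hGval]
    refine ((hlim.comp (hscale k)).const_mul _).congr' ?_
    filter_upwards [hpos] with z hz
    exact (hFval z hz k).symm
  have hA : ∀ᶠ z in l, ∫ s in Ioi (0 : ℝ), |Real.exp (-s) * F z s| ≤
      (∫ s in Ioi (0 : ℝ), Real.exp (-s) ^ (0 + 1) * G s) + 1 := by
    filter_upwards [hpos, (hconv 0).eventually (gt_mem_nhds (lt_add_one _))] with z hz h1
    refine le_trans (le_of_eq ?_) h1.le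
    refine setIntegral_congr_fun measurableSet_Ioi fun s hs => ?_
    simp only [zero_add, pow_one]
    refine abs_of_nonneg (mul_nonneg (Real.exp_pos _).le (mul_nonneg (Real.rpow_nonneg hz.le _) ?_))
    exact hnn _ (div_pos hs hz)
  have hfinal := tendsto_of_antitone_of_tendsto_integral hFint' (F := F) (G := G) ?_ hGint ?_
    fun g hg => tendsto_integral_comp_exp hFint' hGint hA hconv hg
  · simpa [hFdef, hGdef] using hfinal
  · filter_upwards [hpos] with z hz a ha b hb hab
    refine mul_le_mul_of_nonneg_left ?_ (Real.rpow_nonneg hz.le _)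
    exact hanti (div_pos ha hz) (div_pos hb hz) (by gcongr)
  · exact continuousAt_const.mul (Real.continuousAt_rpow_const 1 _ (Or.inl one_ne_zero))

end

/-! ### Cut-off exponentials in time. -/

noncomputable section

lemma exists_lipschitzWith_smoothTransition : ∃ L, LipschitzWith L Real.smoothTransition := by
  have hd : ContDiff ℝ 1 Real.smoothTransition := Real.smoothTransition.contDiff
  have hc : Continuous (deriv Real.smoothTransition) := hd.continuous_deriv le_rfl
  obtain ⟨C, hC⟩ := (isCompact_Icc (a := (0 : ℝ)) (b := 1)).exists_bound_of_continuousOn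
    hc.continuousOn
  refine ⟨C.toNNReal, lipschitzWith_of_nnnorm_deriv_le (hd.differentiable one_ne_zero) fun x => ?_⟩
  have hC0 : 0 ≤ C := (norm_nonneg _).trans (hC 0 (by simp))
  rw [← NNReal.coe_le_coe, coe_nnnorm, Real.coe_toNNReal _ hC0]
  by_cases hx : x ∈ Icc (0 : ℝ) 1
  · exact hC x hx
  · have : deriv Real.smoothTransition x = 0 := by
      simp only [mem_Icc, not_and_or, not_le] at hx
      rcases hx with hx | hx
      · have h1 : Real.smoothTransition =ᶠ[𝓝 x] fun _ => 0 := by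
          filter_upwards [gt_mem_nhds hx] with y hy
          exact Real.smoothTransition.zero_of_nonpos hy.le
        rw [h1.deriv_eq, deriv_const]
      · have h1 : Real.smoothTransition =ᶠ[𝓝 x] fun _ => 1 := by
          filter_upwards [lt_mem_nhds hx] with y hy
          exact Real.smoothTransition.one_of_one_le hy.le
        rw [h1.deriv_eq, deriv_const]
    rw [this, norm_zero]
    exact hC0

/-- A smooth cutoff equal to `1` on `[2 / n, n]` and supported in `[1 / n, 2 n]`. -/
def timeCutoff (n : ℕ) (t : ℝ) : ℝ :=
  Real.smoothTransition (n * t - 1) * Real.smoothTransition (2 - t / n)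

lemma contDiff_timeCutoff (n : ℕ) : ContDiff ℝ ∞ (timeCutoff n) :=
  (Real.smoothTransition.contDiff.comp (by fun_prop)).mul
    (Real.smoothTransition.contDiff.comp (by fun_prop))

lemma timeCutoff_nonneg (n : ℕ) (t : ℝ) : 0 ≤ timeCutoff n t :=
  mul_nonneg (Real.smoothTransition.nonneg _) (Real.smoothTransition.nonneg _)

lemma timeCutoff_le_one (n : ℕ) (t : ℝ) : timeCutoff n t ≤ 1 :=
  mul_le_one₀ (Real.smoothTransition.le_one _) (Real.smoothTransition.nonneg _)
    (Real.smoothTransition.le_one _)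

lemma timeCutoff_eq_zero {n : ℕ} (hn : 0 < n) {t : ℝ} (ht : t ∉ Icc (1 / (n : ℝ)) (2 * n)) :
    timeCutoff n t = 0 := by
  have hn' : (0 : ℝ) < n := by exact_mod_cast hn
  simp only [mem_Icc, not_and_or, not_le] at ht
  rcases ht with ht | ht
  · rw [lt_div_iff₀ hn'] at ht
    rw [timeCutoff, Real.smoothTransition.zero_of_nonpos (by linarith), zero_mul]
  · rw [timeCutoff, Real.smoothTransition.zero_of_nonpos (x := 2 - t / n), mul_zero]
    rw [sub_nonpos, le_div_iff₀ hn']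
    exact ht.le

lemma tendsto_timeCutoff {t : ℝ} (ht : 0 < t) :
    Tendsto (fun n => timeCutoff n t) atTop (𝓝 1) := by
  refine tendsto_const_nhds.congr' ?_
  obtain ⟨N, hN⟩ := exists_nat_gt (max t (2 / t))
  filter_upwards [eventually_ge_atTop N] with n hn
  have hn' : (N : ℝ) ≤ n := by exact_mod_cast hn
  have h1 : t < n := ((le_max_left _ _).trans_lt hN).trans_le hn'
  have h2 : 2 / t < n := ((le_max_right _ _).trans_lt hN).trans_le hn'
  rw [div_lt_iff₀ ht] at h2
  rw [timeCutoff, Real.smoothTransition.one_of_one_le (by linarith),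
    Real.smoothTransition.one_of_one_le, mul_one]
  have : t / n ≤ 1 := by rw [div_le_one (ht.trans h1)]; exact h1.le
  linarith

/-- Each transition has slope of order `1 / t` where it acts: the lower one has slope of order `n`
on `t < 2 / n`, the upper one of order `1 / n` on `t < 2 n`. The constant is therefore independent
of `n`. -/
lemma exists_abs_timeCutoff_sub_le : ∃ C, 1 ≤ C ∧ ∀ n : ℕ, 0 < n → ∀ t s : ℝ, 0 < t → 0 < s →
    |timeCutoff n t - timeCutoff n (t + s)| ≤ C * (s / t) := by
  obtain ⟨L, hL⟩ := exists_lipschitzWith_smoothTransition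
  refine ⟨max 1 (4 * L), le_max_left _ _, fun n hn t s ht hs => ?_⟩
  have hn' : (0 : ℝ) < n := by exact_mod_cast hn
  have hst : 0 < s / t := by positivity
  have hL0 : (0 : ℝ) ≤ L := L.2
  have hlip : ∀ a b, |Real.smoothTransition a - Real.smoothTransition b| ≤ L * |a - b| :=
    fun a b => by simpa [Real.dist_eq] using hL.dist_le_mul a b
  have h1 : |Real.smoothTransition (n * t - 1) - Real.smoothTransition (n * (t + s) - 1)| ≤
      2 * L * (s / t) := by
    rcases le_or_gt 2 (n * t) with h | h
    · rw [Real.smoothTransition.one_of_one_le (by linarith),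
        Real.smoothTransition.one_of_one_le (by nlinarith), sub_self, abs_zero]
      positivity
    · refine (hlip _ _).trans ?_
      rw [show (n : ℝ) * t - 1 - (n * (t + s) - 1) = -(n * s) by ring, abs_neg,
        abs_of_pos (by positivity), mul_comm (2 : ℝ), mul_assoc]
      refine mul_le_mul_of_nonneg_left ?_ hL0
      rw [mul_div_assoc', le_div_iff₀ ht]
      nlinarith
  have h2 : |Real.smoothTransition (2 - t / n) - Real.smoothTransition (2 - (t + s) / n)| ≤
      2 * L * (s / t) := by
    rcases le_or_gt (2 * (n : ℝ)) t with h | h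
    · have e1 : 2 ≤ t / n := by rw [le_div_iff₀ hn']; exact h
      have e2 : 2 ≤ (t + s) / n := by rw [le_div_iff₀ hn']; linarith
      rw [Real.smoothTransition.zero_of_nonpos (by linarith),
        Real.smoothTransition.zero_of_nonpos (by linarith), sub_self, abs_zero]
      positivity
    · refine (hlip _ _).trans ?_
      rw [show 2 - t / (n : ℝ) - (2 - (t + s) / n) = s / n by ring,
        abs_of_pos (by positivity), mul_comm (2 : ℝ), mul_assoc]
      refine mul_le_mul_of_nonneg_left ?_ hL0
      rw [mul_div_assoc', div_le_div_iff₀ hn' ht]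
      nlinarith
  have h3 : timeCutoff n t - timeCutoff n (t + s) =
      (Real.smoothTransition (n * t - 1) - Real.smoothTransition (n * (t + s) - 1)) *
        Real.smoothTransition (2 - t / n) + Real.smoothTransition (n * (t + s) - 1) *
      (Real.smoothTransition (2 - t / n) - Real.smoothTransition (2 - (t + s) / n)) := by
    rw [timeCutoff, timeCutoff]; ring
  rw [h3]
  refine (abs_add_le _ _).trans ?_
  rw [abs_mul, abs_mul, abs_of_nonneg (Real.smoothTransition.nonneg (2 - t / n)),
    abs_of_nonneg (Real.smoothTransition.nonneg (n * (t + s) - 1))]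
  have h4 := mul_le_of_le_one_right
    (abs_nonneg (Real.smoothTransition (n * t - 1) - Real.smoothTransition (n * (t + s) - 1)))
    (Real.smoothTransition.le_one (2 - t / n))
  have h5 := mul_le_of_le_one_left
    (abs_nonneg (Real.smoothTransition (2 - t / n) - Real.smoothTransition (2 - (t + s) / n)))
    (Real.smoothTransition.le_one (n * (t + s) - 1))
  calc _ ≤ 2 * L * (s / t) + 2 * L * (s / t) := by linarith
    _ = 4 * L * (s / t) := by ring
    _ ≤ _ := mul_le_mul_of_nonneg_right (le_max_right _ _) hst.le

/-- Interpolates between the bounds `1` and `s / t`: the outcome `(s / t) ^ β` is integrable against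
`ν` in `s` and, as `β < 1`, near `t = 0`, whereas `s / t` is not. -/
lemma min_one_le_rpow {y β : ℝ} (hy : 0 ≤ y) (hβ0 : 0 < β) (hβ1 : β < 1) {x : ℝ} (hx1 : x ≤ 1)
    (hxy : x ≤ y) : x ≤ y ^ β := by
  rcases le_or_gt y 1 with h | h
  · refine hxy.trans ?_
    rcases hy.eq_or_lt with h0 | h0
    · rw [← h0]; exact (Real.rpow_nonneg le_rfl _)
    · exact Real.self_le_rpow_of_le_one hy h hβ1.le
  · exact hx1.trans (Real.one_le_rpow h.le hβ0.le)

/-- The exponential `e^(-z t)`, cut off near `0` and near `∞`. -/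
def cutExp (z : ℝ) (n : ℕ) (t : ℝ) : ℝ := Real.exp (-z * t) * timeCutoff n t

lemma abs_cutExp_le (z : ℝ) (n : ℕ) (t : ℝ) : |cutExp z n t| ≤ Real.exp (-z * t) := by
  rw [cutExp, abs_mul, abs_of_pos (Real.exp_pos _), abs_of_nonneg (timeCutoff_nonneg _ _)]
  exact mul_le_of_le_one_right (Real.exp_pos _).le (timeCutoff_le_one _ _)

lemma contDiff_cutExp (z : ℝ) (n : ℕ) : ContDiff ℝ ∞ (cutExp z n) :=
  ContDiff.mul (by fun_prop) (contDiff_timeCutoff n)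

lemma tendsto_cutExp (z : ℝ) {t : ℝ} (ht : 0 < t) :
    Tendsto (fun n => cutExp z n t) atTop (𝓝 (Real.exp (-z * t))) := by
  simpa [cutExp] using (tendsto_timeCutoff ht).const_mul (Real.exp (-z * t))

lemma exists_abs_cutExp_sub_le {z : ℝ} (hz : 0 < z) {β : ℝ} (hβ0 : 0 < β) (hβ1 : β < 1) :
    ∃ C, 0 < C ∧ ∀ n : ℕ, 0 < n → ∀ t s : ℝ, 0 < t → 0 < s →
    |cutExp z n t - cutExp z n (t + s)| ≤
      Real.exp (-z * t) * (C * t ^ (-β) * s ^ β + z * s) := by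
  obtain ⟨C, hC1, hC⟩ := exists_abs_timeCutoff_sub_le
  refine ⟨C ^ β, by positivity, fun n hn t s ht hs => ?_⟩
  have h1 : cutExp z n t - cutExp z n (t + s) = Real.exp (-z * t) *
      ((timeCutoff n t - timeCutoff n (t + s)) +
        (1 - Real.exp (-z * s)) * timeCutoff n (t + s)) := by
    rw [cutExp, cutExp, mul_add, Real.exp_add]; ring
  rw [h1, abs_mul, abs_of_pos (Real.exp_pos _)]
  refine mul_le_mul_of_nonneg_left ((abs_add_le _ _).trans (add_le_add ?_ ?_)) (Real.exp_pos _).le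
  · have h2 : |timeCutoff n t - timeCutoff n (t + s)| ≤ 1 := by
      rw [abs_le]
      constructor <;> linarith [timeCutoff_nonneg n t, timeCutoff_le_one n t,
        timeCutoff_nonneg n (t + s), timeCutoff_le_one n (t + s)]
    have h3 := min_one_le_rpow (by positivity) hβ0 hβ1 h2 (hC n hn t s ht hs)
    refine h3.trans (le_of_eq ?_)
    rw [Real.mul_rpow (by positivity) (by positivity), Real.div_rpow hs.le ht.le,
      Real.rpow_neg ht.le]
    field_simp
  · have h2 := Real.add_one_le_exp (-z * s)
    have h3 : Real.exp (-z * s) ≤ 1 := Real.exp_le_one_iff.2 (by nlinarith)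
    rw [abs_mul, abs_of_nonneg (by linarith), abs_of_nonneg (timeCutoff_nonneg _ _)]
    exact (mul_le_of_le_one_right (by linarith) (timeCutoff_le_one _ _)).trans (by linarith)

namespace IsJumpKernel

variable {δ β : ℝ} {ν : Measure ℝ} (h : IsJumpKernel δ β ν)
include h

/-- The bound is independent of `n` and integrable over `(0, ∞)`, so the lower cutoff can be removed
without a boundary term at `t = 0`. -/
lemma exists_abs_jumpAdjoint_cutExp_le {z : ℝ} (hz : 0 < z) :
    ∃ C, 0 < C ∧ ∀ n : ℕ, 0 < n → ∀ t : ℝ, 0 < t →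
      |jumpAdjoint ν (cutExp z n) t| ≤ C * (Real.exp (-z * t) * (t ^ (-β) + 1)) := by
  obtain ⟨C, hC0, hC⟩ := exists_abs_cutExp_sub_le hz h.beta_pos h.beta_lt_one
  set m := ∫ s, s ^ β ∂ν
  set m' := ∫ s, s ∂ν
  have hm : 0 ≤ m := integral_nonneg_of_ae (h.ae_pos.mono fun s hs => Real.rpow_nonneg hs.le _)
  have hm' : 0 ≤ m' := integral_nonneg_of_ae (h.ae_pos.mono fun s hs => hs.le)
  refine ⟨C * m + z * m' + 1, by positivity, fun n hn t ht => ?_⟩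
  have h1 : |jumpAdjoint ν (cutExp z n) t| ≤
      ∫ s, Real.exp (-z * t) * (C * t ^ (-β) * s ^ β + z * s) ∂ν := by
    refine norm_integral_le_of_norm_le (f := fun s => cutExp z n t - cutExp z n (t + s))
      (((h.moment.const_mul _).add (h.integrable_id.const_mul z)).const_mul _) ?_
    filter_upwards [h.ae_pos] with s hs
    exact hC n hn t s ht hs
  rw [integral_const_mul, integral_add (h.moment.const_mul _) (h.integrable_id.const_mul z),
    integral_const_mul, integral_const_mul] at h1
  refine h1.trans ?_
  have ht' : 0 ≤ t ^ (-β) := Real.rpow_nonneg ht.le _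
  rw [mul_left_comm]
  refine mul_le_mul_of_nonneg_left ?_ (Real.exp_pos _).le
  nlinarith [mul_nonneg hC0.le hm, mul_nonneg hz.le hm', mul_nonneg (mul_nonneg hz.le hm') ht']

/-- The pure exponential is an eigenfunction of the adjoint, with eigenvalue the symbol. -/
lemma tendsto_jumpAdjoint_cutExp {z : ℝ} (hz : 0 < z) {t : ℝ} (ht : 0 < t) :
    Tendsto (fun n => jumpAdjoint ν (cutExp z n) t) atTop
      (𝓝 (Real.exp (-z * t) * jumpSymbol ν z)) := by
  obtain ⟨C, hC0, hC⟩ := exists_abs_cutExp_sub_le hz h.beta_pos h.beta_lt_one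
  have h1 : Real.exp (-z * t) * jumpSymbol ν z =
      ∫ s, (Real.exp (-z * t) - Real.exp (-z * (t + s))) ∂ν := by
    rw [jumpSymbol, ← integral_const_mul]
    congr 1; ext s
    rw [mul_add, Real.exp_add]; ring
  rw [h1]
  refine tendsto_integral_filter_of_dominated_convergence
    (fun s => Real.exp (-z * t) * (C * t ^ (-β) * s ^ β + z * s)) ?_ ?_
    (((h.moment.const_mul _).add (h.integrable_id.const_mul z)).const_mul _) ?_
  · refine Eventually.of_forall fun n => ?_
    have := (contDiff_cutExp z n).continuous
    exact Continuous.aestronglyMeasurable (by fun_prop)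
  · filter_upwards [eventually_gt_atTop 0] with n hn
    filter_upwards [h.ae_pos] with s hs
    exact hC n hn t s ht hs
  · filter_upwards [h.ae_pos] with s hs
    exact (tendsto_cutExp z ht).sub (tendsto_cutExp z (by linarith))

end IsJumpKernel
end

/-! ### Homogeneous weak solutions tested against separated exponentials. -/

noncomputable section

/-- A function that is continuous for positive times, with mass at most `M` at each time. -/
structure BoundedMass (u : ℝ → ℝ → ℝ) (M : ℝ) : Prop where
  continuousOn : ContinuousOn (fun p : ℝ × ℝ => u p.1 p.2) {p : ℝ × ℝ | 0 < p.2}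
  integrable : ∀ t : ℝ, 0 < t → Integrable (fun x : ℝ => u x t)
  bound : ∀ t : ℝ, 0 < t → ∫ x : ℝ, |u x t| ≤ M

lemma BoundedMass.sub {u v : ℝ → ℝ → ℝ} {M N : ℝ} (hu : BoundedMass u M) (hv : BoundedMass v N) :
    BoundedMass (fun x t => u x t - v x t) (M + N) where
  continuousOn := hu.continuousOn.sub hv.continuousOn
  integrable t ht := (hu.integrable t ht).sub (hv.integrable t ht)
  bound t ht := by
    refine le_trans ?_ (add_le_add (hu.bound t ht) (hv.bound t ht))
    rw [← integral_add (hu.integrable t ht).abs (hv.integrable t ht).abs]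
    exact integral_mono ((hu.integrable t ht).sub (hv.integrable t ht)).abs
      ((hu.integrable t ht).abs.add (hv.integrable t ht).abs) fun x => abs_sub _ _

lemma BoundedMass.aestronglyMeasurable {u : ℝ → ℝ → ℝ} {M : ℝ} (hu : BoundedMass u M) :
    AEStronglyMeasurable (fun p : ℝ × ℝ => u p.2 p.1)
      ((volume.restrict (Ioi (0 : ℝ))).prod volume) := by
  have h1 : ((volume.restrict (Ioi (0 : ℝ))).prod (volume : Measure ℝ)) =
      (volume.prod volume).restrict (Ioi (0 : ℝ) ×ˢ univ) := by
    rw [← Measure.prod_restrict, Measure.restrict_univ]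
  rw [h1]
  refine ContinuousOn.aestronglyMeasurable ?_ (measurableSet_Ioi.prod MeasurableSet.univ)
  exact hu.continuousOn.comp (f := fun p : ℝ × ℝ => (p.2, p.1)) (by fun_prop) fun p hp => hp.1

lemma BoundedMass.integrable_mul {u : ℝ → ℝ → ℝ} {M : ℝ} (hu : BoundedMass u M)
    {b : ℝ × ℝ → ℝ} (hb : AEStronglyMeasurable b ((volume.restrict (Ioi (0 : ℝ))).prod volume))
    {D : ℝ → ℝ} (hD : IntegrableOn D (Ioi 0)) (hbD : ∀ t x, 0 < t → |b (t, x)| ≤ D t) :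
    Integrable (fun p : ℝ × ℝ => u p.2 p.1 * b p)
      ((volume.restrict (Ioi (0 : ℝ))).prod volume) := by
  have hm := hu.aestronglyMeasurable.mul hb
  have hle : ∀ t, 0 < t → ∀ x, ‖u x t * b (t, x)‖ ≤ |u x t| * D t := fun t ht x => by
    rw [norm_mul]
    exact mul_le_mul_of_nonneg_left (hbD t x ht) (norm_nonneg _)
  refine (integrable_prod_iff hm).2 ⟨?_, ?_⟩
  · filter_upwards [hm.prodMk_left, ae_restrict_mem measurableSet_Ioi] with t h1 ht
    exact ((hu.integrable t ht).abs.mul_const (D t)).mono' h1 (Eventually.of_forall (hle t ht))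
  · refine (hD.const_mul M).mono' hm.norm.integral_prod_right' ?_
    filter_upwards [ae_restrict_mem measurableSet_Ioi] with t ht
    have hD0 : 0 ≤ D t := (abs_nonneg _).trans (hbD t 0 ht)
    rw [Real.norm_eq_abs, abs_of_nonneg (integral_nonneg fun _ => norm_nonneg _)]
    refine (integral_mono_of_nonneg (Eventually.of_forall fun _ => norm_nonneg _)
      ((hu.integrable t ht).abs.mul_const (D t)) (Eventually.of_forall (hle t ht))).trans ?_
    rw [integral_mul_const]
    exact mul_le_mul_of_nonneg_right (hu.bound t ht) hD0

lemma integrableOn_exp_mul_rpow_add_one {z β : ℝ} (hz : 0 < z) (hβ : β < 1) :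
    IntegrableOn (fun t : ℝ => Real.exp (-z * t) * (t ^ (-β) + 1)) (Ioi 0) := by
  have h1 := integrableOn_rpow_mul_exp_neg_mul_rpow (p := 1) (s := -β) (b := z) (by linarith)
    one_pos hz
  have h2 := integrableOn_exp_mul_Ioi (a := -z) (by linarith) 0
  refine (h1.add h2).congr (Eventually.of_forall fun t => ?_)
  simp only [Pi.add_apply, Real.rpow_one]
  ring

/-- A smooth compactly supported function on the line that is `1` near `0`. -/
def spaceBump : ContDiffBump (0 : ℝ) := ⟨1, 2, one_pos, one_lt_two⟩

/-- A smooth function `e`, cut off at distance about `n` from `0`. -/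
def cutSpace (e : ℝ → ℝ) (n : ℕ) (x : ℝ) : ℝ := spaceBump (x / n) * e x

/-- The second derivative of `cutSpace e n` when `e'' = -κ e`. -/
def cutSpaceSnd (e : ℝ → ℝ) (κ : ℝ) (n : ℕ) (x : ℝ) : ℝ :=
  deriv (deriv spaceBump) (x / n) / n / n * e x + 2 * (deriv spaceBump (x / n) / n * deriv e x) -
    spaceBump (x / n) * (κ * e x)

lemma contDiff_spaceBump : ContDiff ℝ ∞ spaceBump := spaceBump.contDiff

lemma contDiff_deriv_of_contDiff {f : ℝ → ℝ} (hf : ContDiff ℝ ∞ f) : ContDiff ℝ ∞ (deriv f) :=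
  (contDiff_infty_iff_deriv.1 hf).2

lemma hasDerivAt_of_contDiff {f : ℝ → ℝ} (hf : ContDiff ℝ ∞ f) (x : ℝ) :
    HasDerivAt f (deriv f x) x := (hf.differentiable (by simp) x).hasDerivAt

lemma iteratedDeriv_cutSpace_mul {e : ℝ → ℝ} (he : ContDiff ℝ ∞ e) {κ : ℝ}
    (he2 : ∀ x, deriv (deriv e) x = -κ * e x) (n : ℕ) (c x : ℝ) :
    iteratedDeriv 2 (fun y => cutSpace e n y * c) x = cutSpaceSnd e κ n x * c := by
  have hs : ∀ {f : ℝ → ℝ}, ContDiff ℝ ∞ f → ∀ y : ℝ,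
      HasDerivAt (fun y => f (y / n)) (deriv f (y / n) / n) y := by
    intro f hf y
    have := (hasDerivAt_of_contDiff hf (y / n)).comp y ((hasDerivAt_id y).div_const (n : ℝ))
    rwa [mul_one_div] at this
  have h1 : ∀ y, HasDerivAt (fun y => cutSpace e n y * c)
      ((deriv spaceBump (y / n) / n * e y + spaceBump (y / n) * deriv e y) * c) y := fun y =>
    ((hs contDiff_spaceBump y).mul (hasDerivAt_of_contDiff he y)).mul_const c
  have h2 : HasDerivAt
      (fun y => (deriv spaceBump (y / n) / n * e y + spaceBump (y / n) * deriv e y) * c)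
      (((deriv (deriv spaceBump) (x / n) / n / n * e x + deriv spaceBump (x / n) / n * deriv e x) +
        (deriv spaceBump (x / n) / n * deriv e x + spaceBump (x / n) * deriv (deriv e) x)) * c) x :=
    (((((hs (contDiff_deriv_of_contDiff contDiff_spaceBump) x).div_const (n : ℝ)).mul
      (hasDerivAt_of_contDiff he x))).add ((hs contDiff_spaceBump x).mul
        (hasDerivAt_of_contDiff (contDiff_deriv_of_contDiff he) x))).mul_const c
  rw [iteratedDeriv_succ, iteratedDeriv_one, funext fun y => (h1 y).deriv, h2.deriv, he2,
    cutSpaceSnd]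
  ring

lemma exists_bound_of_compact {f : ℝ → ℝ} (hf : Continuous f) (hc : HasCompactSupport f) :
    ∃ C, 0 ≤ C ∧ ∀ x, |f x| ≤ C := by
  obtain ⟨C, hC⟩ := hc.exists_bound_of_continuous hf
  exact ⟨C, (norm_nonneg _).trans (hC 0), hC⟩

lemma exists_abs_cutSpaceSnd_le {e : ℝ → ℝ} (he1 : ∀ x, |e x| ≤ 1) {B : ℝ}
    (heB : ∀ x, |deriv e x| ≤ B) {κ : ℝ} (hκ : 0 ≤ κ) :
    ∃ Q, 0 ≤ Q ∧ ∀ n : ℕ, 0 < n → ∀ x, |cutSpaceSnd e κ n x| ≤ Q := by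
  have hB : 0 ≤ B := (abs_nonneg _).trans (heB 0)
  obtain ⟨C1, hC1, h1⟩ := exists_bound_of_compact
    (contDiff_deriv_of_contDiff contDiff_spaceBump).continuous spaceBump.hasCompactSupport.deriv
  obtain ⟨C2, hC2, h2⟩ := exists_bound_of_compact
    (contDiff_deriv_of_contDiff (contDiff_deriv_of_contDiff contDiff_spaceBump)).continuous
    spaceBump.hasCompactSupport.deriv.deriv
  refine ⟨C2 + 2 * (C1 * B) + κ, by positivity, fun n hn x => ?_⟩
  have hn1 : (1 : ℝ) ≤ n := by exact_mod_cast hn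
  have hdiv : ∀ {y C : ℝ}, |y| ≤ C → |y / n| ≤ C := fun {y C} hy => by
    rw [abs_div, Nat.abs_cast]
    exact (div_le_self (abs_nonneg _) hn1).trans hy
  rw [cutSpaceSnd]
  refine (abs_sub _ _).trans (add_le_add ((abs_add_le _ _).trans (add_le_add ?_ ?_)) ?_)
  · rw [abs_mul]
    exact (mul_le_of_le_one_right (abs_nonneg _) (he1 x)).trans (hdiv (hdiv (h2 _)))
  · rw [abs_mul, abs_two, abs_mul]
    exact mul_le_mul_of_nonneg_left (mul_le_mul (hdiv (h1 _)) (heB x) (abs_nonneg _) hC1) two_pos.le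
  · rw [abs_mul, abs_mul, abs_of_nonneg hκ, abs_of_nonneg spaceBump.nonneg]
    exact (mul_le_of_le_one_left (by positivity) spaceBump.le_one).trans
      (mul_le_of_le_one_right hκ (he1 x))

lemma tendsto_div_nat (x : ℝ) : Tendsto (fun n : ℕ => x / (n : ℝ)) atTop (𝓝 0) :=
  tendsto_const_div_atTop_nhds_zero_nat x

lemma tendsto_cutSpace (e : ℝ → ℝ) (x : ℝ) :
    Tendsto (fun n => cutSpace e n x) atTop (𝓝 (e x)) := by
  have h1 : Tendsto (fun n : ℕ => spaceBump (x / n)) atTop (𝓝 (spaceBump (0 : ℝ))) :=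
    (contDiff_spaceBump.continuous.tendsto 0).comp (tendsto_div_nat x)
  have h2 : spaceBump (0 : ℝ) = 1 :=
    spaceBump.one_of_mem_closedBall (Metric.mem_closedBall_self spaceBump.rIn_pos.le)
  rw [h2] at h1
  simpa [cutSpace] using h1.mul_const (e x)

lemma tendsto_cutSpaceSnd (e : ℝ → ℝ) (κ x : ℝ) :
    Tendsto (fun n => cutSpaceSnd e κ n x) atTop (𝓝 (-(κ * e x))) := by
  have hc1 := (contDiff_deriv_of_contDiff contDiff_spaceBump)
  have hc2 := contDiff_deriv_of_contDiff hc1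
  have h0 : Tendsto (fun n : ℕ => ((n : ℝ))⁻¹) atTop (𝓝 0) := tendsto_inv_atTop_nhds_zero_nat
  have h1 : Tendsto (fun n : ℕ => deriv spaceBump (x / n) / n) atTop (𝓝 0) := by
    have := ((hc1.continuous.tendsto 0).comp (tendsto_div_nat x)).mul h0
    simpa [div_eq_mul_inv, Function.comp_def] using this
  have h2 : Tendsto (fun n : ℕ => deriv (deriv spaceBump) (x / n) / n / n) atTop (𝓝 0) := by
    have := (((hc2.continuous.tendsto 0).comp (tendsto_div_nat x)).mul h0).mul h0
    simpa [div_eq_mul_inv, Function.comp_def] using this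
  have h3 : Tendsto (fun n : ℕ => spaceBump (x / n) * (κ * e x)) atTop (𝓝 (κ * e x)) :=
    tendsto_cutSpace (fun x => κ * e x) x
  have := ((h2.mul_const (e x)).add ((h1.mul_const (deriv e x)).const_mul 2)).sub h3
  simpa [cutSpaceSnd] using this

lemma cutSpace_eq_zero (e : ℝ → ℝ) {n : ℕ} (hn : 0 < n) {x : ℝ} (hx : 2 * (n : ℝ) < |x|) :
    cutSpace e n x = 0 := by
  have hn' : (0 : ℝ) < n := by exact_mod_cast hn
  rw [cutSpace, spaceBump.zero_of_le_dist, zero_mul]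
  rw [Real.dist_eq, sub_zero, abs_div, Nat.abs_cast]
  exact (le_div_iff₀ hn').2 hx.le

lemma abs_cutSpace_le {e : ℝ → ℝ} (he1 : ∀ x, |e x| ≤ 1) (n : ℕ) (x : ℝ) :
    |cutSpace e n x| ≤ 1 := by
  rw [cutSpace, abs_mul, abs_of_nonneg spaceBump.nonneg]
  exact mul_le_one₀ spaceBump.le_one (abs_nonneg _) (he1 x)

namespace IsJumpKernel

variable {δ β : ℝ} {ν : Measure ℝ} (h : IsJumpKernel δ β ν)
include h

/-- Cut-off products of `e(x)` and `exp(-z t)` are admissible tests. In the limit the operator acts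
on the product as multiplication by `K(z) + κ > 0`, so the pairing with the product itself is zero.
-/
lemma integral_mul_exp_eq_zero [SFinite ν] {d : ℝ → ℝ → ℝ} {M : ℝ} (hd : BoundedMass d M)
    (hweak : ∀ φ : ℝ × ℝ → ℝ, ContDiff ℝ ∞ φ → HasCompactSupport φ →
      tsupport φ ⊆ {p : ℝ × ℝ | 0 < p.2} →
      ∫ t in Ioi (0 : ℝ), ∫ x, d x t * testOperator ν φ (t, x) = 0)
    {e : ℝ → ℝ} (he : ContDiff ℝ ∞ e) (he1 : ∀ x, |e x| ≤ 1) {B : ℝ}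
    (heB : ∀ x, |deriv e x| ≤ B) {κ : ℝ} (hκ : 0 ≤ κ)
    (he2 : ∀ x, deriv (deriv e) x = -κ * e x) {z : ℝ} (hz : 0 < z) :
    ∫ t in Ioi (0 : ℝ), ∫ x, d x t * (e x * Real.exp (-z * t)) = 0 := by
  obtain ⟨C, hC0, hC⟩ := h.exists_abs_jumpAdjoint_cutExp_le hz
  obtain ⟨Q, hQ0, hQ⟩ := exists_abs_cutSpaceSnd_le he1 heB hκ
  set μ₂ : Measure (ℝ × ℝ) := (volume.restrict (Ioi (0 : ℝ))).prod volume with hμ₂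
  have hpos : ∀ᵐ p ∂μ₂, (0 : ℝ) < p.1 :=
    Measure.quasiMeasurePreserving_fst.ae (ae_restrict_mem measurableSet_Ioi)
  set b : ℕ → ℝ × ℝ → ℝ := fun n p => cutSpace e n p.2 * jumpAdjoint ν (cutExp z n) p.1 -
    cutSpaceSnd e κ n p.2 * cutExp z n p.1 with hb
  set D : ℝ → ℝ := fun t => (C + Q) * (Real.exp (-z * t) * (t ^ (-β) + 1)) with hD
  have hDi : IntegrableOn D (Ioi 0) :=
    (integrableOn_exp_mul_rpow_add_one hz h.beta_lt_one).const_mul _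
  have hbD : ∀ n : ℕ, 0 < n → ∀ t x, 0 < t → |b n (t, x)| ≤ D t := by
    intro n hn t x ht
    have ht' : 0 ≤ t ^ (-β) := Real.rpow_nonneg ht.le _
    simp only [hb, hD]
    rw [add_mul]
    refine (abs_sub _ _).trans (add_le_add ?_ ?_)
    · rw [abs_mul]
      exact (mul_le_of_le_one_left (abs_nonneg _) (abs_cutSpace_le he1 n x)).trans (hC n hn t ht)
    · rw [abs_mul]
      refine mul_le_mul (hQ n hn x) ((abs_cutExp_le z n t).trans ?_) (abs_nonneg _) hQ0
      exact le_mul_of_one_le_right (Real.exp_pos _).le (by linarith)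
  have hcs : ∀ n, Continuous (cutSpace e n) := fun n =>
    (contDiff_spaceBump.continuous.comp (by fun_prop)).mul he.continuous
  have hbm : ∀ n, AEStronglyMeasurable (b n) μ₂ := by
    intro n
    have hce := (contDiff_cutExp z n).continuous
    refine (Measurable.sub (Measurable.mul ((hcs n).measurable.comp measurable_snd) ?_)
      (Measurable.mul ?_ (hce.measurable.comp measurable_fst))).aestronglyMeasurable
    · have hm : Measurable fun p : ℝ × ℝ => cutExp z n p.1 - cutExp z n (p.1 + p.2) := by fun_prop
      have : Measurable fun t => jumpAdjoint ν (cutExp z n) t :=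
        hm.stronglyMeasurable.integral_prod_right'.measurable
      exact this.comp measurable_fst
    · have hc1 := (contDiff_deriv_of_contDiff contDiff_spaceBump)
      have hc2 := (contDiff_deriv_of_contDiff hc1).continuous
      have hc3 := (contDiff_deriv_of_contDiff he).continuous
      have hc4 := hc1.continuous
      have hc5 := contDiff_spaceBump.continuous
      have hc6 := he.continuous
      have : Continuous (cutSpaceSnd e κ n) := by unfold cutSpaceSnd; fun_prop
      exact this.measurable.comp measurable_snd
  have hint : ∀ n : ℕ, 0 < n → Integrable (fun p : ℝ × ℝ => d p.2 p.1 * b n p) μ₂ := fun n hn =>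
    hd.integrable_mul (hbm n) hDi (hbD n hn)
  have hzero : ∀ n : ℕ, 0 < n → ∫ p, d p.2 p.1 * b n p ∂μ₂ = 0 := by
    intro n hn
    have hn' : (0 : ℝ) < n := by exact_mod_cast hn
    set φ : ℝ × ℝ → ℝ := fun p => cutSpace e n p.1 * cutExp z n p.2 with hφdef
    have hφ : ContDiff ℝ ∞ φ := by
      refine ContDiff.mul ?_ ((contDiff_cutExp z n).comp contDiff_snd)
      exact ((contDiff_spaceBump.comp (by fun_prop : ContDiff ℝ ∞ fun x : ℝ => x / n)).mul
        he).comp contDiff_fst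
    have hct : ∀ t, t ∉ Icc (1 / (n : ℝ)) (2 * n) → cutExp z n t = 0 := fun t ht => by
      rw [cutExp, timeCutoff_eq_zero hn ht, mul_zero]
    have hsupp : Function.support φ ⊆ Icc (-(2 * (n : ℝ))) (2 * n) ×ˢ Icc (1 / (n : ℝ)) (2 * n) := by
      intro p hp
      refine ⟨?_, ?_⟩
      · by_contra hcon
        refine hp ?_
        have : 2 * (n : ℝ) < |p.1| := by
          by_contra h2
          exact hcon (abs_le.1 (not_lt.1 h2))
        simp only [hφdef, cutSpace_eq_zero e hn this, zero_mul]
      · by_contra hcon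
        exact hp (by simp only [hφdef, hct _ hcon, mul_zero])
    have hcomp : IsCompact (Icc (-(2 * (n : ℝ))) (2 * n) ×ˢ Icc (1 / (n : ℝ)) (2 * n)) :=
      isCompact_Icc.prod isCompact_Icc
    have h1 := hweak φ hφ (HasCompactSupport.of_support_subset_isCompact hcomp hsupp) (by
      refine (closure_minimal hsupp hcomp.isClosed).trans fun p hp => ?_
      exact (by positivity : (0 : ℝ) < 1 / n).trans_le hp.2.1)
    have h2 : ∀ t x, testOperator ν φ (t, x) = b n (t, x) := by
      intro t x
      simp only [testOperator, hφdef, hb]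
      rw [iteratedDeriv_cutSpace_mul he he2]
      congr 1
      rw [jumpAdjoint, jumpAdjoint, ← integral_const_mul]
      congr 1; ext s; ring
    simp only [h2] at h1
    rw [hμ₂, integral_prod _ (hint n hn)]
    exact h1
  have hlim : Tendsto (fun n => ∫ p, d p.2 p.1 * b n p ∂μ₂) atTop
      (𝓝 (∫ p : ℝ × ℝ, d p.2 p.1 * (e p.2 * (Real.exp (-z * p.1) * jumpSymbol ν z) -
        -(κ * e p.2) * Real.exp (-z * p.1)) ∂μ₂)) := by
    have hdom : Integrable (fun p : ℝ × ℝ => |d p.2 p.1 * D p.1|) μ₂ := by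
      refine (hd.integrable_mul (b := fun p => D p.1) (D := fun t => |D t|)
        hDi.aestronglyMeasurable.comp_fst hDi.abs fun t x _ => le_rfl).abs
    refine tendsto_integral_filter_of_dominated_convergence _
      (Eventually.of_forall fun n => hd.aestronglyMeasurable.mul (hbm n)) ?_ hdom ?_
    · filter_upwards [eventually_gt_atTop 0] with n hn
      filter_upwards [hpos] with p hp
      rw [norm_mul, abs_mul]
      exact mul_le_mul_of_nonneg_left ((hbD n hn p.1 p.2 hp).trans (le_abs_self _)) (norm_nonneg _)
    · filter_upwards [hpos] with p hp
      exact (((tendsto_cutSpace e p.2).mul (h.tendsto_jumpAdjoint_cutExp hz hp)).sub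
        ((tendsto_cutSpaceSnd e κ p.2).mul (tendsto_cutExp z hp))).const_mul _
  have h0 : ∫ p : ℝ × ℝ, d p.2 p.1 * (e p.2 * (Real.exp (-z * p.1) * jumpSymbol ν z) -
        -(κ * e p.2) * Real.exp (-z * p.1)) ∂μ₂ = 0 := by
    refine tendsto_nhds_unique hlim (tendsto_const_nhds.congr' ?_)
    filter_upwards [eventually_gt_atTop 0] with n hn
    exact (hzero n hn).symm
  -- The limit integrand is the eigenvalue `K(z) + κ` times the target integrand.
  have h3 : ∀ p : ℝ × ℝ, d p.2 p.1 * (e p.2 * (Real.exp (-z * p.1) * jumpSymbol ν z) -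
        -(κ * e p.2) * Real.exp (-z * p.1)) =
        (jumpSymbol ν z + κ) * (d p.2 p.1 * (e p.2 * Real.exp (-z * p.1))) := fun p => by ring
  simp only [h3] at h0
  rw [integral_const_mul] at h0
  have hK := h.jumpSymbol_pos hz
  have h4 := (mul_eq_zero.1 h0).resolve_left (by positivity)
  rw [hμ₂, integral_prod] at h4
  · exact h4
  · refine hd.integrable_mul (b := fun p => e p.2 * Real.exp (-z * p.1))
      (D := fun t => Real.exp (-z * t)) ?_ (integrableOn_exp_mul_Ioi (by linarith) 0) ?_
    · have := he.continuous
      exact Continuous.aestronglyMeasurable (by fun_prop)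
    · intro t x _
      rw [abs_mul, abs_of_pos (Real.exp_pos _)]
      exact mul_le_of_le_one_left (Real.exp_pos _).le (he1 x)

/-- The Laplace transform in time vanishes at `z = 1, 2, 3, ...`, which already suffices by
`ae_eq_zero_of_laplace_eq_zero`. -/
lemma ae_integral_mul_eq_zero [SFinite ν] {d : ℝ → ℝ → ℝ} {M : ℝ} (hd : BoundedMass d M)
    (hweak : ∀ φ : ℝ × ℝ → ℝ, ContDiff ℝ ∞ φ → HasCompactSupport φ →
      tsupport φ ⊆ {p : ℝ × ℝ | 0 < p.2} →
      ∫ t in Ioi (0 : ℝ), ∫ x, d x t * testOperator ν φ (t, x) = 0)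
    {e : ℝ → ℝ} (he : ContDiff ℝ ∞ e) (he1 : ∀ x, |e x| ≤ 1) {B : ℝ}
    (heB : ∀ x, |deriv e x| ≤ B) {κ : ℝ} (hκ : 0 ≤ κ)
    (he2 : ∀ x, deriv (deriv e) x = -κ * e x) :
    ∀ᵐ t ∂volume.restrict (Ioi (0 : ℝ)), ∫ x, d x t * e x = 0 := by
  have hi : Integrable (fun p : ℝ × ℝ => d p.2 p.1 * (e p.2 * Real.exp (-1 * p.1)))
      ((volume.restrict (Ioi (0 : ℝ))).prod volume) := by
    refine hd.integrable_mul (b := fun p => e p.2 * Real.exp (-1 * p.1))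
      (D := fun t => Real.exp (-1 * t)) ?_ (integrableOn_exp_mul_Ioi (by norm_num) 0) ?_
    · have := he.continuous
      exact Continuous.aestronglyMeasurable (by fun_prop)
    · intro t x _
      rw [abs_mul, abs_of_pos (Real.exp_pos _)]
      exact mul_le_of_le_one_left (Real.exp_pos _).le (he1 x)
  refine ae_eq_zero_of_laplace_eq_zero ?_ fun k => ?_
  · refine hi.integral_prod_left.congr (Eventually.of_forall fun t => ?_)
    simp only
    rw [← integral_const_mul]
    congr 1; ext x
    rw [neg_one_mul]; ring
  · refine Eq.trans ?_
      (h.integral_mul_exp_eq_zero hd hweak he he1 heB hκ he2 (z := (k : ℝ) + 1) (by positivity))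
    congr 1; ext t
    rw [← integral_const_mul, ← Real.exp_nat_mul]
    congr 1; ext x
    rw [show ((k + 1 : ℕ) : ℝ) * -t = -((k : ℝ) + 1) * t by push_cast; ring]
    ring

end IsJumpKernel
end

/-! ### Uniqueness by Fourier inversion. -/

open scoped FourierTransform
noncomputable section

lemma fourier_ofReal_eq {f : ℝ → ℝ} (hf : Integrable f) (w : ℝ) :
    𝓕 (fun x => (f x : ℂ)) w =
      ((∫ x, f x * Real.cos (2 * Real.pi * w * x) : ℝ) : ℂ) -
        ((∫ x, f x * Real.sin (2 * Real.pi * w * x) : ℝ) : ℂ) * Complex.I := by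
  have hc : Integrable fun x => f x * Real.cos (2 * Real.pi * w * x) :=
    hf.mul_bdd (c := 1) (by fun_prop) (Eventually.of_forall fun x => Real.abs_cos_le_one _)
  have hs : Integrable fun x => f x * Real.sin (2 * Real.pi * w * x) :=
    hf.mul_bdd (c := 1) (by fun_prop) (Eventually.of_forall fun x => Real.abs_sin_le_one _)
  rw [Real.fourier_real_eq_integral_exp_smul, ← integral_complex_ofReal, ← integral_complex_ofReal,
    ← integral_mul_const, ← integral_sub hc.ofReal (hs.ofReal.mul_const _)]
  congr 1; ext x
  rw [Complex.exp_mul_I, ← Complex.ofReal_cos, ← Complex.ofReal_sin,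
    show -2 * Real.pi * x * w = -(2 * Real.pi * w * x) by ring, Real.cos_neg, Real.sin_neg]
  simp only [smul_eq_mul]
  push_cast
  ring

/-- Rational frequencies suffice because the Fourier transform is continuous. Countability matters
later: the exceptional null sets of times can be united. -/
lemma eq_zero_of_fourier_eq_zero_on_rat {f : ℝ → ℝ} (hf : Integrable f) (hc : Continuous f)
    (h1 : ∀ q : ℚ, ∫ x, f x * Real.cos (2 * Real.pi * q * x) = 0)
    (h2 : ∀ q : ℚ, ∫ x, f x * Real.sin (2 * Real.pi * q * x) = 0) (x : ℝ) : f x = 0 := by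
  have hfc : Integrable fun x => (f x : ℂ) := hf.ofReal
  have hcont : Continuous (𝓕 fun x => (f x : ℂ)) :=
    VectorFourier.fourierIntegral_continuous Real.continuous_fourierChar
      (by exact continuous_inner) hfc
  have hzero : (𝓕 fun x => (f x : ℂ)) = fun _ => 0 := by
    refine Continuous.ext_on Rat.denseRange_cast hcont continuous_const ?_
    rintro _ ⟨q, rfl⟩
    rw [fourier_ofReal_eq hf, h1, h2]
    simp
  have hinv := hfc.fourierInv_fourier_eq (by rw [hzero]; exact integrable_zero _ _ _)
    (v := x) (Complex.continuous_ofReal.comp hc).continuousAt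
  rw [hzero] at hinv
  have : 𝓕⁻ (fun _ : ℝ => (0 : ℂ)) x = 0 := by
    rw [Real.fourierInv_eq]; simp
  rw [this] at hinv
  exact_mod_cast hinv.symm

lemma deriv_cos_const_mul (c : ℝ) :
    deriv (fun x => Real.cos (c * x)) = fun x => -c * Real.sin (c * x) := by
  ext x
  have h := ((hasDerivAt_id x).const_mul c).cos
  simp only [id_eq, mul_one] at h
  rw [h.deriv]; ring

lemma deriv_sin_const_mul (c : ℝ) :
    deriv (fun x => Real.sin (c * x)) = fun x => c * Real.cos (c * x) := by
  ext x
  have h := ((hasDerivAt_id x).const_mul c).sin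
  simp only [id_eq, mul_one] at h
  rw [h.deriv]; ring

namespace IsJumpKernel

variable {δ β : ℝ} {ν : Measure ℝ} (h : IsJumpKernel δ β ν)
include h

theorem eq_zero_of_weak_eq [SFinite ν] {d : ℝ → ℝ → ℝ} {M : ℝ} (hd : BoundedMass d M)
    (hweak : ∀ φ : ℝ × ℝ → ℝ, ContDiff ℝ ∞ φ → HasCompactSupport φ →
      tsupport φ ⊆ {p : ℝ × ℝ | 0 < p.2} →
      ∫ t in Ioi (0 : ℝ), ∫ x, d x t * testOperator ν φ (t, x) = 0)
    (x : ℝ) {t : ℝ} (ht : 0 < t) : d x t = 0 := by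
  have hcos : ∀ q : ℚ, ∀ᵐ t ∂volume.restrict (Ioi (0 : ℝ)),
      ∫ x, d x t * Real.cos (2 * Real.pi * q * x) = 0 := fun q => by
    refine h.ae_integral_mul_eq_zero hd hweak (B := |2 * Real.pi * q|)
      (κ := (2 * Real.pi * q) ^ 2) (Real.contDiff_cos.comp (by fun_prop))
      (fun x => Real.abs_cos_le_one _) (fun x => ?_) (sq_nonneg _) fun x => ?_
    · rw [deriv_cos_const_mul, abs_mul, abs_neg]
      exact mul_le_of_le_one_right (abs_nonneg _) (Real.abs_sin_le_one _)
    · rw [deriv_cos_const_mul, deriv_const_mul_field, deriv_sin_const_mul]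
      ring
  have hsin : ∀ q : ℚ, ∀ᵐ t ∂volume.restrict (Ioi (0 : ℝ)),
      ∫ x, d x t * Real.sin (2 * Real.pi * q * x) = 0 := fun q => by
    refine h.ae_integral_mul_eq_zero hd hweak (B := |2 * Real.pi * q|)
      (κ := (2 * Real.pi * q) ^ 2) (Real.contDiff_sin.comp (by fun_prop))
      (fun x => Real.abs_sin_le_one _) (fun x => ?_) (sq_nonneg _) fun x => ?_
    · rw [deriv_sin_const_mul, abs_mul]
      exact mul_le_of_le_one_right (abs_nonneg _) (Real.abs_cos_le_one _)
    · rw [deriv_sin_const_mul, deriv_const_mul_field, deriv_cos_const_mul]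
      ring
  have hae : (fun t => d x t) =ᵐ[volume.restrict (Ioi (0 : ℝ))] fun _ => 0 := by
    filter_upwards [ae_all_iff.2 hcos, ae_all_iff.2 hsin, ae_restrict_mem measurableSet_Ioi]
      with t h1 h2 ht
    refine eq_zero_of_fourier_eq_zero_on_rat (hd.integrable t ht) ?_ h1 h2 x
    exact hd.continuousOn.comp_continuous (f := fun x : ℝ => (x, t)) (by fun_prop) fun _ => ht
  -- Almost every time is upgraded to every positive time by continuity in `t` at fixed `x`.
  refine Measure.eqOn_open_of_ae_eq hae isOpen_Ioi ?_ continuousOn_const ht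
  exact hd.continuousOn.comp (f := fun t : ℝ => (x, t)) (by fun_prop) fun t ht => ht

end IsJumpKernel
end

/-! ### The fractional kernel as a jump measure. -/

noncomputable section

/-- The jump measure `ρ_δ(s) / s ds` on `(0, δ)` of the fractional kernel. -/
def fracJump (α δ : ℝ) : Measure ℝ :=
  (volume.restrict (Ioo 0 δ)).withDensity fun s => ENNReal.ofReal (fracKernel α δ s / s)

instance (α δ : ℝ) : SFinite (fracJump α δ) := by unfold fracJump; infer_instance

section FracJump

variable {α δ : ℝ}

lemma measurable_fracKernel_div : Measurable fun s => fracKernel α δ s / s := by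
  unfold fracKernel; fun_prop

lemma fracKernel_div_eq {s : ℝ} (hs : 0 < s) :
    fracKernel α δ s / s = (1 - α) * δ ^ (α - 1) * s ^ (-α - 1) := by
  rw [fracKernel, Real.rpow_sub_one hs.ne']; ring

lemma fracKernel_div_pos (hα1 : α < 1) (hδ : 0 < δ) {s : ℝ} (hs : 0 < s) :
    0 < fracKernel α δ s / s := by
  rw [fracKernel_div_eq hs]
  have : 0 < 1 - α := by linarith
  positivity

lemma integral_fracJump (hα1 : α < 1) (hδ : 0 < δ) (f : ℝ → ℝ) :
    ∫ s, f s ∂fracJump α δ = ∫ s in (0 : ℝ)..δ, f s * (fracKernel α δ s / s) := by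
  rw [fracJump, integral_withDensity_eq_integral_toReal_smul
    measurable_fracKernel_div.ennreal_ofReal (Eventually.of_forall fun s => ENNReal.ofReal_lt_top),
    intervalIntegral.integral_of_le hδ.le, integral_Ioc_eq_integral_Ioo]
  refine setIntegral_congr_fun measurableSet_Ioo fun s hs => ?_
  simp only [smul_eq_mul]
  rw [ENNReal.toReal_ofReal (fracKernel_div_pos hα1 hδ hs.1).le, mul_comm]

lemma integrable_fracJump_iff (hα1 : α < 1) (hδ : 0 < δ) {f : ℝ → ℝ} :
    Integrable f (fracJump α δ) ↔
      IntegrableOn (fun s => fracKernel α δ s / s * f s) (Ioo 0 δ) := by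
  rw [fracJump, integrable_withDensity_iff_integrable_smul'
    measurable_fracKernel_div.ennreal_ofReal (Eventually.of_forall fun s => ENNReal.ofReal_lt_top)]
  refine integrable_congr ?_
  filter_upwards [ae_restrict_mem measurableSet_Ioo] with s hs
  rw [ENNReal.toReal_ofReal (fracKernel_div_pos hα1 hδ hs.1).le, smul_eq_mul]

lemma integrable_rpow_fracJump_iff (hα1 : α < 1) (hδ : 0 < δ) {b : ℝ} :
    Integrable (fun s : ℝ => s ^ b) (fracJump α δ) ↔ α < b := by
  rw [integrable_fracJump_iff hα1 hδ]
  have h1 : 0 < (1 - α) * δ ^ (α - 1) := mul_pos (by linarith) (by positivity)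
  have h2 : IntegrableOn (fun s => fracKernel α δ s / s * s ^ b) (Ioo 0 δ) ↔
      IntegrableOn (fun s => ((1 - α) * δ ^ (α - 1)) * s ^ (b - α - 1)) (Ioo 0 δ) := by
    refine integrableOn_congr_fun (fun s hs => ?_) measurableSet_Ioo
    rw [fracKernel_div_eq hs.1, mul_assoc, ← Real.rpow_add hs.1]
    congr 2; ring
  rw [h2, IntegrableOn, integrable_const_mul_iff (IsUnit.mk0 _ h1.ne')]
  have h3 := intervalIntegral.integrableOn_Ioo_rpow_iff (s := b - α - 1) hδ
  rw [IntegrableOn] at h3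
  rw [h3]
  constructor <;> intro h <;> linarith

/-- A power `s ^ b` is integrable exactly when `b > α`. The midpoint `(1 + α) / 2` of `α` and `1`
gives the moment, and `b = 0` shows that the mass is infinite. -/
lemma isJumpKernel_fracJump (hα0 : 0 < α) (hα1 : α < 1) (hδ : 0 < δ) :
    IsJumpKernel δ ((1 + α) / 2) (fracJump α δ) where
  delta_pos := hδ
  beta_pos := by linarith
  beta_lt_one := by linarith
  support := (withDensity_absolutelyContinuous _ _).ae_le (ae_restrict_mem measurableSet_Ioo)
  moment := (integrable_rpow_fracJump_iff hα1 hδ).2 (by linarith)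
  mass_pos := by
    rw [pos_iff_ne_zero, Ne, fracJump,
      withDensity_apply_eq_zero measurable_fracKernel_div.ennreal_ofReal]
    have hsub : Ioo (δ / 2) δ ⊆
        ({s | ENNReal.ofReal (fracKernel α δ s / s) ≠ 0} ∩ Ioi (δ / 2)) ∩ Ioo 0 δ := by
      intro s hs
      have hs0 : 0 < s := by linarith [hs.1]
      refine ⟨⟨?_, hs.1⟩, hs0, hs.2⟩
      simpa using fracKernel_div_pos hα1 hδ hs0
    have h1 : 0 < volume (Ioo (δ / 2) δ) := by
      rw [Real.volume_Ioo]; simpa using hδ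
    exact ((h1.trans_le (measure_mono hsub)).trans_le (Measure.le_restrict_apply _ _)).ne'
  infinite := by
    by_contra hfin
    have : IsFiniteMeasure (fracJump α δ) := ⟨lt_top_iff_ne_top.2 hfin⟩
    have h1 : Integrable (fun s : ℝ => s ^ (0 : ℝ)) (fracJump α δ) := by
      simp only [Real.rpow_zero]
      exact integrable_const _
    have := (integrable_rpow_fracJump_iff hα1 hδ).1 h1
    linarith

lemma nonlocalAdjoint_fracKernel (hα1 : α < 1) (hδ : 0 < δ) (ψ : ℝ → ℝ) (t : ℝ) :
    nonlocalAdjoint δ (fracKernel α δ) ψ t = jumpAdjoint (fracJump α δ) ψ t := by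
  rw [nonlocalAdjoint, jumpAdjoint, integral_fracJump hα1 hδ]
  congr 1; ext s; ring

lemma memorySymbol_fracKernel (hα1 : α < 1) (hδ : 0 < δ) (z : ℝ) :
    memorySymbol δ (fracKernel α δ) z = jumpSymbol (fracJump α δ) z := by
  rw [memorySymbol, jumpSymbol, integral_fracJump hα1 hδ]
  congr 1; ext s; ring

/-- Jumps are shorter than `δ`, so from times `t ≤ -δ` the support of `φ` cannot be reached. -/
lemma integral_history_jumpAdjoint (hα0 : 0 < α) (hα1 : α < 1) (hδ : 0 < δ) {φ : ℝ × ℝ → ℝ}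
    (hs : tsupport φ ⊆ {p : ℝ × ℝ | 0 < p.2}) :
    ∫ t in (-δ)..(0 : ℝ), jumpAdjoint (fracJump α δ) (fun r => φ (0, r)) t =
      ∫ t in Iic (0 : ℝ), jumpAdjoint (fracJump α δ) (fun r => φ (0, r)) t := by
  have h := isJumpKernel_fracJump hα0 hα1 hδ
  have h0 : ∀ t, t ≤ 0 → φ (0, t) = 0 := fun t ht =>
    image_eq_zero_of_notMem_tsupport fun h' => (not_lt.2 ht) (hs h')
  rw [intervalIntegral.integral_of_le (by linarith)]
  refine (setIntegral_eq_of_subset_of_forall_sdiff_eq_zero measurableSet_Iic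
    (fun t ht => ht.2) fun t ht => ?_).symm
  have ht0 : t ≤ 0 := ht.1
  have ht1 : t ≤ -δ := by
    by_contra hcon
    exact ht.2 ⟨not_le.1 hcon, ht0⟩
  refine integral_eq_zero_of_ae ?_
  filter_upwards [h.support] with s hs
  simp only [Pi.zero_apply]
  rw [h0 t ht0, h0 (t + s) (by linarith [hs.2]), sub_zero]

lemma isFundamentalSolution_iff (hα0 : 0 < α) (hα1 : α < 1) (hδ : 0 < δ) (u : ℝ → ℝ → ℝ) :
    IsFundamentalSolution δ (fracKernel α δ) u ↔ (∃ M, BoundedMass u M) ∧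
      ∀ φ : ℝ × ℝ → ℝ, ContDiff ℝ ∞ φ → HasCompactSupport φ →
      tsupport φ ⊆ {p : ℝ × ℝ | 0 < p.2} →
      (∫ t in Iic (0 : ℝ), jumpAdjoint (fracJump α δ) (fun r => φ (0, r)) t) +
        (∫ t in Ioi (0 : ℝ), ∫ x, u x t * testOperator (fracJump α δ) φ (t, x)) = 0 := by
  constructor
  · intro hu
    obtain ⟨M, hM⟩ := hu.bounded_mass
    refine ⟨⟨M, hu.continuousOn, hu.integrable, hM⟩, fun φ hφ hc hs => ?_⟩
    have h1 := hu.weak_eq φ hφ hc hs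
    simp only [nonlocalAdjoint_fracKernel hα1 hδ] at h1
    rwa [integral_history_jumpAdjoint hα0 hα1 hδ hs] at h1
  · rintro ⟨⟨M, hM⟩, hw⟩
    refine ⟨hM.continuousOn, hM.integrable, ⟨M, hM.bound⟩, fun φ hφ hc hs => ?_⟩
    simp only [nonlocalAdjoint_fracKernel hα1 hδ]
    rw [integral_history_jumpAdjoint hα0 hα1 hδ hs]
    exact hw φ hφ hc hs

theorem isFundamentalSolution_fundKernel (hα0 : 0 < α) (hα1 : α < 1) (hδ : 0 < δ) :
    IsFundamentalSolution δ (fracKernel α δ) (fundKernel (fracJump α δ) δ) := by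
  have h := isJumpKernel_fracJump hα0 hα1 hδ
  exact (isFundamentalSolution_iff hα0 hα1 hδ _).2
    ⟨⟨1, h.continuousOn_fundKernel, fun t ht => h.integrable_fundKernel ht,
      fun t ht => h.integral_abs_fundKernel_le ht⟩, fun φ hφ hc hs => h.fundKernel_weak_eq hφ hc hs⟩

lemma integrable_mul_testOperator (hα0 : 0 < α) (hα1 : α < 1) (hδ : 0 < δ) {u : ℝ → ℝ → ℝ}
    {M : ℝ} (hu : BoundedMass u M) {φ : ℝ × ℝ → ℝ} (hφ : ContDiff ℝ ∞ φ)
    (hc : HasCompactSupport φ) (hs : tsupport φ ⊆ {p : ℝ × ℝ | 0 < p.2}) :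
    Integrable (fun p : ℝ × ℝ => u p.2 p.1 * testOperator (fracJump α δ) φ p)
      ((volume.restrict (Ioi (0 : ℝ))).prod volume) := by
  have h := isJumpKernel_fracJump hα0 hα1 hδ
  have hT := h.continuous_testOperator hφ hc
  have hTc := h.hasCompactSupport_testOperator hφ hc hs
  obtain ⟨R, hR, hbox⟩ := exists_support_box hTc
  obtain ⟨C, hC⟩ := hTc.exists_bound_of_continuous hT
  refine hu.integrable_mul hT.aestronglyMeasurable (D := (Icc (-R) R).indicator fun _ => C)
    (integrable_indicator_Icc_const _ _ _).integrableOn fun t x _ => ?_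
  by_cases ht : t ∈ Icc (-R) R
  · rw [indicator_of_mem ht]
    exact hC _
  · rw [indicator_of_notMem ht, hbox t x (Or.inl ?_), abs_zero]
    by_contra hcon
    exact ht (abs_le.1 (not_lt.1 hcon))

/-- Both functions satisfy the equation with the same history term, which cancels in the difference.
-/
theorem IsFundamentalSolution.eq_fundKernel (hα0 : 0 < α) (hα1 : α < 1) (hδ : 0 < δ)
    {u : ℝ → ℝ → ℝ} (hu : IsFundamentalSolution δ (fracKernel α δ) u) (x : ℝ) {t : ℝ}
    (ht : 0 < t) : u x t = fundKernel (fracJump α δ) δ x t := by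
  have h := isJumpKernel_fracJump hα0 hα1 hδ
  obtain ⟨⟨M, hM⟩, hw⟩ := (isFundamentalSolution_iff hα0 hα1 hδ u).1 hu
  obtain ⟨⟨N, hN⟩, hv⟩ := (isFundamentalSolution_iff hα0 hα1 hδ _).1
    (isFundamentalSolution_fundKernel hα0 hα1 hδ)
  refine sub_eq_zero.1 (h.eq_zero_of_weak_eq (hM.sub hN) (fun φ hφ hc hs => ?_) x ht)
  have i1 := integrable_mul_testOperator hα0 hα1 hδ hM hφ hc hs
  have i2 := integrable_mul_testOperator hα0 hα1 hδ hN hφ hc hs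
  have i3 := integrable_mul_testOperator hα0 hα1 hδ (hM.sub hN) hφ hc hs
  have e1 := hw φ hφ hc hs
  have e2 := hv φ hφ hc hs
  have p1 := integral_prod _ i1
  have p2 := integral_prod _ i2
  have p3 := integral_prod _ i3
  simp only at p1 p2 p3
  rw [← p1] at e1
  rw [← p2] at e2
  rw [← p3]
  simp only [sub_mul]
  rw [integral_sub i1 i2]
  linarith

end FracJump
end

/-! ### Asymptotics and monotonicity of the symbol. -/

noncomputable section

lemma one_sub_exp_neg_mem {r : ℝ} (hr : 0 ≤ r) :
    0 ≤ 1 - Real.exp (-r) ∧ 1 - Real.exp (-r) ≤ 1 ∧ 1 - Real.exp (-r) ≤ r := by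
  have h1 := Real.add_one_le_exp (-r)
  have h2 : Real.exp (-r) ≤ 1 := Real.exp_le_one_iff.2 (by linarith)
  have h3 := Real.exp_pos (-r)
  exact ⟨by linarith, by linarith, by linarith⟩

lemma integrableOn_one_sub_exp_mul_rpow {α : ℝ} (hα0 : 0 < α) (hα1 : α < 1) :
    IntegrableOn (fun r : ℝ => (1 - Real.exp (-r)) * r ^ (-α - 1)) (Ioi 0) := by
  have hm : Measurable fun r : ℝ => (1 - Real.exp (-r)) * r ^ (-α - 1) := by fun_prop
  rw [← Ioc_union_Ioi_eq_Ioi (zero_le_one' ℝ)]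
  refine IntegrableOn.union ?_ ?_
  · have h1 : IntegrableOn (fun r : ℝ => r ^ (-α)) (Ioc 0 1) :=
      (integrableOn_Ioc_iff_integrableOn_Ioo (by simp)).2
        ((intervalIntegral.integrableOn_Ioo_rpow_iff one_pos).2 (by linarith))
    refine h1.mono' hm.aestronglyMeasurable ?_
    filter_upwards [ae_restrict_mem measurableSet_Ioc] with r hr
    obtain ⟨h2, _, h3⟩ := one_sub_exp_neg_mem hr.1.le
    have h4 : 0 < r ^ (-α - 1) := Real.rpow_pos_of_pos hr.1 _
    rw [Real.norm_eq_abs, abs_of_nonneg (mul_nonneg h2 h4.le)]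
    refine (mul_le_mul_of_nonneg_right h3 h4.le).trans (le_of_eq ?_)
    rw [Real.rpow_sub_one hr.1.ne']
    field_simp [hr.1.ne']
  · refine (integrableOn_Ioi_rpow_of_lt (by linarith : -α - 1 < -1) one_pos).mono'
      hm.aestronglyMeasurable ?_
    filter_upwards [ae_restrict_mem measurableSet_Ioi] with r hr
    have hr0 : 0 < r := one_pos.trans hr
    obtain ⟨h2, h3, _⟩ := one_sub_exp_neg_mem hr0.le
    have h4 : 0 < r ^ (-α - 1) := Real.rpow_pos_of_pos hr0 _
    rw [Real.norm_eq_abs, abs_of_nonneg (mul_nonneg h2 h4.le)]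
    exact mul_le_of_le_one_left h4.le h3

/-- Integration by parts against the primitive `-r ^ (-α) / α`; the boundary terms are at most `r ^
(1 - α) / α` at `0` and `r ^ (-α) / α` at infinity. -/
lemma integral_one_sub_exp_mul_rpow {α : ℝ} (hα0 : 0 < α) (hα1 : α < 1) :
    ∫ r in Ioi (0 : ℝ), (1 - Real.exp (-r)) * r ^ (-α - 1) = Real.Gamma (1 - α) / α := by
  have hΓ := Real.GammaIntegral_convergent (s := 1 - α) (by linarith)
  have hG : IntegrableOn (fun r : ℝ => Real.exp (-r) * r ^ (-α)) (Ioi 0) := by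
    refine hΓ.congr (Eventually.of_forall fun r => ?_)
    simp only
    rw [show 1 - α - 1 = -α by ring]
  have hdv : ∀ r ∈ Ioi (0 : ℝ), HasDerivAt (fun r : ℝ => -(r ^ (-α)) / α) (r ^ (-α - 1)) r := by
    intro r hr
    have := ((Real.hasDerivAt_rpow_const (p := -α) (Or.inl (ne_of_gt hr))).neg).div_const α
    refine this.congr_deriv ?_
    field_simp
  have hdu : ∀ r ∈ Ioi (0 : ℝ), HasDerivAt (fun r : ℝ => 1 - Real.exp (-r)) (Real.exp (-r)) r := by
    intro r _
    have := ((hasDerivAt_neg r).exp).const_sub 1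
    refine this.congr_deriv ?_
    ring
  have h0 : Tendsto (fun r : ℝ => (1 - Real.exp (-r)) * (-(r ^ (-α)) / α)) (𝓝[>] 0) (𝓝 0) := by
    have h1 : Tendsto (fun r : ℝ => r ^ (1 - α) / α) (𝓝[>] 0) (𝓝 0) := by
      have := (((Real.continuousAt_rpow_const 0 (1 - α) (Or.inr (by linarith))).tendsto).mono_left
        (nhdsWithin_le_nhds (s := Ioi 0))).div_const α
      simpa [Real.zero_rpow (by linarith : 1 - α ≠ 0)] using this
    refine squeeze_zero_norm' ?_ h1
    filter_upwards [self_mem_nhdsWithin] with r hr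
    have hr0 : (0 : ℝ) < r := hr
    obtain ⟨h2, _, h3⟩ := one_sub_exp_neg_mem hr0.le
    have h4 : 0 < r ^ (-α) := Real.rpow_pos_of_pos hr0 _
    have h5 : r ^ (1 - α) = r * r ^ (-α) := by
      rw [sub_eq_add_neg, Real.rpow_add hr0, Real.rpow_one]
    rw [norm_mul, norm_div, norm_neg, Real.norm_eq_abs, Real.norm_eq_abs, Real.norm_eq_abs,
      abs_of_nonneg h2, abs_of_pos h4, abs_of_pos hα0, h5, mul_div_assoc]
    exact mul_le_mul_of_nonneg_right h3 (by positivity)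
  have hinf : Tendsto (fun r : ℝ => (1 - Real.exp (-r)) * (-(r ^ (-α)) / α)) atTop (𝓝 0) := by
    have h1 : Tendsto (fun r : ℝ => r ^ (-α) / α) atTop (𝓝 0) := by
      simpa using (tendsto_rpow_neg_atTop hα0).div_const α
    refine squeeze_zero_norm' ?_ h1
    filter_upwards [eventually_gt_atTop 0] with r hr0
    obtain ⟨h2, h3, _⟩ := one_sub_exp_neg_mem hr0.le
    have h4 : 0 < r ^ (-α) := Real.rpow_pos_of_pos hr0 _
    rw [norm_mul, norm_div, norm_neg, Real.norm_eq_abs, Real.norm_eq_abs, Real.norm_eq_abs,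
      abs_of_nonneg h2, abs_of_pos h4, abs_of_pos hα0]
    exact mul_le_of_le_one_left (by positivity) h3
  have hu'v : IntegrableOn (fun r : ℝ => Real.exp (-r) * (-(r ^ (-α)) / α)) (Ioi 0) := by
    refine (hG.const_mul (-α⁻¹)).congr (Eventually.of_forall fun r => ?_)
    simp only
    field_simp
  have key := integral_Ioi_mul_deriv_eq_deriv_mul hdu hdv
    (integrableOn_one_sub_exp_mul_rpow hα0 hα1) hu'v h0 hinf
  rw [key, Real.Gamma_eq_integral (by linarith), sub_zero, zero_sub, ← integral_neg,
    ← integral_div]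
  congr 1; ext r
  rw [show 1 - α - 1 = -α by ring]
  field_simp

section Symbol

variable {α δ : ℝ}

/-- The normalisation of `ρ_δ`; it fixes the slope of the symbol at `0` and thus the heat-kernel
constant at large times. -/
lemma integral_id_fracJump (hα1 : α < 1) (hδ : 0 < δ) : ∫ s, s ∂fracJump α δ = 1 := by
  rw [integral_fracJump hα1 hδ, intervalIntegral.integral_of_le hδ.le]
  have h1 : ∀ s ∈ Ioc 0 δ, s * (fracKernel α δ s / s) = (1 - α) * δ ^ (α - 1) * s ^ (-α) := by
    intro s hs
    have := hs.1
    rw [fracKernel]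
    field_simp
  rw [setIntegral_congr_fun measurableSet_Ioc h1, ← intervalIntegral.integral_of_le hδ.le,
    intervalIntegral.integral_const_mul, integral_rpow (Or.inl (by linarith)),
    Real.zero_rpow (by linarith), sub_zero, show -α + 1 = 1 - α by ring, mul_comm (1 - α),
    mul_assoc, mul_div_cancel₀ _ (by linarith : (1 - α) ≠ 0), ← Real.rpow_add hδ]
  simp

lemma tendsto_jumpSymbol_div_zero (hα0 : 0 < α) (hα1 : α < 1) (hδ : 0 < δ) :
    Tendsto (fun z => jumpSymbol (fracJump α δ) z / z) (𝓝[>] 0) (𝓝 1) := by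
  have h := isJumpKernel_fracJump hα0 hα1 hδ
  rw [← integral_id_fracJump hα1 hδ]
  have h1 : ∀ z, jumpSymbol (fracJump α δ) z / z =
      ∫ s, (1 - Real.exp (-z * s)) / z ∂fracJump α δ := fun z => by
    rw [jumpSymbol, integral_div]
  simp only [h1]
  refine tendsto_integral_filter_of_dominated_convergence (fun s => s)
    (Eventually.of_forall fun z => Measurable.aestronglyMeasurable (by fun_prop)) ?_
    h.integrable_id (Eventually.of_forall fun s => ?_)
  · filter_upwards [self_mem_nhdsWithin] with z hz
    have hz0 : (0 : ℝ) < z := hz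
    filter_upwards [h.ae_pos] with s hs
    obtain ⟨h2, _, h3⟩ := one_sub_exp_neg_mem (mul_pos hz0 hs).le
    rw [neg_mul, Real.norm_eq_abs, abs_of_nonneg (div_nonneg h2 hz0.le), div_le_iff₀ hz0]
    linarith
  · have hd : HasDerivAt (fun z : ℝ => 1 - Real.exp (-z * s)) s 0 := by
      have := (((hasDerivAt_neg (0 : ℝ)).mul_const s).exp).const_sub 1
      refine this.congr_deriv ?_
      simp
    have h4 := hd.tendsto_slope_zero_right
    refine h4.congr fun z => ?_
    simp [div_eq_inv_mul]

/-- The substitution `r = z s` isolates `z ^ α`; the remaining integral converges as `z → ∞`. -/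
lemma jumpSymbol_fracJump_eq (hα1 : α < 1) (hδ : 0 < δ) {z : ℝ} (hz : 0 < z) :
    jumpSymbol (fracJump α δ) z = (1 - α) * δ ^ (α - 1) * z ^ α *
      ∫ r in (0 : ℝ)..(z * δ), (1 - Real.exp (-r)) * r ^ (-α - 1) := by
  have h1 := intervalIntegral.integral_comp_mul_left (a := 0) (b := δ)
    (fun r : ℝ => (1 - Real.exp (-r)) * r ^ (-α - 1)) hz.ne'
  rw [mul_zero, smul_eq_mul, inv_mul_eq_div, eq_div_iff hz.ne'] at h1
  rw [← h1, jumpSymbol, integral_fracJump hα1 hδ, ← mul_assoc, mul_comm _ z, ← mul_assoc,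
    ← intervalIntegral.integral_const_mul, intervalIntegral.integral_of_le hδ.le,
    intervalIntegral.integral_of_le hδ.le]
  refine setIntegral_congr_fun measurableSet_Ioc fun s hs => ?_
  have hs0 := hs.1
  rw [fracKernel_div_eq hs0, Real.mul_rpow hz.le hs0.le, Real.rpow_sub_one hz.ne',
    Real.rpow_neg hz.le, neg_mul]
  have : 0 < z ^ α := Real.rpow_pos_of_pos hz _
  field_simp

lemma tendsto_jumpSymbol_mul_rpow (hα0 : 0 < α) (hα1 : α < 1) (hδ : 0 < δ) :
    Tendsto (fun z => jumpSymbol (fracJump α δ) z * z ^ (-α)) atTop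
      (𝓝 (Real.Gamma (2 - α) / (α * δ ^ (1 - α)))) := by
  have h1 : Tendsto (fun z : ℝ => ∫ r in (0 : ℝ)..(z * δ), (1 - Real.exp (-r)) * r ^ (-α - 1))
      atTop (𝓝 (∫ r in Ioi (0 : ℝ), (1 - Real.exp (-r)) * r ^ (-α - 1))) :=
    intervalIntegral_tendsto_integral_Ioi 0 (integrableOn_one_sub_exp_mul_rpow hα0 hα1)
      (tendsto_id.atTop_mul_const hδ)
  rw [integral_one_sub_exp_mul_rpow hα0 hα1] at h1
  have h2 : Real.Gamma (2 - α) / (α * δ ^ (1 - α)) =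
      (1 - α) * δ ^ (α - 1) * (Real.Gamma (1 - α) / α) := by
    rw [show 2 - α = (1 - α) + 1 by ring, Real.Gamma_add_one (by linarith),
      show α - 1 = -(1 - α) by ring, Real.rpow_neg hδ.le]
    have : 0 < δ ^ (1 - α) := Real.rpow_pos_of_pos hδ _
    field_simp
  rw [h2]
  refine (h1.const_mul ((1 - α) * δ ^ (α - 1))).congr' ?_
  filter_upwards [eventually_gt_atTop 0] with z hz
  rw [jumpSymbol_fracJump_eq hα1 hδ hz, Real.rpow_neg hz.le]
  have : 0 < z ^ α := Real.rpow_pos_of_pos hz _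
  field_simp

end Symbol

/-- The symbol is concave and vanishes at `0`, so `K(z) / z` is nonincreasing. Here this is
convexity of `exp` with `a` written as a convex combination of `b` and `0`. -/
lemma IsJumpKernel.jumpSymbol_div_antitone {δ β : ℝ} {ν : Measure ℝ} (h : IsJumpKernel δ β ν)
    {a b : ℝ} (ha : 0 < a) (hab : a ≤ b) : a * jumpSymbol ν b ≤ b * jumpSymbol ν a := by
  have hb : 0 < b := ha.trans_le hab
  rw [jumpSymbol, jumpSymbol, ← integral_const_mul, ← integral_const_mul]
  refine integral_mono ((h.integrable_one_sub_exp hb.le).const_mul a)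
    ((h.integrable_one_sub_exp ha.le).const_mul b) fun s => ?_
  have h1 := convexOn_exp.2 (mem_univ (-b * s)) (mem_univ (0 : ℝ))
    (div_nonneg ha.le hb.le) (sub_nonneg.2 ((div_le_one hb).2 hab)) (by ring)
  simp only [smul_eq_mul, mul_zero, add_zero, Real.exp_zero, mul_one] at h1
  rw [show a / b * (-b * s) = -a * s by field_simp] at h1
  have h2 := mul_le_mul_of_nonneg_left h1 hb.le
  have h3 : b * (a / b * Real.exp (-b * s) + (1 - a / b)) = a * Real.exp (-b * s) + (b - a) := by
    field_simp
  rw [h3] at h2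
  simp only
  linarith

/-- Up to a factor, `√K / z` is `√(K / z)` times `1 / √z`; the second factor supplies strictness. -/
lemma IsJumpKernel.strictAntiOn_sqrt_jumpSymbol_div {δ β : ℝ} {ν : Measure ℝ}
    (h : IsJumpKernel δ β ν) :
    StrictAntiOn (fun z => Real.sqrt (jumpSymbol ν z) / (2 * z)) (Ioi 0) := by
  intro a ha b hb hab
  have ha0 : 0 < a := ha
  have hb0 : 0 < b := hb
  have hKa := h.jumpSymbol_pos ha0
  have hKb := h.jumpSymbol_pos hb0
  have h1 := h.jumpSymbol_div_antitone ha0 hab.le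
  have h2 : a ^ 2 * jumpSymbol ν b < b ^ 2 * jumpSymbol ν a :=
    calc a ^ 2 * jumpSymbol ν b = a * (a * jumpSymbol ν b) := by ring
      _ ≤ a * (b * jumpSymbol ν a) := mul_le_mul_of_nonneg_left h1 ha0.le
      _ < b * (b * jumpSymbol ν a) := mul_lt_mul_of_pos_right hab (mul_pos hb0 hKa)
      _ = b ^ 2 * jumpSymbol ν a := by ring
  have h3 : Real.sqrt (a ^ 2 * jumpSymbol ν b) < Real.sqrt (b ^ 2 * jumpSymbol ν a) :=
    Real.sqrt_lt_sqrt (by positivity) h2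
  rw [Real.sqrt_mul (by positivity), Real.sqrt_mul (by positivity), Real.sqrt_sq ha0.le,
    Real.sqrt_sq hb0.le] at h3
  simp only
  rw [div_lt_div_iff₀ (by positivity) (by positivity)]
  linarith

end

/-! ### Asymptotics at the origin in space, and conclusion. -/

noncomputable section

lemma mainardiM_zero (ν : ℝ) : mainardiM ν 0 = 1 / Real.Gamma (1 - ν) := by
  rw [mainardiM, tsum_eq_single 0 fun n hn => by simp [hn]]
  simp

lemma subdiffusionKernel_zero (α t : ℝ) :
    subdiffusionKernel α 0 t = 1 / 2 * t ^ (-(α / 2)) * (1 / Real.Gamma (1 - α / 2)) := by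
  rw [subdiffusionKernel, abs_zero, zero_div, mainardiM_zero]

lemma heatKernel_zero (t : ℝ) : heatKernel 0 t = 1 / Real.sqrt (4 * Real.pi * t) := by
  simp [heatKernel]

lemma IsEquivalent.of_tendsto_mul_rpow {l : Filter ℝ} {f : ℝ → ℝ} {p c : ℝ} (hc : c ≠ 0)
    (hl : ∀ᶠ t in l, 0 < t) (h : Tendsto (fun t => t ^ p * f t) l (𝓝 c)) :
    IsEquivalent l f (fun t => c * t ^ (-p)) := by
  have h1 : Tendsto (f / fun t => c * t ^ (-p)) l (𝓝 1) := by
    rw [← div_self hc]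
    refine (h.div_const c).congr' ?_
    filter_upwards [hl] with t ht
    have : 0 < t ^ p := Real.rpow_pos_of_pos ht _
    rw [Pi.div_apply, Real.rpow_neg ht.le]
    field_simp
  refine (isEquivalent_iff_tendsto_one ?_).2 h1
  filter_upwards [hl] with t ht
  exact mul_ne_zero hc (Real.rpow_pos_of_pos ht _).ne'

section FundamentalSolution

variable {α δ : ℝ}

lemma sqrt_Gamma_div_two (hα0 : 0 < α) (hδ : 0 < δ) :
    Real.sqrt (Real.Gamma (2 - α) / (α * δ ^ (1 - α))) / 2 =
      Real.sqrt (Real.Gamma (2 - α) / (4 * α * δ ^ (1 - α))) := by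
  have h4 : Real.sqrt 4 = 2 := by
    rw [show (4 : ℝ) = 2 ^ 2 by norm_num, Real.sqrt_sq (by norm_num)]
  rw [← h4, ← Real.sqrt_div' _ (by norm_num)]
  congr 1
  have : 0 < δ ^ (1 - α) := Real.rpow_pos_of_pos hδ _
  field_simp

lemma tendsto_rpow_mul_sqrt_jumpSymbol_atTop (hα0 : 0 < α) (hα1 : α < 1) (hδ : 0 < δ) :
    Tendsto (fun z => z ^ (1 - α / 2) * (Real.sqrt (jumpSymbol (fracJump α δ) z) / (2 * z))) atTop
      (𝓝 (Real.sqrt (Real.Gamma (2 - α) / (4 * α * δ ^ (1 - α))))) := by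
  rw [← sqrt_Gamma_div_two hα0 hδ]
  refine (((tendsto_jumpSymbol_mul_rpow hα0 hα1 hδ).sqrt).div_const 2).congr' ?_
  filter_upwards [eventually_gt_atTop 0] with z hz
  have h1 : Real.sqrt (z ^ (-α)) = z ^ (-(α / 2)) := by
    rw [Real.sqrt_eq_rpow, ← Real.rpow_mul hz.le]
    ring_nf
  rw [Real.sqrt_mul' _ (Real.rpow_nonneg hz.le _), h1, sub_eq_add_neg, Real.rpow_add hz,
    Real.rpow_one]
  field_simp

lemma tendsto_rpow_mul_sqrt_jumpSymbol_zero (hα0 : 0 < α) (hα1 : α < 1) (hδ : 0 < δ) :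
    Tendsto (fun z => z ^ (1 / 2 : ℝ) * (Real.sqrt (jumpSymbol (fracJump α δ) z) / (2 * z)))
      (𝓝[>] 0) (𝓝 (1 / 2)) := by
  have h := ((tendsto_jumpSymbol_div_zero hα0 hα1 hδ).sqrt).div_const 2
  rw [Real.sqrt_one] at h
  refine h.congr' ?_
  filter_upwards [self_mem_nhdsWithin] with z hz
  have hz0 : (0 : ℝ) < z := hz
  rw [Real.sqrt_div' _ hz0.le, ← Real.sqrt_eq_rpow]
  have h1 : 0 < Real.sqrt z := Real.sqrt_pos.2 hz0
  have h2 := Real.mul_self_sqrt hz0.le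
  rw [div_div, mul_div_assoc', div_eq_div_iff (by positivity) (by positivity)]
  linear_combination (-2 * Real.sqrt (jumpSymbol (fracJump α δ) z)) * h2

lemma tendsto_fundKernel_zero_of_laplaceTransform (hα0 : 0 < α) (hα1 : α < 1) (hδ : 0 < δ)
    {l : Filter ℝ} (hpos : ∀ᶠ z in l, 0 < z)
    (hscale : ∀ k : ℕ, Tendsto (fun z => ((k : ℝ) + 1) * z) l l) {ρ C : ℝ} (hρ : 0 < ρ)
    (hlim : Tendsto (fun z => z ^ ρ * (Real.sqrt (jumpSymbol (fracJump α δ) z) / (2 * z))) l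
      (𝓝 C)) :
    Tendsto (fun z => z ^ (ρ - 1) * fundKernel (fracJump α δ) δ 0 z⁻¹) l
      (𝓝 (C / Real.Gamma ρ)) := by
  have h := isJumpKernel_fracJump hα0 hα1 hδ
  refine tendsto_of_laplaceTransform h.antitoneOn_fundKernel_zero
    (fun t ht => h.fundKernel_nonneg 0 ht) (fun z hz => (h.laplaceTransform_fundKernel_zero hz).1)
    hpos hscale hρ (hlim.congr' ?_)
  filter_upwards [hpos] with z hz
  rw [(h.laplaceTransform_fundKernel_zero hz).2]

/-- Karamata at `z → ∞` with exponent `ρ = 1 - α / 2`, read at `t = 1 / z`. -/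
lemma tendsto_fundKernel_zero_small (hα0 : 0 < α) (hα1 : α < 1) (hδ : 0 < δ) :
    Tendsto (fun t => t ^ (α / 2) * fundKernel (fracJump α δ) δ 0 t) (𝓝[>] 0)
      (𝓝 (Real.sqrt (Real.Gamma (2 - α) / (4 * α * δ ^ (1 - α))) / Real.Gamma (1 - α / 2))) := by
  have h := tendsto_fundKernel_zero_of_laplaceTransform hα0 hα1 hδ (eventually_gt_atTop 0)
    (fun k => tendsto_id.const_mul_atTop (by positivity)) (by linarith : 0 < 1 - α / 2)
    (tendsto_rpow_mul_sqrt_jumpSymbol_atTop hα0 hα1 hδ)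
  refine (h.comp tendsto_inv_nhdsGT_zero).congr' ?_
  filter_upwards [self_mem_nhdsWithin] with t ht
  have ht0 : (0 : ℝ) < t := ht
  rw [Function.comp_apply, inv_inv, Real.inv_rpow ht0.le, ← Real.rpow_neg ht0.le]
  ring_nf

/-- Karamata at `z → 0` with `ρ = 1 / 2`; the constant is `(1 / 2) / Γ(1 / 2)` with `Γ(1 / 2) = √π`.
-/
lemma tendsto_fundKernel_zero_large (hα0 : 0 < α) (hα1 : α < 1) (hδ : 0 < δ) :
    Tendsto (fun t => t ^ (1 / 2 : ℝ) * fundKernel (fracJump α δ) δ 0 t) atTop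
      (𝓝 (1 / Real.sqrt (4 * Real.pi))) := by
  have hscale : ∀ k : ℕ, Tendsto (fun z : ℝ => ((k : ℝ) + 1) * z) (𝓝[>] 0) (𝓝[>] 0) := fun k => by
    refine tendsto_nhdsWithin_iff.2 ⟨?_, ?_⟩
    · have : Tendsto (fun z : ℝ => ((k : ℝ) + 1) * z) (𝓝 0) (𝓝 (((k : ℝ) + 1) * 0)) :=
        (continuous_const.mul continuous_id).tendsto 0
      rw [mul_zero] at this
      exact this.mono_left nhdsWithin_le_nhds
    · filter_upwards [self_mem_nhdsWithin] with z hz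
      exact mul_pos (by positivity : (0 : ℝ) < (k : ℝ) + 1) hz
  have h := tendsto_fundKernel_zero_of_laplaceTransform hα0 hα1 hδ self_mem_nhdsWithin hscale
    (by norm_num : (0 : ℝ) < 1 / 2) (tendsto_rpow_mul_sqrt_jumpSymbol_zero hα0 hα1 hδ)
  have h4 : Real.sqrt (4 * Real.pi) = 2 * Real.sqrt Real.pi := by
    rw [Real.sqrt_mul (by norm_num), show (4 : ℝ) = 2 ^ 2 by norm_num, Real.sqrt_sq (by norm_num)]
  rw [Real.Gamma_one_half_eq, div_div, ← h4] at h
  refine (h.comp tendsto_inv_atTop_nhdsGT_zero).congr' ?_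
  filter_upwards [eventually_gt_atTop 0] with t ht
  rw [Function.comp_apply, inv_inv, Real.inv_rpow ht.le, ← Real.rpow_neg ht.le]
  norm_num

end FundamentalSolution

end

theorem mainTheorem2 (α δ : ℝ) (hα0 : 0 < α) (hα1 : α < 1) (hδ : 0 < δ) :
    (∃ u : ℝ → ℝ → ℝ, IsFundamentalSolution δ (fracKernel α δ) u) ∧
    ∀ u : ℝ → ℝ → ℝ, IsFundamentalSolution δ (fracKernel α δ) u →
      -- the Laplace transform at `x = 0`, its monotonicity and its asymptotics
      (∀ z : ℝ, 0 < z →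
        IntegrableOn (fun t : ℝ => Real.exp (-z * t) * u 0 t) (Ioi 0) ∧
        laplaceTransform (u 0) z
          = Real.sqrt (memorySymbol δ (fracKernel α δ) z) / (2 * z)) ∧
      StrictAntiOn (laplaceTransform (u 0)) (Ioi 0) ∧
      IsEquivalent atTop (laplaceTransform (u 0))
        (fun z : ℝ => Real.sqrt (Real.Gamma (2 - α) / (4 * α * δ ^ (1 - α)))
          * z ^ (α / 2 - 1)) ∧
      IsEquivalent (𝓝[>] 0) (laplaceTransform (u 0))
        (fun z : ℝ => 1 / 2 * z ^ (-(1 / 2) : ℝ)) ∧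
      -- small times: the explicit constant, and the comparison with sub-diffusion
      IsEquivalent (𝓝[>] 0) (u 0)
        (fun t : ℝ => Real.sqrt (Real.Gamma (2 - α))
          / (Real.sqrt (4 * α * δ ^ (1 - α)) * Real.Gamma (1 - α / 2)) * t ^ (-(α / 2))) ∧
      IsEquivalent (𝓝[>] 0) (u 0)
        (fun t : ℝ => Real.sqrt (Real.Gamma (2 - α) * δ ^ (α - 1) / α)
          * subdiffusionKernel α 0 t) ∧
      -- large times: the explicit constant, and the comparison with the heat kernel
      IsEquivalent atTop (u 0) (fun t : ℝ => 1 / Real.sqrt (4 * Real.pi * t)) ∧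
      IsEquivalent atTop (u 0) (fun t : ℝ => heatKernel 0 t) := by
  refine ⟨⟨_, isFundamentalSolution_fundKernel hα0 hα1 hδ⟩, fun u hu => ?_⟩
  have hJ := isJumpKernel_fracJump hα0 hα1 hδ
  have hu0 : ∀ t, 0 < t → u 0 t = fundKernel (fracJump α δ) δ 0 t := fun t ht =>
    hu.eq_fundKernel hα0 hα1 hδ 0 ht
  have hexp : ∀ z : ℝ, EqOn (fun t => Real.exp (-z * t) * fundKernel (fracJump α δ) δ 0 t)
      (fun t => Real.exp (-z * t) * u 0 t) (Ioi 0) := fun z t ht => by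
    simp only [hu0 t ht]
  have hL : ∀ z : ℝ, 0 < z → laplaceTransform (u 0) z =
      Real.sqrt (jumpSymbol (fracJump α δ) z) / (2 * z) := fun z hz => by
    rw [← (hJ.laplaceTransform_fundKernel_zero hz).2]
    exact (setIntegral_congr_fun measurableSet_Ioi (hexp z)).symm
  have hΓ2 : 0 < Real.Gamma (2 - α) := Real.Gamma_pos_of_pos (by linarith)
  have hΓ : 0 < Real.Gamma (1 - α / 2) := Real.Gamma_pos_of_pos (by linarith)
  have hδα : 0 < δ ^ (1 - α) := Real.rpow_pos_of_pos hδ _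
  have hC : 0 < Real.sqrt (Real.Gamma (2 - α) / (4 * α * δ ^ (1 - α))) :=
    Real.sqrt_pos.2 (by positivity)
  have hpos : ∀ᶠ t : ℝ in 𝓝[>] 0, 0 < t := self_mem_nhdsWithin
  have hsmall := IsEquivalent.of_tendsto_mul_rpow (div_pos hC hΓ).ne' hpos
    ((tendsto_fundKernel_zero_small hα0 hα1 hδ).congr' <| by
      filter_upwards [hpos] with t ht
      rw [← hu0 t ht])
  have hlarge := IsEquivalent.of_tendsto_mul_rpow
    (one_div_pos.2 (Real.sqrt_pos.2 (by positivity : 0 < 4 * Real.pi))).ne'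
    (eventually_gt_atTop 0) ((tendsto_fundKernel_zero_large hα0 hα1 hδ).congr' <| by
      filter_upwards [eventually_gt_atTop 0] with t ht
      rw [← hu0 t ht])
  have hheat : IsEquivalent atTop (u 0) (fun t : ℝ => 1 / Real.sqrt (4 * Real.pi * t)) := by
    refine hlarge.congr_right ?_
    filter_upwards [eventually_gt_atTop 0] with t ht
    rw [Real.sqrt_mul' _ ht.le, Real.rpow_neg ht.le, ← Real.sqrt_eq_rpow]
    field_simp
  refine ⟨fun z hz => ⟨(hJ.laplaceTransform_fundKernel_zero hz).1.congr_fun (hexp z)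
    measurableSet_Ioi, ?_⟩, ?_, ?_, ?_, ?_, ?_, hheat, ?_⟩
  · rw [memorySymbol_fracKernel hα1 hδ, hL z hz]
  · exact hJ.strictAntiOn_sqrt_jumpSymbol_div.congr fun z hz => (hL z hz).symm
  · have h := IsEquivalent.of_tendsto_mul_rpow hC.ne' (eventually_gt_atTop 0)
      ((tendsto_rpow_mul_sqrt_jumpSymbol_atTop hα0 hα1 hδ).congr' <| by
        filter_upwards [eventually_gt_atTop 0] with z hz
        rw [← hL z hz])
    simpa only [neg_sub] using h
  · exact IsEquivalent.of_tendsto_mul_rpow (by norm_num) hpos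
      ((tendsto_rpow_mul_sqrt_jumpSymbol_zero hα0 hα1 hδ).congr' <| by
        filter_upwards [hpos] with z hz
        rw [← hL z hz])
  · rw [Real.sqrt_div hΓ2.le, div_div] at hsmall
    exact hsmall
  -- The factor `1 / 2` in the sub-diffusion kernel accounts for the `4` under the square root.
  · refine hsmall.congr_right (Eventually.of_forall fun t => ?_)
    simp only
    rw [subdiffusionKernel_zero, ← sqrt_Gamma_div_two hα0 hδ, show α - 1 = -(1 - α) by ring,
      Real.rpow_neg hδ.le, show Real.Gamma (2 - α) * (δ ^ (1 - α))⁻¹ / α =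
        Real.Gamma (2 - α) / (α * δ ^ (1 - α)) by field_simp]
    ring
  · simpa only [heatKernel_zero] using hheat
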